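/- **Setting.** A finite *arena* consists of a finite non-empty set $V=V_0\sqcup V_1$ of positions and a set $E\subseteq (V_0\times V_1)\cup(V_1\times V_0)$ of edges such that every position has an outgoing edge; the positions in $V_\sigma$ belong to Player $\sigma\in\{0,1\}$. A *play* is an infinite path $\rho=v_0,v_1,\dots$ in $(V,E)$, and $\mathrm{Inf}(\rho)$ is the set of positions that occur infinitely often in $\rho$. - A *Rabin* or *Streett game* $\mathcal G$ is an arena with pairs $(U_1,W_1),\dots,(U_k,W_k)$, $k\ge 0$, of subsets of $V$. In the Rabin game Player 0 wins $\rho$ iff for some $i$, $\mathrm{Inf}(\rho)\cap U_i\ne\emptyset$ and $\mathrm{Inf}(\rho)\cap W_i=\emptyset$. In the Streett game Player 0 wins $\rho$ iff for all $i$, $\mathrm{Inf}(\rho)\cap U_i\neq\emptyset$ implies $\mathrm{Inf}(\rho)\cap W_i\ne\emptyset$. - A *KL game* $\mathcal G$ is an arena with pairs $(u_1,S_1),\dots,(u_t,S_t)$, $t\ge 0$, where $u_i\in V$ and $S_i\subseteq V$. Player 0 wins $\rho$ iff for some $i$, $u_i\in\mathrm{Inf}(\rho)$ and $\mathrm{Inf}(\rho)\subseteq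 S_i$. Plays not won by Player 0 are won by Player 1. $Win_\sigma(\mathcal G)$ is the set of positions $v$ from which Player $\sigma$ has a (history-dependent) strategy that wins every play that starts at $v$ and is consistent with the strategy. Games are given to algorithms by explicitly listing $V$ (with the owner of each position), $E$ and the pairs (each set by its members); for a Rabin or Streett game the input also says which of the two it is. $|\mathcal G|$ is the size of this representation, i.e. $|V|+|E|+\sum_i(1+|U_i|+|W_i|)$, respectively $|V|+|E|+\sum_i(1+|S_i|)$. Algorithms are programs for a unit-cost random access machine; time is the number of primitive operations, and space is the number $S$ of memory cells, input included, where all registers and cells hold natural numbers less than $S$ (words of $O(\log S)$ bits). **Theorem.** 1. There exists an algorithm that, given a Rabin or Streett game $\mathcal G$ with index $k$, computes the partition of $V$ into $Win_0(\mathcal G)$ and $Win_1(\mathcal G)$ in time $O\big(|V|!\,|V|\,(|E|+k|V|)\big)$ and space $O\big(|\mathcal G|+|V|^2\big)$. 2. There exists an algorithm that, given a KL game $\mathcal G$ with index $t$, computes the partition of $V$ into $Win_0(\mathcal G)$ and $Win_1(\mathcal G)$ in time $O\big(|V|!\,|V|\,(|E|+t|V|)\big)$ and space $O\big(|\mathcal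 G|+|V|^2\big)$. The implied constants are absolute. -/

import Mathlib

namespace RegularGames

/-! ### Arenas, plays, strategies -/

/-- The two players are `0` and `1`. -/
abbrev Player := Fin 2

/-- An arena on the set `V` of positions: `owner v = σ` says that `v` is a position of Player `σ`;
edges lead from positions of one player to positions of the other, and every position has an
outgoing edge. -/
structure Arena (V : Type) where
  owner : V → Player
  edges : Finset (V × V)
  bipartite : ∀ e ∈ edges, owner e.1 ≠ owner e.2
  total : ∀ v, ∃ u, (v, u) ∈ edges

namespace Arena

variable {V : Type}

/-- A play is an infinite path in the arena. -/
def IsPlay (A : Arena V) (ρ : ℕ → V) : Prop :=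
  ∀ i, (ρ i, ρ (i + 1)) ∈ A.edges

/-- A strategy of Player `σ` receives an initial segment `v₀, …, vₖ` of a play that ends in a
position of Player `σ`, and returns a successor of `vₖ` (its values on other sequences play no
role). -/
structure Strategy (A : Arena V) (σ : Player) where
  move : (k : ℕ) → (Fin (k + 1) → V) → V
  legal : ∀ (k : ℕ) (h : Fin (k + 1) → V), A.owner (h (Fin.last k)) = σ →
    (h (Fin.last k), move k h) ∈ A.edges

/-- The sequence `ρ` is consistent with the strategy `s` of Player `σ`. -/
def Strategy.Consistent {A : Arena V} {σ : Player} (s : A.Strategy σ) (ρ : ℕ → V) : Prop :=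
  ∀ i, A.owner (ρ i) = σ → ρ (i + 1) = s.move i (fun j => ρ j)

end Arena

/-- The infinity set of a play: the positions that occur infinitely often. -/
def infSet {V : Type} (ρ : ℕ → V) : Set V :=
  {v | ∃ᶠ i in Filter.atTop, ρ i = v}

/-- Player 0 wins the play `ρ` if its infinity set satisfies `cond`; otherwise Player 1 wins. -/
def WinsPlay {V : Type} (cond : Set V → Prop) (σ : Player) (ρ : ℕ → V) : Prop :=
  if σ = 0 then cond (infSet ρ) else ¬ cond (infSet ρ)

/-- The winning region of Player `σ`: the positions from which some strategy of Player `σ` wins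
every play that is consistent with it. -/
def Arena.Win {V : Type} (A : Arena V) (cond : Set V → Prop) (σ : Player) : Set V :=
  {v | ∃ s : A.Strategy σ, ∀ ρ : ℕ → V, A.IsPlay ρ → ρ 0 = v → s.Consistent ρ →
    WinsPlay cond σ ρ}

/-! ### Rabin, Streett and KL games -/

/-- Which of the two winning conditions the pairs `(U, W)` stand for. -/
inductive PairKind
  | rabin
  | streett

/-- Player 0 wins if some pair `(U, W)` has `X ∩ U ≠ ∅` and `X ∩ W = ∅`. -/
def RabinCond {V : Type} (pairs : List (Finset V × Finset V)) (X : Set V) : Prop :=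
  ∃ p ∈ pairs, (X ∩ (p.1 : Set V)).Nonempty ∧ X ∩ (p.2 : Set V) = ∅

/-- Player 0 wins if for all pairs `(U, W)`, `X ∩ U ≠ ∅` implies `X ∩ W ≠ ∅`. -/
def StreettCond {V : Type} (pairs : List (Finset V × Finset V)) (X : Set V) : Prop :=
  ∀ p ∈ pairs, (X ∩ (p.1 : Set V)).Nonempty → (X ∩ (p.2 : Set V)).Nonempty

/-- Player 0 wins if some pair `(u, S)` has `u ∈ X` and `X ⊆ S`. -/
def KLCond {V : Type} (pairs : List (V × Finset V)) (X : Set V) : Prop :=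
  ∃ p ∈ pairs, p.1 ∈ X ∧ X ⊆ (p.2 : Set V)

/-- A Rabin or Streett game; the index is `pairs.length`. -/
structure PairGame (V : Type) where
  kind : PairKind
  arena : Arena V
  pairs : List (Finset V × Finset V)

/-- A KL game; the index is `pairs.length`. -/
structure KLGame (V : Type) where
  arena : Arena V
  pairs : List (V × Finset V)

/-- The winning region of Player `σ` in a Rabin or Streett game. -/
def PairGame.Win {V : Type} (G : PairGame V) (σ : Player) : Set V :=
  match G.kind with
  | .rabin => G.arena.Win (RabinCond G.pairs) σ
  | .streett => G.arena.Win (StreettCond G.pairs) σ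

/-- The winning region of Player `σ` in a KL game. -/
def KLGame.Win {V : Type} (G : KLGame V) (σ : Player) : Set V :=
  G.arena.Win (KLCond G.pairs) σ

/-! ### Explicit representation of games

The positions are `0, …, n - 1`.  Finite sets are listed without repetition, in any order. -/

/-- The size of the explicit representation: positions, edges, and for each pair `(U, W)` one
item for the pair itself and one for each member of `U` and of `W`. -/
def PairGame.size {n : ℕ} (G : PairGame (Fin n)) : ℕ :=
  n + G.arena.edges.card + (G.pairs.map fun p => 1 + p.1.card + p.2.card).sum

/-- The size of the explicit representation: positions, edges, and for each pair `(u, S)` one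
item for `u` and one for each member of `S`. -/
def KLGame.size {n : ℕ} (G : KLGame (Fin n)) : ℕ :=
  n + G.arena.edges.card + (G.pairs.map fun p => 1 + p.2.card).sum

/-- `l` lists the elements of `s`, each once. -/
def Lists {α : Type} (l : List α) (s : Finset α) : Prop :=
  l.Nodup ∧ ∀ x, x ∈ l ↔ x ∈ s

/-- A listed set is written as its cardinality followed by its elements. -/
def setCode {n : ℕ} (l : List (Fin n)) : List ℕ :=
  l.length :: l.map fun v => (v : ℕ)

/-- The owner of each position, followed by the two ends of each edge. -/
def arenaCode {n : ℕ} (A : Arena (Fin n)) (es : List (Fin n × Fin n)) : List ℕ :=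
  ((List.finRange n).map fun v => (A.owner v : ℕ)) ++
    es.flatMap fun e => [(e.1 : ℕ), (e.2 : ℕ)]

/-- The tag by which an input says whether it is a Rabin or a Streett game. -/
def PairKind.tag : PairKind → ℕ
  | .rabin => 0
  | .streett => 1

/-- `w` is an explicit representation of the Rabin or Streett game `G`. -/
def PairGame.IsCode {n : ℕ} (G : PairGame (Fin n)) (w : List ℕ) : Prop :=
  ∃ (es : List (Fin n × Fin n)) (ps : List (List (Fin n) × List (Fin n))),
    Lists es G.arena.edges ∧
    List.Forall₂ (fun l p => Lists l.1 p.1 ∧ Lists l.2 p.2) ps G.pairs ∧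
    w = [G.kind.tag, n, es.length, ps.length] ++ arenaCode G.arena es ++
      ps.flatMap fun l => setCode l.1 ++ setCode l.2

/-- `w` is an explicit representation of the KL game `G`. -/
def KLGame.IsCode {n : ℕ} (G : KLGame (Fin n)) (w : List ℕ) : Prop :=
  ∃ (es : List (Fin n × Fin n)) (ps : List (Fin n × List (Fin n))),
    Lists es G.arena.edges ∧
    List.Forall₂ (fun l p => l.1 = p.1 ∧ Lists l.2 p.2) ps G.pairs ∧
    w = [n, es.length, ps.length] ++ arenaCode G.arena es ++
      ps.flatMap fun l => (l.1 : ℕ) :: setCode l.2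

/-! ### Random access machines

A program uses finitely many registers and a random access memory.  On a machine of size `S` the
memory has the cells `0, …, S - 1`, and every register and every cell holds a word, that is, a
number below `S`.  A computation that leaves these limits is stuck.  Each primitive operation
takes one unit of time. -/

/-- Expressions; `mem a` is the content of the cell whose address is the value of `a`. -/
inductive Exp
  | lit (c : ℕ)
  | reg (i : ℕ)
  | mem (a : Exp)
  | add (a b : Exp)
  | sub (a b : Exp)
  | mul (a b : Exp)
  | lt (a b : Exp)
  | eq (a b : Exp)

/-- Programs of the machine. -/
inductive Prog
  | skip
  | set (i : ℕ) (e : Exp)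
  | store (a e : Exp)
  | seq (p q : Prog)
  | ite (e : Exp) (p q : Prog)
  | loop (e : Exp) (p : Prog)

/-- Contents of the registers and of the memory. -/
structure State where
  reg : ℕ → ℕ
  mem : ℕ → ℕ

/-- The state in which a computation on the input `w` starts: `w` stands in the first cells of
the memory, and everything else is `0`. -/
def State.start (w : List ℕ) : State where
  reg := fun _ => 0
  mem := fun a => w.getD a 0

/-- The number `x`, if it is a word of the machine of size `S`. -/
def fit (S x : ℕ) : Option ℕ :=
  if x < S then some x else none

/-- The value of an expression; undefined if a number outside the range of words comes up.
Subtraction is truncated at `0`; comparisons return `0` or `1`. -/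
def Exp.eval (S : ℕ) (s : State) : Exp → Option ℕ
  | .lit c => fit S c
  | .reg i => fit S (s.reg i)
  | .mem a => (a.eval S s).bind fun x => fit S (s.mem x)
  | .add a b => (a.eval S s).bind fun x => (b.eval S s).bind fun y => fit S (x + y)
  | .sub a b => (a.eval S s).bind fun x => (b.eval S s).bind fun y => fit S (x - y)
  | .mul a b => (a.eval S s).bind fun x => (b.eval S s).bind fun y => fit S (x * y)
  | .lt a b => (a.eval S s).bind fun x => (b.eval S s).bind fun y =>
      fit S (if x < y then 1 else 0)
  | .eq a b => (a.eval S s).bind fun x => (b.eval S s).bind fun y =>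
      fit S (if x = y then 1 else 0)

/-- The number of primitive operations in the evaluation of an expression. -/
def Exp.cost : Exp → ℕ
  | .lit _ => 1
  | .reg _ => 1
  | .mem a => a.cost + 1
  | .add a b => a.cost + b.cost + 1
  | .sub a b => a.cost + b.cost + 1
  | .mul a b => a.cost + b.cost + 1
  | .lt a b => a.cost + b.cost + 1
  | .eq a b => a.cost + b.cost + 1

/-- `Exec S p s s' t`: on the machine of size `S`, the program `p` started in the state `s` halts
in the state `s'` after `t` primitive operations. -/
inductive Exec (S : ℕ) : Prog → State → State → ℕ → Prop
  | skip (s : State) : Exec S .skip s s 1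
  | set (i : ℕ) (e : Exp) (s : State) (x : ℕ) (he : e.eval S s = some x) :
      Exec S (.set i e) s ⟨Function.update s.reg i x, s.mem⟩ (e.cost + 1)
  | store (a e : Exp) (s : State) (x y : ℕ) (ha : a.eval S s = some x)
      (he : e.eval S s = some y) :
      Exec S (.store a e) s ⟨s.reg, Function.update s.mem x y⟩ (a.cost + e.cost + 1)
  | seq (p q : Prog) (s s' s'' : State) (t t' : ℕ) (hp : Exec S p s s' t)
      (hq : Exec S q s' s'' t') : Exec S (.seq p q) s s'' (t + t')
  | ite_true (e : Exp) (p q : Prog) (s s' : State) (x t : ℕ) (he : e.eval S s = some x)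
      (hx : x ≠ 0) (hp : Exec S p s s' t) : Exec S (.ite e p q) s s' (e.cost + 1 + t)
  | ite_false (e : Exp) (p q : Prog) (s s' : State) (t : ℕ) (he : e.eval S s = some 0)
      (hq : Exec S q s s' t) : Exec S (.ite e p q) s s' (e.cost + 1 + t)
  | loop_true (e : Exp) (p : Prog) (s s' s'' : State) (x t t' : ℕ) (he : e.eval S s = some x)
      (hx : x ≠ 0) (hp : Exec S p s s' t) (hl : Exec S (.loop e p) s' s'' t') :
      Exec S (.loop e p) s s'' (e.cost + 1 + t + t')
  | loop_false (e : Exp) (p : Prog) (s : State) (he : e.eval S s = some 0) :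
      Exec S (.loop e p) s s (e.cost + 1)

/-- On the input `w`, the program `P` halts within time `T` on the machine of size `S` and outputs
the partition of the positions into the winning regions of the two players: for each `v < n`, the
cell `v` contains the number of the player in whose winning region `v` lies. -/
def Solves (P : Prog) (T S : ℕ) (w : List ℕ) {n : ℕ} (Win : Player → Set (Fin n)) : Prop :=
  ∃ (s : State) (t : ℕ), Exec S P (State.start w) s t ∧ t ≤ T ∧
    ∀ v : Fin n, s.mem v < 2 ∧ ∀ σ : Player, s.mem v = (σ : ℕ) ↔ v ∈ Win σ

end RegularGames

/-! Call `X` a sub-arena if each of its positions has a successor in `X`, and let `σ` be the player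
who wins the plays with infinity set `X`. For `v` in `X` remove the `σ`-attractor of `v`; the rest
`Y` is a smaller sub-arena, which is solved recursively.

Suppose that `σ` wins all of `Y` for every choice of `v`. Then `σ` wins all of `X`: the positions of
`X` are taken as targets in turn, each infinitely often. Inside the attractor of the current target
`σ` moves towards it; outside, `σ` follows the winning strategy of the smaller game. Either all
targets are hit, and the infinity set is `X`, or the play finally stays in one `Y` and a tail of it
is won there, which is enough because the winner depends on the infinity set only
(`Arena.winsOn_of_forall_diff_attractor`).

Suppose instead that the opponent `τ` wins a nonempty part `W` of some `Y`. As `σ` cannot leave `Y`,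
Player `τ` wins `W` within `X` too, hence also the `τ`-attractor `D` of `W`, and it remains to solve
`X \ D` (`Arena.Solved.step`). Determinacy is not presupposed: the recursion produces strategies for
both players, and disjointness of the winning regions (`Arena.win_disjoint`) does the rest. The
three kinds of games differ only in the test which player wins with a given infinity set.

Edges change the owner, so a nonempty winning region has at least two positions. A sub-arena with
`m` positions thus leads to at most `m` calls on at most `m - 1` positions and one final call on at
most `m - 2`. The recurrence `T m = m * T (m - 1) + T (m - 2) + O(m)` has solutions of order `m!`
(`nodeTime_bound`), whereas a final call on `m - 1` positions would only give `(m + 1)!`. One step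
costs a constant number of attractors, each found by `n` rounds over all edges, and of tests of all
pairs, which fits into `O(n (|E| + k n))`.

The recursion is run as one loop over a stack of frames with `n + 2` cells each; the final call on
`X \ D` reuses the frame of `X`. Hence `O(n)` frames and `O(n ^ 2)` cells suffice beyond the input.
`runs_mainLoop` joins the game argument to the machine, and `solves_solveProg` adds input and
output. -/

namespace RegularGames

/-! ### Histories and winning inside a sub-arena -/

section Games

variable {V : Type}

/-- The play `ρ` from time `τ` on. -/
def shift (τ : ℕ) (ρ : ℕ → V) : ℕ → V := fun i => ρ (τ + i)

theorem infSet_shift (τ : ℕ) (ρ : ℕ → V) : infSet (shift τ ρ) = infSet ρ := by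
  ext v
  simp only [infSet, shift, Set.mem_ofPred_eq, Filter.frequently_atTop]
  constructor
  · intro h a
    obtain ⟨b, hb, e⟩ := h a
    exact ⟨τ + b, by omega, e⟩
  · intro h a
    obtain ⟨b, hb, e⟩ := h (τ + a)
    exact ⟨b - τ, by omega, by rwa [Nat.add_sub_cancel' (by omega)]⟩

theorem winsPlay_shift {cond : Set V → Prop} {σ : Player} (τ : ℕ) (ρ : ℕ → V) :
    WinsPlay cond σ (shift τ ρ) ↔ WinsPlay cond σ ρ := by
  simp [WinsPlay, infSet_shift]

/-- The history of `ρ` at time `t`, latest position first. -/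
def hist (ρ : ℕ → V) : ℕ → List V
  | 0 => [ρ 0]
  | t + 1 => ρ (t + 1) :: hist ρ t

theorem hist_eq_cons (ρ : ℕ → V) (t : ℕ) : ∃ h, hist ρ t = ρ t :: h := by
  cases t <;> exact ⟨_, rfl⟩

theorem mem_hist {ρ : ℕ → V} {t : ℕ} {v : V} : v ∈ hist ρ t ↔ ∃ i ≤ t, ρ i = v := by
  induction t with
  | zero => simp [hist, eq_comm]
  | succ t ih =>
    simp only [hist, List.mem_cons, ih]
    constructor
    · rintro (rfl | ⟨i, hi, rfl⟩)
      · exact ⟨t + 1, le_rfl, rfl⟩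
      · exact ⟨i, by omega, rfl⟩
    · rintro ⟨i, hi, rfl⟩
      rcases Nat.lt_or_ge t i with h | h
      · left; congr 1; omega
      · exact Or.inr ⟨i, h, rfl⟩

theorem hist_eq_reverse_ofFn (ρ : ℕ → V) (t : ℕ) :
    (List.ofFn fun j : Fin (t + 1) => ρ j).reverse = hist ρ t := by
  induction t with
  | zero => simp [hist]
  | succ t ih =>
    rw [List.ofFn_succ', List.concat_eq_append, List.reverse_append]
    simp only [List.reverse_cons, List.reverse_nil, List.nil_append, List.singleton_append, hist]
    congr 1

/-- `ρ` is a play inside `X` that is consistent with the strategy `f` of Player `σ`. -/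
structure Arena.PlayIn (A : Arena V) (X : Set V) (σ : Player) (f : List V → V) (ρ : ℕ → V) :
    Prop where
  mem : ∀ i, ρ i ∈ X
  edge : A.IsPlay ρ
  cons : ∀ i, A.owner (ρ i) = σ → ρ (i + 1) = f (hist ρ i)

/-- The strategy `f` of Player `σ` makes legal moves to `X` from the positions in `Y`. -/
def Arena.Legal (A : Arena V) (Y X : Set V) (σ : Player) (f : List V → V) : Prop :=
  ∀ v h, v ∈ Y → A.owner v = σ → f (v :: h) ∈ X ∧ (v, f (v :: h)) ∈ A.edges

/-- Player `σ` wins from all positions in `W` if the game is played inside `X`. -/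
def Arena.WinsOn (A : Arena V) (cond : Set V → Prop) (X : Set V) (σ : Player) (W : Set V) :
    Prop :=
  W ⊆ X ∧ ∃ f, A.Legal X X σ f ∧ ∀ ρ, A.PlayIn X σ f ρ → ρ 0 ∈ W → WinsPlay cond σ ρ

/-- Every position in `X` has a successor in `X`. -/
def Arena.IsSub (A : Arena V) (X : Set V) : Prop :=
  ∀ v ∈ X, ∃ u ∈ X, (v, u) ∈ A.edges

theorem Arena.IsSub.exists_legal {A : Arena V} {X : Set V} (hX : A.IsSub X) :
    ∃ g : V → V, ∀ v ∈ X, g v ∈ X ∧ (v, g v) ∈ A.edges := by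
  classical
  choose! g hg using hX
  exact ⟨g, hg⟩

/-- The function on histories that applies `g` to the last position. -/
noncomputable def positional [Nonempty V] (g : V → V) : List V → V
  | [] => Classical.arbitrary V
  | v :: _ => g v

theorem positional_hist [Nonempty V] (g : V → V) (ρ : ℕ → V) (t : ℕ) :
    positional g (hist ρ t) = g (ρ t) := by
  obtain ⟨h, e⟩ := hist_eq_cons ρ t
  rw [e, positional]

/-! ### Combining strategies -/

open Classical in
/-- The last part of a history on which the label is constant. -/
noncomputable def segment {Λ : Type} (lab : List V → Λ) : List V → List V
  | [] => []
  | v :: h => if lab (v :: h) = lab h then v :: segment lab h else [v]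

theorem segment_cons {Λ : Type} (lab : List V → Λ) (v : V) (h : List V) :
    ∃ h', segment lab (v :: h) = v :: h' := by
  unfold segment
  split_ifs
  exacts [⟨_, rfl⟩, ⟨_, rfl⟩]

/-- As long as the label does not change after time `τ`, the segment is the history of the tail of
the play that starts at `τ`. A strategy that takes over at `τ` therefore sees a fresh play. -/
theorem segment_hist {Λ : Type} {lab : List V → Λ} {ρ : ℕ → V} {τ : ℕ}
    (h0 : τ = 0 ∨ lab (hist ρ τ) ≠ lab (hist ρ (τ - 1))) (t : ℕ)
    (hc : ∀ j ≤ t, lab (hist ρ (τ + j)) = lab (hist ρ τ)) :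
    segment lab (hist ρ (τ + t)) = hist (shift τ ρ) t := by
  induction t with
  | zero =>
    rcases τ with _ | τ
    · simp [hist, segment, shift]
    · have h1 : lab (ρ (τ + 1) :: hist ρ τ) ≠ lab (hist ρ τ) := by simpa [hist] using h0
      simp [hist, segment, shift, h1]
  | succ t ih =>
    have h1 := hc (t + 1) le_rfl
    rw [← hc t (by omega)] at h1
    have h2 : hist ρ (τ + (t + 1)) = ρ (τ + (t + 1)) :: hist ρ (τ + t) := rfl
    rw [h2] at h1 ⊢
    rw [segment, if_pos h1, ih fun j hj => hc j (by omega)]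
    rfl

/-- If the label is constant from time `N` on, then the play follows the strategy for that label
from the time `τ` at which the label was last changed. -/
theorem exists_follows {Λ : Type} {A : Arena V} {X : Set V} {σ : Player} {lab : List V → Λ}
    {s : Λ → List V → V} {ρ : ℕ → V}
    (hρ : A.PlayIn X σ (fun h => s (lab h) (segment lab h)) ρ) {l : Λ} {N : ℕ}
    (hN : ∀ t, N ≤ t → lab (hist ρ t) = l) :
    ∃ τ ≤ N, (∀ t, τ ≤ t → lab (hist ρ t) = l) ∧ (τ = 0 ∨ lab (hist ρ (τ - 1)) ≠ l) ∧
      ∀ i, A.owner (shift τ ρ i) = σ → shift τ ρ (i + 1) = s l (hist (shift τ ρ) i) := by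
  classical
  have hex : ∃ N, ∀ t, N ≤ t → lab (hist ρ t) = l := ⟨N, hN⟩
  have h1 := Nat.find_spec hex
  have h2 : Nat.find hex = 0 ∨ lab (hist ρ (Nat.find hex - 1)) ≠ l := by
    by_contra! hcon
    refine Nat.find_min hex (m := Nat.find hex - 1) (by omega) fun t ht => ?_
    rcases Nat.eq_or_lt_of_le ht with rfl | h
    · exact hcon.2
    · exact h1 t (by omega)
  refine ⟨Nat.find hex, Nat.find_min' hex hN, h1, h2, fun i hi => ?_⟩
  have h3 := hρ.cons (Nat.find hex + i) hi
  rw [segment_hist (by rw [h1 _ le_rfl]; exact h2.imp_right Ne.symm) i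
    (fun j _ => by rw [h1 _ (by omega), h1 _ le_rfl]), h1 _ (by omega)] at h3
  exact h3

theorem Arena.IsPlay.shift {A : Arena V} {ρ : ℕ → V} (h : A.IsPlay ρ) (τ : ℕ) :
    A.IsPlay (shift τ ρ) := fun i => h (τ + i)

/-- A player who wins from `D`, and from `W` as long as `D` is not reached, wins from both. -/
theorem Arena.WinsOn.union {A : Arena V} {cond : Set V → Prop} {X D W : Set V} {σ : Player}
    (hD : A.WinsOn cond X σ D) (hW : W ⊆ X) {g : List V → V} (hg : A.Legal (X \ D) X σ g)
    (hwin : ∀ ρ, A.PlayIn (X \ D) σ g ρ → ρ 0 ∈ W → WinsPlay cond σ ρ) :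
    A.WinsOn cond X σ (D ∪ W) := by
  classical
  obtain ⟨hDX, f, hf, hfw⟩ := hD
  -- The label tells whether `D` has been visited. It changes at most once, so it is eventually
  -- constant on every play.
  let lab : List V → Prop := fun h => ∃ v ∈ h, v ∈ D
  let s : Prop → List V → V := fun l => if l then f else g
  refine ⟨Set.union_subset hDX hW, fun h => s (lab h) (segment lab h), ?_, ?_⟩
  · intro v h hv ho
    obtain ⟨h', e⟩ := segment_cons lab v h
    simp only [e]
    by_cases hl : lab (v :: h)
    · simpa [s, hl] using hf v h' hv ho
    · have : v ∉ D := fun hv => hl ⟨v, by simp, hv⟩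
      simpa [s, hl] using hg v h' ⟨hv, this⟩ ho
  · intro ρ hρ h0
    by_cases hvis : ∃ N, ρ N ∈ D
    · obtain ⟨N, hN⟩ := hvis
      have hl : ∀ t, N ≤ t → lab (hist ρ t) = True := fun t ht =>
        eq_true ⟨ρ N, mem_hist.2 ⟨N, ht, rfl⟩, hN⟩
      obtain ⟨τ, -, h1, h2, h3⟩ := exists_follows hρ hl
      rw [← winsPlay_shift τ]
      refine hfw _ ⟨fun i => hρ.mem _, hρ.edge.shift τ, ?_⟩ ?_
      · intro i hi
        simpa [s] using h3 i hi
      · have h4 : lab (hist ρ τ) := by rw [h1 τ le_rfl]; trivial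
        obtain ⟨v, hv, hvD⟩ := h4
        obtain ⟨i, hi, rfl⟩ := mem_hist.1 hv
        -- The label last changed at the first visit to `D`, so the tail on which `f` is followed
        -- starts in `D`.
        have : i = τ := by
          by_contra hne
          rcases h2 with h2 | h2
          · omega
          · exact h2 (eq_true ⟨ρ i, mem_hist.2 ⟨i, by omega, rfl⟩, hvD⟩)
        subst this
        exact hvD
    · push Not at hvis
      have hl : ∀ t, 0 ≤ t → lab (hist ρ t) = False := fun t _ => by
        refine eq_false ?_
        rintro ⟨v, hv, hvD⟩
        obtain ⟨i, -, rfl⟩ := mem_hist.1 hv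
        exact hvis i hvD
      obtain ⟨τ, hτ, -, -, h3⟩ := exists_follows hρ hl
      obtain rfl : τ = 0 := by omega
      have e : shift 0 ρ = ρ := by funext i; simp [RegularGames.shift]
      rw [e] at h3
      refine hwin ρ ⟨fun i => ⟨hρ.mem i, hvis i⟩, hρ.edge, fun i hi => ?_⟩
        (h0.resolve_left (hvis 0))
      simpa [s] using h3 i hi

/-! ### Attractors -/

/-- The positions in `X` from which Player `τ` can force a visit to `T` in at most `j` moves. -/
def Arena.attr (A : Arena V) (X : Set V) (τ : Player) (T : Set V) : ℕ → Set V
  | 0 => T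
  | j + 1 => A.attr X τ T j ∪ {v | v ∈ X ∧
      ((A.owner v = τ ∧ ∃ u ∈ A.attr X τ T j, (v, u) ∈ A.edges) ∨
       (A.owner v ≠ τ ∧ ∀ u ∈ X, (v, u) ∈ A.edges → u ∈ A.attr X τ T j))}

variable {A : Arena V} {X T : Set V} {τ : Player}

theorem Arena.attr_mono : Monotone (A.attr X τ T) :=
  monotone_nat_of_le_succ fun _ => Set.subset_union_left

theorem Arena.attr_subset (hT : T ⊆ X) (j : ℕ) : A.attr X τ T j ⊆ X := by
  induction j with
  | zero => exact hT
  | succ j ih => exact Set.union_subset ih fun v hv => hv.1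

/-- The stages form an increasing chain of subsets of a finite set, and once two successive stages
agree all later ones do. Hence `Fintype.card V` rounds reach the fixed point, which yields the two
closure properties of the attractor below. -/
theorem Arena.attr_succ_card [Fintype V] :
    A.attr X τ T (Fintype.card V + 1) = A.attr X τ T (Fintype.card V) := by
  have hst : ∀ m, A.attr X τ T m = A.attr X τ T (m + 1) →
      A.attr X τ T (m + 1) = A.attr X τ T (m + 2) := by
    intro m h
    conv_rhs => rw [attr, ← h]
    rfl
  have hfin : ∀ m, (A.attr X τ T m).Finite := fun m => Set.toFinite _
  have key : ∀ m, (A.attr X τ T m).ncard = (A.attr X τ T (m + 1)).ncard →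
      A.attr X τ T m = A.attr X τ T (m + 1) := fun m h =>
    Set.eq_of_subset_of_ncard_le (attr_mono (Nat.le_succ m)) h.ge
  have h1 := Nat.stabilises_of_monotone (f := fun m => (A.attr X τ T m).ncard)
    (b := Fintype.card V) (n := Fintype.card V + 1)
    (fun i j hij => Set.ncard_le_ncard (attr_mono hij))
    (fun m => by
      rw [← Nat.card_eq_fintype_card, ← Set.ncard_univ]
      exact Set.ncard_le_ncard (Set.subset_univ _))
    (fun m h => by
      have := hst m (key m h)
      simp only [← this]) (Nat.le_succ _)
  exact (key _ h1.symm).symm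

/-- The attractor: the positions from which Player `τ` can force a visit to `T` inside `X`. -/
def Arena.attractor [Fintype V] (A : Arena V) (X : Set V) (τ : Player) (T : Set V) : Set V :=
  A.attr X τ T (Fintype.card V)

theorem Arena.subset_attractor [Fintype V] : T ⊆ A.attractor X τ T :=
  Arena.attr_mono (Nat.zero_le _)

theorem Arena.attractor_subset [Fintype V] (hT : T ⊆ X) : A.attractor X τ T ⊆ X :=
  Arena.attr_subset hT _

theorem Arena.mem_attractor_of_owner [Fintype V] {v u : V} (hv : v ∈ X) (ho : A.owner v = τ)
    (hu : u ∈ A.attractor X τ T) (he : (v, u) ∈ A.edges) : v ∈ A.attractor X τ T := by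
  unfold attractor at hu ⊢
  rw [← attr_succ_card]
  exact Or.inr ⟨hv, Or.inl ⟨ho, u, hu, he⟩⟩

theorem Arena.mem_attractor_of_forall [Fintype V] {v : V} (hv : v ∈ X) (ho : A.owner v ≠ τ)
    (h : ∀ u ∈ X, (v, u) ∈ A.edges → u ∈ A.attractor X τ T) : v ∈ A.attractor X τ T := by
  unfold attractor at h ⊢
  rw [← attr_succ_card]
  exact Or.inr ⟨hv, Or.inr ⟨ho, h⟩⟩

/-- Outside an attractor one can stay outside. -/
theorem Arena.IsSub.diff_attractor [Fintype V] (hX : A.IsSub X) :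
    A.IsSub (X \ A.attractor X τ T) := by
  rintro v ⟨hv, hvA⟩
  by_cases ho : A.owner v = τ
  · obtain ⟨u, hu, he⟩ := hX v hv
    exact ⟨u, ⟨hu, fun h => hvA (mem_attractor_of_owner hv ho h he)⟩, he⟩
  · by_contra! hcon
    refine hvA (mem_attractor_of_forall hv ho fun u hu he => ?_)
    by_contra huA
    exact hcon u ⟨hu, huA⟩ he

/-- A positional strategy by which Player `τ` forces a visit to `T` from the attractor. -/
theorem Arena.IsSub.exists_attract [Fintype V] (hX : A.IsSub X) (hT : T ⊆ X) :
    ∃ g : V → V, (∀ v ∈ X, g v ∈ X ∧ (v, g v) ∈ A.edges) ∧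
      ∀ ρ : ℕ → V, (∀ i, ρ i ∈ X) → A.IsPlay ρ → ∀ t, ρ t ∈ A.attractor X τ T →
        (∀ i, t ≤ i → ρ i ∈ A.attractor X τ T → A.owner (ρ i) = τ → ρ (i + 1) = g (ρ i)) →
        ∃ i, t ≤ i ∧ ρ i ∈ T := by
  classical
  obtain ⟨g₀, hg₀⟩ := hX.exists_legal
  -- The rank of a position is the stage at which it enters the attractor; a good move leads to a
  -- smaller rank. Where there is no such move, `g` only has to be legal.
  let P : V → V → Prop := fun v u => (v, u) ∈ A.edges ∧
    ∃ j, v ∈ A.attr X τ T (j + 1) ∧ v ∉ A.attr X τ T j ∧ u ∈ A.attr X τ T j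
  let g : V → V := fun v => if h : ∃ u, P v u then h.choose else g₀ v
  have hgP : ∀ v, (∃ u, P v u) → P v (g v) := fun v h => by
    simp only [g, dif_pos h]
    exact h.choose_spec
  refine ⟨g, fun v hv => ?_, ?_⟩
  · by_cases h : ∃ u, P v u
    · obtain ⟨he, j, -, -, hj⟩ := hgP v h
      exact ⟨attr_subset hT j hj, he⟩
    · simp only [g, dif_neg h]
      exact hg₀ v hv
  · intro ρ hρ hplay
    suffices H : ∀ j, j ≤ Fintype.card V → ∀ t, ρ t ∈ A.attr X τ T j →
        (∀ i, t ≤ i → ρ i ∈ A.attractor X τ T → A.owner (ρ i) = τ → ρ (i + 1) = g (ρ i)) →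
        ∃ i, t ≤ i ∧ ρ i ∈ T from fun t h => H _ le_rfl t h
    intro j
    induction j with
    | zero => exact fun _ t h _ => ⟨t, le_rfl, h⟩
    | succ j ih =>
      intro hj t ht hc
      by_cases htj : ρ t ∈ A.attr X τ T j
      · exact ih (by omega) t htj hc
      · have hnext : ρ (t + 1) ∈ A.attr X τ T j := by
          rcases ht with ht | ⟨hX', ⟨ho, u, hu, he⟩ | ⟨ho, hall⟩⟩
          · exact absurd ht htj
          · rw [hc t le_rfl (attr_mono hj (Or.inr ⟨hX', Or.inl ⟨ho, u, hu, he⟩⟩)) ho]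
            obtain ⟨-, j', h1, h2, h3⟩ :=
              hgP (ρ t) ⟨u, he, j, Or.inr ⟨hX', Or.inl ⟨ho, u, hu, he⟩⟩, htj, hu⟩
            refine attr_mono (a := j') ?_ h3
            by_contra hlt
            exact h2 (attr_mono (by omega : j + 1 ≤ j') (Or.inr ⟨hX', Or.inl ⟨ho, u, hu, he⟩⟩))
          · exact hall _ (hρ _) (hplay t)
        obtain ⟨i, hi, hiT⟩ := ih (by omega) (t + 1) hnext fun i hi => hc i (by omega)
        exact ⟨i, by omega, hiT⟩

/-! ### The recursion for winning regions -/

variable {cond : Set V → Prop} {σ : Player}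

/-- Winning regions of a part of `X` that the opponent cannot leave are won in `X`. -/
theorem Arena.WinsOn.of_trap {Y W : Set V} (hX : A.IsSub X) (hYX : Y ⊆ X)
    (hW : A.WinsOn cond Y σ W)
    (htrap : ∀ v ∈ Y, A.owner v ≠ σ → ∀ u ∈ X, (v, u) ∈ A.edges → u ∈ Y) :
    A.WinsOn cond X σ W := by
  classical
  by_cases hne : Nonempty V
  swap
  · have h : ∀ v : V, False := fun v => hne ⟨v⟩
    -- Without positions, the only thing needed is some function `List V → V`; its value on the
    -- empty list is borrowed from the hypothesis.
    exact ⟨fun v => (h v).elim, fun l => by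
      cases l with
      | nil => exact (hW.2.choose [])
      | cons v _ => exact v, fun v => (h v).elim, fun ρ => (h (ρ 0)).elim⟩
  obtain ⟨g₀, hg₀⟩ := hX.exists_legal
  obtain ⟨hWY, f, hf, hwin⟩ := hW
  refine ⟨hWY.trans hYX, fun h => if ∃ v ∈ h.head?, v ∈ Y then f h else positional g₀ h, ?_, ?_⟩
  · intro v h hv ho
    by_cases hvY : v ∈ Y
    · have := hf v h hvY ho
      simpa [hvY] using ⟨hYX this.1, this.2⟩
    · simpa [hvY, positional] using hg₀ v hv
  · intro ρ hρ h0
    have hcons : ∀ i, ρ i ∈ Y → A.owner (ρ i) = σ → ρ (i + 1) = f (hist ρ i) := by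
      intro i hi ho
      have := hρ.cons i ho
      obtain ⟨h, e⟩ := hist_eq_cons ρ i
      simpa [e, hi] using this
    have hY : ∀ i, ρ i ∈ Y := by
      intro i
      induction i with
      | zero => exact hWY h0
      | succ i ih =>
        by_cases ho : A.owner (ρ i) = σ
        · rw [hcons i ih ho]
          obtain ⟨h, e⟩ := hist_eq_cons ρ i
          rw [e]
          exact (hf _ h ih ho).1
        · exact htrap _ ih ho _ (hρ.mem _) (hρ.edge i)
    exact hwin ρ ⟨hY, hρ.edge, fun i ho => hcons i (hY i) ho⟩ h0

/-- Attract to `W`, then follow the winning strategy. A play that starts in the attractor and avoids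
`W` forever contradicts the attraction, so the second requirement of `Arena.WinsOn.union` holds
vacuously. -/
theorem Arena.WinsOn.attractor [Fintype V] {W : Set V} (hX : A.IsSub X)
    (hW : A.WinsOn cond X σ W) : A.WinsOn cond X σ (A.attractor X σ W) := by
  by_cases hne : Nonempty V
  swap
  · have : A.attractor X σ W = W := Set.ext fun v => (hne ⟨v⟩).elim
    rwa [this]
  obtain ⟨g, hg, hreach⟩ := hX.exists_attract (A := A) (τ := σ) hW.1
  have := hW.union (W := A.attractor X σ W) (g := positional g) (attractor_subset hW.1)
    (fun v h hv ho => hg v hv.1) (fun ρ hρ h0 => by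
      obtain ⟨i, -, hi⟩ := hreach ρ (fun i => (hρ.mem i).1) hρ.edge 0 h0 fun i _ _ ho => by
        rw [hρ.cons i ho, positional_hist]
      exact absurd hi (hρ.mem i).2)
  rwa [Set.union_eq_self_of_subset_left subset_attractor] at this

theorem Arena.WinsOn.union_diff {D W : Set V} (hD : A.WinsOn cond X σ D)
    (hW : A.WinsOn cond (X \ D) σ W) : A.WinsOn cond X σ (D ∪ W) := by
  obtain ⟨hWX, g, hg, hwin⟩ := hW
  exact hD.union (hWX.trans Set.sdiff_subset)
    (fun v h hv ho => ⟨(hg v h hv ho).1.1, (hg v h hv ho).2⟩) hwin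

theorem Arena.winsOn_empty [Nonempty V] (hX : A.IsSub X) : A.WinsOn cond X σ ∅ := by
  obtain ⟨g, hg⟩ := hX.exists_legal
  exact ⟨Set.empty_subset _, positional g, fun v h hv _ => hg v hv, fun ρ _ h => h.elim⟩

theorem exists_cofinal_enumeration [Countable V] (hX : X.Nonempty) :
    ∃ e : ℕ → V, (∀ i, e i ∈ X) ∧ ∀ v ∈ X, ∀ N, ∃ i, N ≤ i ∧ e i = v := by
  have := hX.to_subtype
  obtain ⟨g, hg⟩ := exists_surjective_nat X
  -- The second component of the pairing function makes each value recur at arbitrarily large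
  -- indices.
  refine ⟨fun i => g (Nat.unpair i).1, fun i => (g _).2, fun v hv N => ?_⟩
  obtain ⟨a, ha⟩ := hg ⟨v, hv⟩
  exact ⟨Nat.pair a N, Nat.right_le_pair a N, by simp [ha]⟩

open Classical in
/-- The number of targets `e 0, e 1, …` that have been visited one after the other. -/
noncomputable def targetsHit (e : ℕ → V) : List V → ℕ
  | [] => 0
  | v :: h => if v = e (targetsHit e h) then targetsHit e h + 1 else targetsHit e h

/-- A player who wins if all of `X` is visited infinitely often, and who wins everywhere outside
the attractor of each single position, wins from everywhere. -/
theorem Arena.winsOn_of_forall_diff_attractor [Fintype V] [Nonempty V] (hX : A.IsSub X)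
    (hcond : if σ = 0 then cond X else ¬ cond X)
    (h : ∀ v ∈ X, A.WinsOn cond (X \ A.attractor X σ {v}) σ (X \ A.attractor X σ {v})) :
    A.WinsOn cond X σ X := by
  classical
  rcases X.eq_empty_or_nonempty with rfl | hne
  · exact winsOn_empty hX
  obtain ⟨e, heX, he⟩ := exists_cofinal_enumeration hne
  choose! f hf using fun v hv => (h v hv).2
  choose! g hg using fun v (hv : v ∈ X) =>
    hX.exists_attract (A := A) (τ := σ) (Set.singleton_subset_iff.2 hv)
  -- The label consists of the index of the current target and of whether the play is now inside its
  -- attractor; it selects between attracting and the strategy for the rest.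
  let lab : List V → ℕ × Prop := fun h =>
    (targetsHit e h, ∃ v ∈ h.head?, v ∈ A.attractor X σ {e (targetsHit e h)})
  let s : ℕ × Prop → List V → V := fun l =>
    if l.2 then positional (g (e l.1)) else f (e l.1)
  refine ⟨subset_rfl, fun h => s (lab h) (segment lab h), ?_, ?_⟩
  · intro v h hv ho
    obtain ⟨h', e'⟩ := segment_cons lab v h
    simp only [e']
    by_cases hl : v ∈ A.attractor X σ {e (targetsHit e (v :: h))}
    · simpa [s, lab, hl, positional] using (hg _ (heX (targetsHit e (v :: h)))).1 v hv
    · have := (hf _ (heX (targetsHit e (v :: h)))).1 v h' ⟨hv, hl⟩ ho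
      simpa [s, lab, hl] using ⟨this.1.1, this.2⟩
  intro ρ hρ _
  set I : ℕ → ℕ := fun t => targetsHit e (hist ρ t) with hI
  have hstep : ∀ t, I (t + 1) = if ρ (t + 1) = e (I t) then I t + 1 else I t := fun t => rfl
  have hmono : Monotone I := monotone_nat_of_le_succ fun t => by
    rw [hstep]; split_ifs <;> omega
  by_cases hunb : ∀ B, ∃ t, B < I t
  · have hinf : infSet ρ = X := by
      ext v
      simp only [infSet, Set.mem_ofPred_eq, Filter.frequently_atTop]
      constructor
      · intro hv
        obtain ⟨b, -, rfl⟩ := hv 0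
        exact hρ.mem b
      · intro hv N
        -- Choose an index of `v` among the targets that have not been hit by time `N`. The moment
        -- at which the count first exceeds this index is a visit to `v` after `N`.
        obtain ⟨i, hi, rfl⟩ := he v hv (I N)
        have hex := hunb i
        have h1 := Nat.find_spec hex
        have h2 : N < Nat.find hex := by
          by_contra hlt
          have := hmono (not_lt.1 hlt)
          omega
        obtain ⟨t, ht⟩ : ∃ t, Nat.find hex = t + 1 := ⟨Nat.find hex - 1, by omega⟩
        have h3 := Nat.find_min hex (m := t) (by omega)
        rw [ht, hstep] at h1
        split_ifs at h1 with hc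
        · exact ⟨t + 1, by omega, by rw [hc]; congr 1; omega⟩
        · omega
    rw [WinsPlay, hinf]
    exact hcond
  · push Not at hunb
    obtain ⟨B, hB⟩ := hunb
    obtain ⟨N, hN⟩ : ∃ N, ∀ t, N ≤ t → I t = I N := by
      have hbdd : BddAbove (Set.range I) := ⟨B, by rintro _ ⟨t, rfl⟩; exact hB t⟩
      obtain ⟨N, hN⟩ := Nat.sSup_mem (Set.range_nonempty I) hbdd
      refine ⟨N, fun t ht => le_antisymm ?_ (hmono ht)⟩
      rw [hN]
      exact le_csSup hbdd ⟨t, rfl⟩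
    have hmiss : ∀ t, N < t → ρ t ≠ e (I N) := by
      intro t ht hc
      obtain ⟨t, rfl⟩ : ∃ t', t = t' + 1 := ⟨t - 1, by omega⟩
      have h1 := hstep t
      rw [hN t (by omega), hN (t + 1) (by omega), if_pos hc] at h1
      omega
    have hlab : ∀ t, N ≤ t → lab (hist ρ t) = (I N, ρ t ∈ A.attractor X σ {e (I N)}) := by
      intro t ht
      obtain ⟨h', e'⟩ := hist_eq_cons ρ t
      have h1 : targetsHit e (hist ρ t) = I N := hN t ht
      simp only [lab, h1]
      simp [e']
    -- Once the target is fixed for good, entering its attractor would force a hit of the target,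
    -- that is, another change of the count.
    have hout : ∀ t, N < t → ρ t ∉ A.attractor X σ {e (I N)} := by
      intro t ht hmem
      obtain ⟨i, hi, hiT⟩ := (hg _ (heX (I N))).2 ρ hρ.mem hρ.edge t hmem fun i hi hiA ho => by
        have h1 := hρ.cons i ho
        obtain ⟨h', e'⟩ := hist_eq_cons ρ i
        obtain ⟨h'', e''⟩ := segment_cons lab (ρ i) h'
        simp only [hlab i (by omega)] at h1
        rw [e', e''] at h1
        simpa [s, hiA, positional] using h1
      exact hmiss i (by omega) hiT
    have hlab' : ∀ t, N + 1 ≤ t → lab (hist ρ t) = (I N, False) := fun t ht => by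
      rw [hlab t (by omega), eq_false (hout t ht)]
    obtain ⟨τ, -, h1, -, h3⟩ := exists_follows hρ hlab'
    have hoff : ∀ t, τ ≤ t → ρ t ∈ X \ A.attractor X σ {e (I N)} := by
      intro t ht
      refine ⟨hρ.mem t, ?_⟩
      have h4 := h1 t ht
      obtain ⟨h', e'⟩ := hist_eq_cons ρ t
      simp only [lab, Prod.mk.injEq, eq_iff_iff, iff_false] at h4
      rw [h4.1] at h4
      simpa [e'] using h4.2
    rw [← winsPlay_shift τ]
    refine (hf _ (heX (I N))).2 _ ⟨fun i => hoff _ (by omega), hρ.edge.shift τ, fun i hi => ?_⟩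
      (hoff _ (by omega))
    simpa [s] using h3 i hi

/-! ### Winning regions of the whole arena -/

theorem Arena.WinsOn.subset_win {W : Set V} (h : A.WinsOn cond Set.univ σ W) :
    W ⊆ A.Win cond σ := by
  obtain ⟨-, f, hf, hwin⟩ := h
  intro v hv
  refine ⟨⟨fun k h => f (List.ofFn h).reverse, fun k h ho => ?_⟩, fun ρ hρ h0 hc => ?_⟩
  · rw [List.ofFn_succ', List.concat_eq_append, List.reverse_append]
    exact (hf _ _ (Set.mem_univ _) ho).2
  · refine hwin ρ ⟨fun _ => Set.mem_univ _, hρ, fun i hi => ?_⟩ (by rwa [h0])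
    rw [hc i hi]
    simp only
    rw [hist_eq_reverse_ofFn]

/-- The sequence that starts with `v` and in which `F` determines the next element. -/
def buildPlay (v : V) (F : (k : ℕ) → (Fin (k + 1) → V) → V) : ℕ → V
  | 0 => v
  | k + 1 => F k fun j => buildPlay v F j
decreasing_by exact j.2

/-- Playing both winning strategies against each other produces a single play that both players
would win. -/
theorem Arena.win_disjoint {v : V} (h0 : v ∈ A.Win cond 0) (h1 : v ∈ A.Win cond 1) : False := by
  classical
  obtain ⟨s0, h0⟩ := h0
  obtain ⟨s1, h1⟩ := h1
  let F : (k : ℕ) → (Fin (k + 1) → V) → V := fun k h =>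
    if A.owner (h (Fin.last k)) = 0 then s0.move k h else s1.move k h
  let ρ := buildPlay v F
  have hsucc : ∀ k, ρ (k + 1) = F k fun j => ρ j := fun k => by
    simp only [ρ]; rw [buildPlay]
  have hc0 : s0.Consistent ρ := fun i hi => by
    rw [hsucc]; simp only [F, Fin.val_last]; rw [if_pos hi]
  have hc1 : s1.Consistent ρ := fun i hi => by
    rw [hsucc]; simp only [F, Fin.val_last]; rw [if_neg (by rw [hi]; decide)]
  have hplay : A.IsPlay ρ := fun i => by
    by_cases ho : A.owner (ρ i) = 0
    · rw [hc0 i ho]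
      exact s0.legal i (fun j => ρ j) ho
    · have ho : A.owner (ρ i) = 1 := Fin.eq_one_of_ne_zero _ ho
      rw [hc1 i ho]
      exact s1.legal i (fun j => ρ j) ho
  have hv : ρ 0 = v := by simp [ρ, buildPlay]
  have w0 := h0 ρ hplay hv hc0
  have w1 := h1 ρ hplay hv hc1
  simp [WinsPlay] at w0 w1
  exact w1 w0

end Games

end RegularGames

namespace RegularGames

/-! ### The recursion for winning regions -/

section Solved

variable {V : Type} {A : Arena V} {cond : Set V → Prop} {X : Set V}
  {σ τ : Player}

/-- `c` assigns to each position in `X` the winner of the game played inside `X`. -/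
def Arena.Solved (A : Arena V) (cond : Set V → Prop) (X : Set V) (c : V → Player) : Prop :=
  ∀ τ, A.WinsOn cond X τ {v | v ∈ X ∧ c v = τ} ∧
    ((∃ v ∈ X, c v = τ) → 2 ≤ {v | v ∈ X ∧ c v = τ}.ncard)

/-- This is the use of bipartiteness: there are no loops, so a position and its successor differ. It
is the source of the cardinality clause in `Arena.Solved` and thus of the argument `m - 2` in the
recurrence. -/
theorem Arena.IsSub.two_le_ncard [Finite V] (hX : A.IsSub X) (hne : X.Nonempty) : 2 ≤ X.ncard := by
  obtain ⟨v, hv⟩ := hne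
  obtain ⟨u, hu, he⟩ := hX v hv
  have hne : v ≠ u := by
    rintro rfl
    exact A.bipartite _ he rfl
  rw [← Set.ncard_pair hne]
  exact Set.ncard_le_ncard (by rintro x (rfl | rfl) <;> assumption)

theorem Arena.solved_const [Fintype V] [Nonempty V] (hX : A.IsSub X) (hcond : if σ = 0 then cond X else ¬ cond X)
    (h : ∀ v ∈ X, A.WinsOn cond (X \ A.attractor X σ {v}) σ (X \ A.attractor X σ {v})) :
    A.Solved cond X fun _ => σ := by
  intro τ
  by_cases ht : σ = τ
  · subst ht
    simp only [and_true]
    exact ⟨winsOn_of_forall_diff_attractor hX hcond h, hX.two_le_ncard⟩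
  · simp only [ht, and_false, Set.ofPred_false, exists_false, false_implies, and_true]
    exact winsOn_empty hX

theorem Arena.Solved.winsOn_of_forall {c : V → Player} (h : A.Solved cond X c)
    (hall : ∀ v ∈ X, c v = σ) : A.WinsOn cond X σ X := by
  have := (h σ).1
  rwa [show {v | v ∈ X ∧ c v = σ} = X from Set.ext fun v => ⟨fun h => h.1, fun h => ⟨h, hall v h⟩⟩]
    at this

open Classical in
/-- If Player `τ` wins from `W` outside an attractor of the opponent, it remains to solve the game
outside the attractor of `W`. -/
theorem Arena.Solved.step [Fintype V] (hX : A.IsSub X) (hστ : τ ≠ σ) {T W D : Set V} {c c' : V → Player}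
    (h : A.Solved cond (X \ A.attractor X σ T) c)
    (hW : W = {v | v ∈ X \ A.attractor X σ T ∧ c v = τ}) (hne : W.Nonempty)
    (hD : D = A.attractor X τ W) (h' : A.Solved cond (X \ D) c') :
    A.Solved cond X fun v => if v ∈ D then τ else c' v := by
  have hWX : A.WinsOn cond X τ W := by
    rw [hW]
    -- The complement of a `σ`-attractor is a trap for `σ`: a position of `σ` with an edge into the
    -- attractor would itself belong to it.
    refine (h τ).1.of_trap hX Set.sdiff_subset ?_
    rintro v ⟨hv, hvA⟩ ho u hu he
    refine ⟨hu, fun huA => hvA (mem_attractor_of_owner hv ?_ huA he)⟩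
    have : ∀ a b c : Player, a ≠ b → b ≠ c → a = c := by decide
    exact this _ _ _ ho hστ
  have hDX : A.WinsOn cond X τ D := hD ▸ hWX.attractor hX
  have hDc : 2 ≤ D.ncard := by
    refine le_trans ?_ (Set.ncard_le_ncard (hD ▸ subset_attractor : W ⊆ D))
    rw [hW]
    refine (h τ).2 ?_
    obtain ⟨v, hv⟩ := hne
    rw [hW] at hv
    exact ⟨v, hv⟩
  intro ρ
  by_cases hρ : ρ = τ
  · subst hρ
    have e : {v | v ∈ X ∧ (if v ∈ D then ρ else c' v) = ρ} = D ∪ {v | v ∈ X \ D ∧ c' v = ρ} := by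
      ext v
      by_cases hv : v ∈ D
      · simp [hv, hDX.1 hv]
      · simp [hv]
    rw [e]
    exact ⟨hDX.union_diff (h' ρ).1, fun _ => hDc.trans (Set.ncard_le_ncard Set.subset_union_left)⟩
  · have e : {v | v ∈ X ∧ (if v ∈ D then τ else c' v) = ρ} = {v | v ∈ X \ D ∧ c' v = ρ} := by
      ext v
      by_cases hv : v ∈ D
      · simp [hv, Ne.symm hρ]
      · simp [hv]
    rw [e]
    -- Here `ρ` is the player `σ`, and the trap is the complement of the `τ`-attractor `D`. For `τ`
    -- itself nothing has to be trapped, as a play that enters `D` is won by `τ` anyway.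
    refine ⟨(h' ρ).1.of_trap hX Set.sdiff_subset ?_, fun ⟨v, hv, hc⟩ => (h' ρ).2 ⟨v, ?_⟩⟩
    · rintro v ⟨hv, hvD⟩ ho u hu he
      refine ⟨hu, fun huD => hvD ?_⟩
      have : ∀ a b c : Player, a ≠ b → b ≠ c → a = c := by decide
      rw [hD] at huD ⊢
      exact mem_attractor_of_owner hv (this _ _ _ ho hρ) huD he
    · by_cases hvD : v ∈ D
      · simp [hvD, Ne.symm hρ] at hc
      · exact ⟨⟨hv, hvD⟩, by simpa [hvD] using hc⟩

theorem Arena.Solved.two_le_ncard_attractor [Fintype V] {T W : Set V} {c : V → Player}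
    (h : A.Solved cond (X \ A.attractor X σ T) c)
    (hW : W = {v | v ∈ X \ A.attractor X σ T ∧ c v = τ}) (hne : W.Nonempty) :
    2 ≤ (A.attractor X τ W).ncard := by
  refine le_trans ?_ (Set.ncard_le_ncard subset_attractor)
  obtain ⟨v, hv⟩ := hne
  rw [hW] at hv ⊢
  exact (h τ).2 ⟨v, hv⟩

/-- A solution assigns every position to some player who does win from it. Since winning regions are
disjoint, the assignment is the exact partition. -/
theorem Arena.Solved.mem_win_iff {c : V → Player} (h : A.Solved cond Set.univ c) (v : V) :
    c v = σ ↔ v ∈ A.Win cond σ := by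
  have hmem : ∀ σ, c v = σ → v ∈ A.Win cond σ := fun σ hc =>
    (h σ).1.subset_win ⟨Set.mem_univ _, hc⟩
  refine ⟨hmem σ, fun hv => ?_⟩
  by_contra hne
  have h2 := hmem _ rfl
  generalize c v = x at *
  match x, σ with
  | 0, 0 => exact hne rfl
  | 1, 1 => exact hne rfl
  | 0, 1 => exact win_disjoint h2 hv
  | 1, 0 => exact win_disjoint hv h2

end Solved

/-! ### Total correctness of programs with time bounds -/

/-- All registers and cells contain words of the machine of size `S`. -/
structure State.Bounded (S : ℕ) (s : State) : Prop where
  four_lt : 4 < S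
  reg : ∀ i, s.reg i < S
  mem : ∀ a, s.mem a < S

/-- The value of an expression, if no number exceeds the range of words. -/
def Exp.val (s : State) : Exp → ℕ
  | .lit c => c
  | .reg i => s.reg i
  | .mem a => s.mem (a.val s)
  | .add a b => a.val s + b.val s
  | .sub a b => a.val s - b.val s
  | .mul a b => a.val s * b.val s
  | .lt a b => if a.val s < b.val s then 1 else 0
  | .eq a b => if a.val s = b.val s then 1 else 0

/-- A sufficient condition for the evaluation of an expression not to exceed the range of words. -/
def Exp.Ok (S : ℕ) (s : State) : Exp → Prop
  | .lit c => c ≤ 4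
  | .reg _ => True
  | .mem a => a.Ok S s
  | .add a b => a.Ok S s ∧ b.Ok S s ∧ a.val s + b.val s < S
  | .sub a b => a.Ok S s ∧ b.Ok S s
  | .mul a b => a.Ok S s ∧ b.Ok S s ∧ a.val s * b.val s < S
  | .lt a b => a.Ok S s ∧ b.Ok S s
  | .eq a b => a.Ok S s ∧ b.Ok S s

theorem Exp.eval_eq {S : ℕ} {s : State} (hs : s.Bounded S) (e : Exp) (h : e.Ok S s) :
    e.eval S s = some (e.val s) := by
  have h4 := hs.four_lt
  induction e with
  | lit c => simp only [Ok] at h; simp [eval, fit, val]; omega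
  | reg i => simp [eval, fit, val, hs.reg]
  | mem a ih => simp [eval, fit, val, ih h, hs.mem]
  | add a b iha ihb => simp [eval, fit, val, iha h.1, ihb h.2.1, h.2.2]
  | sub a b iha ihb =>
    simp only [eval, fit, val, iha h.1, ihb h.2, Option.bind_some]
    -- Subtraction carries no range condition of its own: the truncated difference is at most the
    -- first operand, which is a word because its evaluation succeeded.
    have : a.val s < S := by
      have := iha h.1
      by_contra hc
      clear ihb
      cases a <;> simp [eval, fit, Option.bind_eq_some_iff] at this <;> grind
    rw [if_pos (by omega)]
  | mul a b iha ihb => simp [eval, fit, val, iha h.1, ihb h.2.1, h.2.2]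
  | lt a b iha ihb =>
    simp only [eval, fit, val, iha h.1, ihb h.2, Option.bind_some]
    rw [if_pos (by split_ifs <;> omega)]
  | eq a b iha ihb =>
    simp only [eval, fit, val, iha h.1, ihb h.2, Option.bind_some]
    rw [if_pos (by split_ifs <;> omega)]

/-- The number of operations of a program without loops. -/
def Prog.time : Prog → ℕ
  | .skip => 1
  | .set _ e => e.cost + 1
  | .store a e => a.cost + e.cost + 1
  | .seq p q => p.time + q.time
  | .ite e p q => e.cost + 1 + max p.time q.time
  | .loop _ _ => 0

/-- The weakest precondition of a program without loops. -/
def Prog.wp (S : ℕ) : Prog → (State → Prop) → State → Prop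
  | .skip, Q, s => Q s
  | .set i e, Q, s => e.Ok S s ∧ Q ⟨Function.update s.reg i (e.val s), s.mem⟩
  | .store a e, Q, s => a.Ok S s ∧ e.Ok S s ∧
      Q ⟨s.reg, Function.update s.mem (a.val s) (e.val s)⟩
  | .seq p q, Q, s => p.wp S (q.wp S Q) s
  | .ite e p q, Q, s => e.Ok S s ∧ (e.val s ≠ 0 → p.wp S Q s) ∧ (e.val s = 0 → q.wp S Q s)
  | .loop _ _, _, _ => False

/-- Started in the state `s`, the program halts within time `T` in a state that satisfies `Q`. -/
def Runs (S : ℕ) (p : Prog) (s : State) (T : ℕ) (Q : State → Prop) : Prop :=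
  s.Bounded S → ∃ s' t, Exec S p s s' t ∧ t ≤ T ∧ s'.Bounded S ∧ Q s'

theorem fit_lt {S x y : ℕ} (h : fit S x = some y) : y < S := by
  unfold fit at h
  split_ifs at h with hx
  simp only [Option.some.injEq] at h
  omega

theorem Exp.eval_lt {S : ℕ} {s : State} {e : Exp} {x : ℕ} (h : e.eval S s = some x) : x < S := by
  cases e <;> simp only [eval, Option.bind_eq_some_iff] at h <;> try exact fit_lt h
  · obtain ⟨_, _, h⟩ := h; exact fit_lt h
  all_goals obtain ⟨_, _, _, _, h⟩ := h; exact fit_lt h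

theorem State.Bounded.set {S : ℕ} {s : State} (hs : s.Bounded S) (i : ℕ) {x : ℕ} (hx : x < S) :
    State.Bounded S ⟨Function.update s.reg i x, s.mem⟩ :=
  ⟨hs.four_lt, fun j => by simp only [Function.update_apply]; split_ifs; exacts [hx, hs.reg j],
    hs.mem⟩

theorem State.Bounded.store {S : ℕ} {s : State} (hs : s.Bounded S) (a : ℕ) {x : ℕ} (hx : x < S) :
    State.Bounded S ⟨s.reg, Function.update s.mem a x⟩ :=
  ⟨hs.four_lt, hs.reg, fun j => by
    simp only [Function.update_apply]; split_ifs; exacts [hx, hs.mem j]⟩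

/-! ### Rules for deriving correctness with time bounds -/

namespace Runs

variable {S : ℕ} {p q : Prog} {s : State} {T T₁ T₂ : ℕ} {Q R : State → Prop}

/-- Without loops termination is automatic and the syntax bounds the time, so the weakest
precondition alone remains to be checked. Loops are treated by separate rules. -/
theorem of_wp (h : p.wp S Q s) (hT : p.time ≤ T) : Runs S p s T Q := by
  intro hs
  suffices H : ∃ s' t, Exec S p s s' t ∧ t ≤ p.time ∧ s'.Bounded S ∧ Q s' by
    obtain ⟨s', t, h1, h2, h3⟩ := H
    exact ⟨s', t, h1, h2.trans hT, h3⟩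
  clear hT
  induction p generalizing s Q with
  | skip => exact ⟨s, 1, .skip s, le_rfl, hs, h⟩
  | set i e =>
    have he := e.eval_eq hs h.1
    exact ⟨_, _, .set i e s _ he, le_rfl, hs.set i (Exp.eval_lt he), h.2⟩
  | store a e =>
    have ha := a.eval_eq hs h.1
    have he := e.eval_eq hs h.2.1
    exact ⟨_, _, .store a e s _ _ ha he, le_rfl, hs.store _ (Exp.eval_lt he), h.2.2⟩
  | seq p q ihp ihq =>
    obtain ⟨s', t, h1, h2, h3, h4⟩ := ihp h hs
    obtain ⟨s'', t', h1', h2', h3', h4'⟩ := ihq h4 h3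
    exact ⟨s'', _, .seq p q _ _ _ _ _ h1 h1', Nat.add_le_add h2 h2', h3', h4'⟩
  | ite e p q ihp ihq =>
    have he := e.eval_eq hs h.1
    by_cases h0 : e.val s = 0
    · obtain ⟨s', t, h1, h2, h3⟩ := ihq (h.2.2 h0) hs
      rw [h0] at he
      exact ⟨s', _, .ite_false e p q _ _ _ he h1, by simp only [Prog.time]; omega, h3⟩
    · obtain ⟨s', t, h1, h2, h3⟩ := ihp (h.2.1 h0) hs
      exact ⟨s', _, .ite_true e p q _ _ _ _ he h0 h1, by simp only [Prog.time]; omega, h3⟩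
  | loop e p => exact h.elim

theorem bounded (h : s.Bounded S → Runs S p s T Q) : Runs S p s T Q := fun hs => h hs hs

theorem mono (h : Runs S p s T₁ Q) (hT : T₁ ≤ T) (hQ : ∀ s', Q s' → R s') : Runs S p s T R := by
  intro hs
  obtain ⟨s', t, h1, h2, h3, h4⟩ := h hs
  exact ⟨s', t, h1, h2.trans hT, h3, hQ _ h4⟩

theorem seq (hp : Runs S p s T₁ R) (hq : ∀ s', R s' → Runs S q s' T₂ Q) (hT : T₁ + T₂ ≤ T) :
    Runs S (.seq p q) s T Q := by
  intro hs
  obtain ⟨s', t, h1, h2, h3, h4⟩ := hp hs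
  obtain ⟨s'', t', h1', h2', h3', h4'⟩ := hq s' h4 h3
  exact ⟨s'', _, .seq p q _ _ _ _ _ h1 h1', by omega, h3', h4'⟩

theorem ite {e : Exp} (he : e.Ok S s) (hp : e.val s ≠ 0 → Runs S p s T₁ Q)
    (hq : e.val s = 0 → Runs S q s T₁ Q) (hT : e.cost + 1 + T₁ ≤ T) :
    Runs S (.ite e p q) s T Q := by
  intro hs
  have he := e.eval_eq hs he
  by_cases h0 : e.val s = 0
  · obtain ⟨s', t, h1, h2, h3⟩ := hq h0 hs
    rw [h0] at he
    exact ⟨s', _, .ite_false e p q _ _ _ he h1, by omega, h3⟩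
  · obtain ⟨s', t, h1, h2, h3⟩ := hp h0 hs
    exact ⟨s', _, .ite_true e p q _ _ _ _ he h0 h1, by omega, h3⟩

/-- The postcondition of the body is the claim about all remaining iterations. This form permits
inductions in which the number of iterations is not known beforehand, as for the main loop. -/
theorem loop {e : Exp} (he : e.Ok S s) (h0 : e.val s ≠ 0)
    (hp : Runs S p s T₁ fun s' => Runs S (.loop e p) s' T₂ Q) (hT : e.cost + 1 + T₁ + T₂ ≤ T) :
    Runs S (.loop e p) s T Q := by
  intro hs
  have he := e.eval_eq hs he
  obtain ⟨s', t, h1, h2, h3, h4⟩ := hp hs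
  obtain ⟨s'', t', h1', h2', h3', h4'⟩ := h4 h3
  exact ⟨s'', _, .loop_true e p _ _ _ _ _ _ he h0 h1 h1', by omega, h3', h4'⟩

theorem loop_exit {e : Exp} (he : e.Ok S s) (h0 : e.val s = 0) (hQ : Q s) (hT : e.cost + 1 ≤ T) :
    Runs S (.loop e p) s T Q := by
  intro hs
  have he := e.eval_eq hs he
  rw [h0] at he
  exact ⟨s, _, .loop_false e p _ he, hT, hs, hQ⟩

end Runs

/-- The increment of a register. -/
def Prog.inc (i : ℕ) : Prog := .set i (.add (.reg i) (.lit 1))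

/-- Execute `p` for the values `0, 1, …` of register `i` that are smaller than register `b`. -/
def Prog.forTo (i b : ℕ) (p : Prog) : Prog :=
  .seq (.set i (.lit 0)) (.loop (.lt (.reg i) (.reg b)) (.seq p (.inc i)))

/-- Each test of the guard costs 4, including the last one, and the initialisation costs 2; hence
the terms `T + 4` and `6`. The invariant is proved to survive step by step, by induction on the
number `d` of iterations that are left. -/
theorem Runs.forTo {S i b N T T' : ℕ} {p : Prog} {s : State} {Q : State → Prop}
    (Inv : ℕ → State → Prop) (hb : ∀ j s, Inv j s → s.reg i = j ∧ s.reg b = N)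
    (h0 : Inv 0 ⟨Function.update s.reg i 0, s.mem⟩)
    (hstep : ∀ j < N, ∀ s, Inv j s → Runs S (.seq p (.inc i)) s T (Inv (j + 1)))
    (hQ : ∀ s, Inv N s → Q s) (hT : N * (T + 4) + 6 ≤ T') : Runs S (.forTo i b p) s T' Q := by
  have key : ∀ d j s, j + d = N → Inv j s →
      Runs S (.loop (.lt (.reg i) (.reg b)) (.seq p (.inc i))) s (d * (T + 4) + 4) Q := by
    intro d
    induction d with
    | zero =>
      intro j s hj hI
      have := hb j s hI
      refine Runs.loop_exit (by simp [Exp.Ok]) ?_ (hQ s ?_) (by simp [Exp.cost])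
      · simp [Exp.val, this]; omega
      · rwa [← hj]
    | succ d ih =>
      intro j s hj hI
      have := hb j s hI
      refine Runs.loop (T₂ := d * (T + 4) + 4) (by simp [Exp.Ok]) ?_
        ((hstep j (by omega) s hI).mono le_rfl fun s' hs' => ih (j + 1) s' (by omega) hs') ?_
      · simp [Exp.val, this]; omega
      · simp only [Exp.cost]; rw [Nat.succ_mul]; omega
  refine Runs.seq (T₁ := 2) (T₂ := N * (T + 4) + 4)
    (R := fun s' => s' = ⟨Function.update s.reg i 0, s.mem⟩) (Runs.of_wp ?_ ?_) ?_ ?_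
  · simp [Prog.wp, Exp.Ok, Exp.val]
  · simp [Prog.time, Exp.cost]
  · rintro s' rfl
    exact key N 0 _ (by omega) h0
  · omega

/-- The registers below `20` have the same contents. -/
def Agree (s s' : State) : Prop := ∀ i < 20, s'.reg i = s.reg i

theorem Agree.refl (s : State) : Agree s s := fun _ _ => rfl

theorem Agree.trans {s s' s'' : State} (h : Agree s s') (h' : Agree s' s'') : Agree s s'' :=
  fun i hi => (h' i hi).trans (h i hi)

theorem Agree.set {s s' : State} (h : Agree s s') {i : ℕ} (hi : 20 ≤ i) (x : ℕ) (m : ℕ → ℕ) :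
    Agree s ⟨Function.update s'.reg i x, m⟩ := fun j hj => by
  rw [← h j hj]
  exact Function.update_of_ne (by omega) _ _

end RegularGames

namespace RegularGames

/-! ### The memory layout and the computation of attractors -/

/-- The parts of the memory: the input `w` with the list of owners at `ow` and the list `es` of
edges at `ed`, followed by `n` cells of scratch space. -/
structure Layout (n : ℕ) where
  S : ℕ
  A : Arena (Fin n)
  es : List (Fin n × Fin n)
  w : List ℕ
  ow : ℕ
  ed : ℕ
  k : ℕ
  ps : ℕ
  kind : ℕ
  pos : 0 < n
  lists : Lists es A.edges
  ow_le : ow + n ≤ w.length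
  ed_le : ed + 2 * es.length ≤ w.length
  le_S : w.length + n < S
  owner : ∀ v : Fin n, w.getD (ow + v) 0 = A.owner v
  fst : ∀ j (h : j < es.length), w.getD (ed + 2 * j) 0 = es[j].1
  snd : ∀ j (h : j < es.length), w.getD (ed + 2 * j + 1) 0 = es[j].2

/-- The contents of the registers and cells that stay fixed. -/
structure Layout.Holds {n : ℕ} (L : Layout n) (s : State) : Prop where
  r0 : s.reg 0 = n
  r1 : s.reg 1 = L.es.length
  r2 : s.reg 2 = L.ow
  r3 : s.reg 3 = L.ed
  r4 : s.reg 4 = L.w.length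
  r8 : s.reg 8 = L.k
  r9 : s.reg 9 = L.ps
  r10 : s.reg 10 = L.kind
  r11 : s.reg 11 = n + 2
  input : ∀ a < L.w.length, s.mem a = L.w.getD a 0

section

variable {n : ℕ} {L : Layout n} {s s' : State}

theorem Layout.Holds.of_agree (h : L.Holds s) (ha : Agree s s')
    (hm : ∀ a < L.w.length, s'.mem a = s.mem a) : L.Holds s' where
  r0 := (ha 0 (by omega)).trans h.r0
  r1 := (ha 1 (by omega)).trans h.r1
  r2 := (ha 2 (by omega)).trans h.r2
  r3 := (ha 3 (by omega)).trans h.r3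
  r4 := (ha 4 (by omega)).trans h.r4
  r8 := (ha 8 (by omega)).trans h.r8
  r9 := (ha 9 (by omega)).trans h.r9
  r10 := (ha 10 (by omega)).trans h.r10
  r11 := (ha 11 (by omega)).trans h.r11
  input := fun a h' => (hm a h').trans (h.input a h')

theorem Layout.Holds.owner (h : L.Holds s) (v : Fin n) : s.mem (L.ow + v) = L.A.owner v := by
  have := L.ow_le
  rw [h.input _ (by omega), L.owner]

theorem Layout.Holds.fst (h : L.Holds s) {j : ℕ} (hj : j < L.es.length) :
    s.mem (L.ed + 2 * j) = L.es[j].1 := by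
  have := L.ed_le
  rw [h.input _ (by omega), L.fst]

theorem Layout.Holds.snd (h : L.Holds s) {j : ℕ} (hj : j < L.es.length) :
    s.mem (L.ed + 2 * j + 1) = L.es[j].2 := by
  have := L.ed_le
  rw [h.input _ (by omega), L.snd]

end

/-! ### Attractors by repeated passes over the edge list -/

section Attractor

theorem ite_one_eq_ite_one (P Q : Prop) [Decidable P] [Decidable Q] :
    ((if P then 1 else 0 : ℕ) = if Q then 1 else 0) ↔ (P ↔ Q) := by
  by_cases hP : P <;> by_cases hQ : Q <;> simp [hP, hQ]

open Prog Exp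

/-- Clear the scratch space. -/
def clearProg : Prog := .forTo 21 0 (.store (.add (.reg 4) (.reg 21)) (.lit 0))

/-- Mark the positions that have an edge into the attractor computed so far (positions of Player
`reg 13`), or out of it (positions of the opponent). -/
def markProg : Prog := .forTo 21 1
  (.seq (.set 22 (.mem (.add (.reg 3) (.mul (.lit 2) (.reg 21)))))
  (.seq (.set 23 (.mem (.add (.add (.reg 3) (.mul (.lit 2) (.reg 21))) (.lit 1))))
  (.ite (.eq (.mem (.add (.reg 12) (.reg 23)))
      (.add (.lit 2) (.mul (.lit 2) (.eq (.mem (.add (.reg 2) (.reg 22))) (.reg 13)))))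
    (.store (.add (.reg 4) (.reg 22)) (.lit 1)) .skip)))

/-- Add positions to the attractor. -/
def growProg : Prog := .forTo 21 0
  (.ite (.eq (.mem (.add (.reg 12) (.reg 21))) (.lit 2))
    (.ite (.eq (.mem (.add (.reg 4) (.reg 21)))
        (.eq (.mem (.add (.reg 2) (.reg 21))) (.reg 13)))
      (.store (.add (.reg 12) (.reg 21)) (.lit 4)) .skip) .skip)

/-- Replace the code `4` by the content of register `14`. -/
def recodeProg : Prog := .forTo 21 0
  (.ite (.eq (.mem (.add (.reg 12) (.reg 21))) (.lit 4))
    (.store (.add (.reg 12) (.reg 21)) (.reg 14)) .skip)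

/-- In the array at `reg 12`, the code `2` stands for the positions of a sub-arena, and `4` for
targets in it. Replace the code of the attractor of Player `reg 13` by the content of `reg 14`. -/
def attrProg : Prog :=
  .seq (.forTo 20 0 (.seq clearProg (.seq markProg growProg))) recodeProg

variable {n : ℕ} {L : Layout n} {s : State} {p : ℕ}

theorem runs_clearProg (hs : L.Holds s) :
    Runs L.S clearProg s (n * 13 + 6) fun s' => Agree s s' ∧ s'.reg 20 = s.reg 20 ∧
      (∀ a, a < L.w.length ∨ L.w.length + n ≤ a → s'.mem a = s.mem a) ∧
      ∀ v : Fin n, s'.mem (L.w.length + v) = 0 := by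
  have hS := L.le_S
  refine Runs.forTo (N := n) (T := 9) (fun j s' => s'.reg 21 = j ∧ Agree s s' ∧
    s'.reg 20 = s.reg 20 ∧
    (∀ a, a < L.w.length ∨ L.w.length + n ≤ a → s'.mem a = s.mem a) ∧
    ∀ v : Fin n, v < j → s'.mem (L.w.length + v) = 0) ?_ ?_ ?_ ?_ (by omega)
  · rintro j s' ⟨h1, h2, -⟩
    exact ⟨h1, by rw [h2 0 (by omega), hs.r0]⟩
  · exact ⟨by simp, (Agree.refl s).set (by omega) _ _, by simp, fun _ _ => rfl, by simp⟩
  · rintro j hj s' ⟨h1, h2, h3, h4, h5⟩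
    have r4 : s'.reg 4 = L.w.length := by rw [h2 4 (by omega), hs.r4]
    refine Runs.of_wp ?_ (by simp [Prog.time, Prog.inc, Exp.cost])
    simp only [Prog.wp, Prog.inc, Exp.Ok, Exp.val, r4, h1]
    refine ⟨⟨trivial, trivial, by omega⟩, by omega, ⟨trivial, by omega, by omega⟩, by simp,
      h2.set (by omega) _ _, by simp [h3], ?_, ?_⟩
    · intro a ha
      rw [Function.update_of_ne (by omega), h4 a ha]
    · intro v hv
      rw [Function.update_apply]
      split_ifs with h
      · rfl
      · exact h5 v (by omega)
  · rintro s' ⟨-, h2, h3, h4, h5⟩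
    exact ⟨h2, h3, h4, fun v => h5 v v.2⟩

/-- The position `v` has an edge to a position with the code by which it is judged. -/
def Marked (L : Layout n) (τ : Player) (s : State) (p : ℕ) (es : List (Fin n × Fin n))
    (v : Fin n) : Prop :=
  ∃ e ∈ es, e.1 = v ∧ s.mem (p + e.2) = 2 + 2 * if L.A.owner v = τ then 1 else 0

open Classical in
-- The code to look for depends on the owner: `4`, inside the attractor so far, for positions of
-- `τ`, and `2`, still outside, for the opponent. One pass over the edges thus serves both clauses
-- in the definition of `Arena.attr`.
theorem runs_markProg (hs : L.Holds s) {τ : Player} (hp : s.reg 12 = p) (hτ : s.reg 13 = τ)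
    (hp1 : L.w.length + n ≤ p) (hp2 : p + n ≤ L.S)
    (h0 : ∀ v : Fin n, s.mem (L.w.length + v) = 0) :
    Runs L.S markProg s (L.es.length * 45 + 6) fun s' => Agree s s' ∧ s'.reg 20 = s.reg 20 ∧
      (∀ a, a < L.w.length ∨ L.w.length + n ≤ a → s'.mem a = s.mem a) ∧
      ∀ v : Fin n, s'.mem (L.w.length + v) = if Marked L τ s p L.es v then 1 else 0 := by
  have hS := L.le_S
  have hed := L.ed_le
  have how := L.ow_le
  refine Runs.forTo (N := L.es.length) (T := 41) (fun j s' => s'.reg 21 = j ∧ Agree s s' ∧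
    s'.reg 20 = s.reg 20 ∧
    (∀ a, a < L.w.length ∨ L.w.length + n ≤ a → s'.mem a = s.mem a) ∧
    ∀ v : Fin n, s'.mem (L.w.length + v) = if Marked L τ s p (L.es.take j) v then 1 else 0)
    ?_ ?_ ?_ ?_ (by omega)
  · rintro j s' ⟨h1, h2, -⟩
    exact ⟨h1, by rw [h2 1 (by omega), hs.r1]⟩
  · exact ⟨by simp, (Agree.refl s).set (by omega) _ _, by simp, fun _ _ => rfl,
      by simp [Marked, h0]⟩
  · rintro j hj s' ⟨h1, h2, h3, h4, h5⟩
    have hs' : L.Holds s' := hs.of_agree h2 fun a ha => h4 a (Or.inl ha)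
    have e12 : s'.reg 12 = p := by rw [h2 12 (by omega), hp]
    have e13 : s'.reg 13 = τ := by rw [h2 13 (by omega), hτ]
    have m1 := hs'.fst hj
    have m2 := hs'.snd hj
    have m3 := hs'.owner L.es[j].1
    have m4 := h4 (p + L.es[j].2) (Or.inr (by omega))
    have l1 := L.es[j].1.2
    have l2 := L.es[j].2.2
    have hmk : ∀ v, Marked L τ s p (L.es.take (j + 1)) v ↔ Marked L τ s p (L.es.take j) v ∨
        (L.es[j].1 = v ∧
          s.mem (p + L.es[j].2) = 2 + 2 * if L.A.owner L.es[j].1 = τ then 1 else 0) := by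
      intro v
      rw [List.take_succ_eq_append_getElem hj]
      simp only [Marked, List.mem_append, List.mem_singleton, or_and_right, exists_or,
        exists_eq_left]
      refine or_congr_right (and_congr_right ?_)
      rintro rfl
      rfl
    have hval : ∀ q : Player, ((q : ℕ) = (τ : ℕ)) = (q = τ) := fun q => by
      rw [Fin.val_inj]
    refine Runs.bounded fun hb => Runs.of_wp ?_ (by simp [Prog.time, Prog.inc, Exp.cost])
    have h4S := hb.four_lt
    have hif : ∀ q : Player, 2 + 2 * (if q = τ then 1 else 0) < L.S := fun q => by
      split_ifs <;> omega
    have hif' : ∀ q : Player, 2 * (if q = τ then 1 else 0) < L.S := fun q => by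
      split_ifs <;> omega
    simp [Prog.wp, Prog.inc, Exp.Ok, Exp.val, h1, hs'.r2, hs'.r3, hs'.r4, e12, e13, m1, m2, m3,
      m4, hval, hif, hif', -mul_ite]
    refine ⟨by omega, by omega, by omega, fun hc => ⟨by omega, by omega, ?_⟩,
      fun hc => ⟨by omega, ?_⟩⟩
    · refine ⟨((h2.set (by omega) _ s'.mem).set (by omega) _ s'.mem).set (by omega) _ _, h3,
        fun a ha => ?_, fun v => ?_⟩
      · rw [Function.update_of_ne (by omega), h4 a ha]
      · rw [Function.update_apply, h5 v]
        by_cases hv : v = L.es[j].1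
        · subst hv
          rw [if_pos rfl, if_pos ((hmk _).2 (Or.inr ⟨rfl, hc⟩))]
        · rw [if_neg (fun h => hv (Fin.ext (by omega)))]
          simp [hmk, Ne.symm hv]
    · refine ⟨((h2.set (by omega) _ s'.mem).set (by omega) _ s'.mem).set (by omega) _ _, h3, h4,
        fun v => ?_⟩
      rw [h5 v]
      have hc' : Marked L τ s p (L.es.take (j + 1)) v ↔ Marked L τ s p (L.es.take j) v := by
        rw [hmk]; tauto
      simp only [hc']
  · rintro s' ⟨-, h2, h3, h4, h5⟩
    rw [List.take_length] at h5
    exact ⟨h2, h3, h4, h5⟩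

open Classical in
-- A position outside joins iff its mark agrees with the truth value of "owned by `τ`": marked
-- positions of `τ` have an edge into the attractor, and unmarked positions of the opponent have no
-- way to stay outside. Marks were fixed before the pass, so changing the codes in place does not
-- run ahead of the stage.
theorem runs_growProg (hs : L.Holds s) {τ : Player} (hp : s.reg 12 = p) (hτ : s.reg 13 = τ)
    (hp1 : L.w.length + n ≤ p) (hp2 : p + n ≤ L.S) {M : Fin n → Prop}
    (hM : ∀ v : Fin n, s.mem (L.w.length + v) = if M v then 1 else 0) :
    Runs L.S growProg s (n * 32 + 6) fun s' => Agree s s' ∧ s'.reg 20 = s.reg 20 ∧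
      (∀ a, a < p ∨ p + n ≤ a → s'.mem a = s.mem a) ∧
      ∀ v : Fin n, s'.mem (p + v) =
        if s.mem (p + v) = 2 ∧ (M v ↔ L.A.owner v = τ) then 4 else s.mem (p + v) := by
  have hS := L.le_S
  have how := L.ow_le
  refine Runs.forTo (N := n) (T := 28) (fun j s' => s'.reg 21 = j ∧ Agree s s' ∧
    s'.reg 20 = s.reg 20 ∧
    (∀ a, a < p ∨ p + n ≤ a → s'.mem a = s.mem a) ∧
    ∀ v : Fin n, s'.mem (p + v) =
        if v < j ∧ s.mem (p + v) = 2 ∧ (M v ↔ L.A.owner v = τ) then 4 else s.mem (p + v))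
    ?_ ?_ ?_ ?_ (by omega)
  · rintro j s' ⟨h1, h2, -⟩
    exact ⟨h1, by rw [h2 0 (by omega), hs.r0]⟩
  · exact ⟨by simp, (Agree.refl s).set (by omega) _ _, by simp, fun _ _ => rfl, by simp⟩
  · rintro j hj s' ⟨h1, h2, h3, h4, h5⟩
    have hs' : L.Holds s' := hs.of_agree h2 fun a ha => h4 a (Or.inl (by omega))
    have e12 : s'.reg 12 = p := by rw [h2 12 (by omega), hp]
    have e13 : s'.reg 13 = τ := by rw [h2 13 (by omega), hτ]
    have m1 : s'.mem (L.ow + j) = _ := hs'.owner ⟨j, hj⟩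
    have m2 : s'.mem (p + j) = s.mem (p + j) := by
      have := h5 ⟨j, hj⟩
      simpa using this
    have m3 : s'.mem (L.w.length + j) = _ :=
      (h4 _ (Or.inl (by omega))).trans (hM ⟨j, hj⟩)
    have hval : ∀ q : Player, ((q : ℕ) = (τ : ℕ)) = (q = τ) := fun q => by
      rw [Fin.val_inj]
    refine Runs.bounded fun hb => Runs.of_wp ?_ (by simp [Prog.time, Prog.inc, Exp.cost])
    simp [Prog.wp, Prog.inc, Exp.Ok, Exp.val, h1, hs'.r2, hs'.r4, e12, e13, m1, m2, m3,
      hval, ite_one_eq_ite_one, -Order.lt_add_one_iff]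
    have hno : ¬ (s.mem (p + j) = 2 ∧ (M ⟨j, hj⟩ ↔ L.A.owner ⟨j, hj⟩ = τ)) → ∀ v : Fin n,
        s'.mem (p + v) = if v < j + 1 ∧ s.mem (p + v) = 2 ∧ (M v ↔ L.A.owner v = τ) then 4
          else s.mem (p + v) := by
      intro hc v
      rw [h5 v]
      by_cases hv : (v : ℕ) = j
      · obtain rfl : v = ⟨j, hj⟩ := Fin.ext hv
        rw [if_neg (by simp), if_neg (fun h => hc h.2)]
      · congr 2
        exact propext ⟨fun h => by omega, fun h => by omega⟩
    refine ⟨by omega, fun hc => ⟨⟨by omega, by omega⟩, fun hc' => ⟨by omega, by omega,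
      h2.set (by omega) _ _, h3, fun a ha => ?_, fun v => ?_⟩, fun hc' => ⟨by omega,
      h2.set (by omega) _ _, h3, h4, hno fun h => ?_⟩⟩, fun hc => ⟨by omega,
      h2.set (by omega) _ _, h3, h4, hno fun h => hc h.1⟩⟩
    · rw [Function.update_of_ne (by omega), h4 a ha]
    · rw [Function.update_apply]
      by_cases hv : (v : ℕ) = j
      · obtain rfl : v = ⟨j, hj⟩ := Fin.ext hv
        rw [if_pos rfl, if_pos ⟨by simp, hc, hc'⟩]
      · rw [if_neg (by omega), h5 v]
        congr 2
        exact propext ⟨fun h => by omega, fun h => by omega⟩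
    · exact hc' h.2
  · rintro s' ⟨-, h2, h3, h4, h5⟩
    exact ⟨h2, h3, h4, fun v => by simpa using h5 v⟩

theorem runs_recodeProg (hs : L.Holds s) {x : ℕ} (hp : s.reg 12 = p) (hx : s.reg 14 = x)
    (hp1 : L.w.length + n ≤ p) (hp2 : p + n ≤ L.S) :
    Runs L.S recodeProg s (n * 20 + 6) fun s' => Agree s s' ∧
      (∀ a, a < p ∨ p + n ≤ a → s'.mem a = s.mem a) ∧
      ∀ v : Fin n, s'.mem (p + v) = if s.mem (p + v) = 4 then x else s.mem (p + v) := by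
  refine Runs.forTo (N := n) (T := 16) (fun j s' => s'.reg 21 = j ∧ Agree s s' ∧
    (∀ a, a < p ∨ p + n ≤ a → s'.mem a = s.mem a) ∧
    ∀ v : Fin n, s'.mem (p + v) =
        if v < j ∧ s.mem (p + v) = 4 then x else s.mem (p + v))
    ?_ ?_ ?_ ?_ (by omega)
  · rintro j s' ⟨h1, h2, -⟩
    exact ⟨h1, by rw [h2 0 (by omega), hs.r0]⟩
  · exact ⟨by simp, (Agree.refl s).set (by omega) _ _, fun _ _ => rfl, by simp⟩
  · rintro j hj s' ⟨h1, h2, h4, h5⟩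
    have e12 : s'.reg 12 = p := by rw [h2 12 (by omega), hp]
    have e14 : s'.reg 14 = x := by rw [h2 14 (by omega), hx]
    have m2 : s'.mem (p + j) = s.mem (p + j) := by
      have := h5 ⟨j, hj⟩
      simpa using this
    refine Runs.bounded fun hb => Runs.of_wp ?_ (by simp [Prog.time, Prog.inc, Exp.cost])
    simp [Prog.wp, Prog.inc, Exp.Ok, Exp.val, h1, e12, e14, m2]
    refine ⟨by omega, fun hc => ⟨by omega, by omega, h2.set (by omega) _ _, fun a ha => ?_,
      fun v => ?_⟩, fun hc => ⟨by omega, h2.set (by omega) _ _, h4, fun v => ?_⟩⟩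
    · rw [Function.update_of_ne (by omega), h4 a ha]
    · rw [Function.update_apply]
      by_cases hv : (v : ℕ) = j
      · rw [if_pos (by omega), if_pos ⟨by omega, by rw [hv]; exact hc⟩]
      · rw [if_neg (by omega), h5 v]
        congr 2
        exact propext ⟨fun h => by omega, fun h => by omega⟩
    · rw [h5 v]
      by_cases hv : (v : ℕ) = j
      · rw [if_neg (by omega), if_neg (by rw [hv]; tauto)]
      · congr 2
        exact propext ⟨fun h => by omega, fun h => by omega⟩
  · rintro s' ⟨-, h2, h4, h5⟩
    exact ⟨h2, h4, fun v => by simpa using h5 v⟩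

open Classical in
-- After `j` rounds the code `4` stands exactly on stage `j`, and `n` rounds give the attractor.
-- Rescanning all edges in every round costs a factor `n` over a linear algorithm, but the bound per
-- step allows it.
theorem runs_attrProg (hs : L.Holds s) {τ : Player} {x : ℕ} {X T : Set (Fin n)}
    (hp : s.reg 12 = p) (hτ : s.reg 13 = τ) (hx : s.reg 14 = x)
    (hp1 : L.w.length + n ≤ p) (hp2 : p + n ≤ L.S)
    (hc4 : ∀ v : Fin n, s.mem (p + v) = 4 ↔ v ∈ T)
    (hc2 : ∀ v : Fin n, s.mem (p + v) = 2 ↔ v ∈ X \ T) :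
    Runs L.S attrProg s (n * (n * 45 + L.es.length * 45 + 26) + n * 20 + 12) fun s' =>
      Agree s s' ∧
      (∀ a, (a < L.w.length ∨ L.w.length + n ≤ a) → (a < p ∨ p + n ≤ a) → s'.mem a = s.mem a) ∧
      ∀ v : Fin n, s'.mem (p + v) =
        if v ∈ L.A.attractor X τ T then x else s.mem (p + v) := by
  have hS := L.le_S
  refine Runs.seq (T₁ := n * (n * 45 + L.es.length * 45 + 26) + 6) (T₂ := n * 20 + 6)
    (R := fun s' => Agree s s' ∧
      (∀ a, (a < L.w.length ∨ L.w.length + n ≤ a) → (a < p ∨ p + n ≤ a) → s'.mem a = s.mem a) ∧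
      ∀ v : Fin n, s'.mem (p + v) =
        if v ∈ L.A.attr X τ T n then 4 else s.mem (p + v)) ?_ ?_ (by omega)
  · refine Runs.forTo (N := n) (T := n * 45 + L.es.length * 45 + 22)
      (fun j s' => s'.reg 20 = j ∧ Agree s s' ∧
        (∀ a, (a < L.w.length ∨ L.w.length + n ≤ a) → (a < p ∨ p + n ≤ a) →
          s'.mem a = s.mem a) ∧
        ∀ v : Fin n, s'.mem (p + v) = if v ∈ L.A.attr X τ T j then 4 else s.mem (p + v))
      ?_ ?_ ?_ ?_ le_rfl
    · rintro j s' ⟨h1, h2, -⟩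
      exact ⟨h1, by rw [h2 0 (by omega), hs.r0]⟩
    · refine ⟨by simp, (Agree.refl s).set (by omega) _ _, fun _ _ _ => rfl, fun v => ?_⟩
      by_cases h : v ∈ L.A.attr X τ T 0
      · rw [if_pos h]
        exact (hc4 v).2 h
      · rw [if_neg h]
    · rintro j hj s₁ ⟨h1, h2, h3, h4⟩
      have hs₁ : L.Holds s₁ := hs.of_agree h2 fun a ha => h3 a (Or.inl ha) (Or.inl (by omega))
      refine Runs.seq (T₁ := n * 45 + L.es.length * 45 + 18) (T₂ := 4) (R := fun s' =>
        s'.reg 20 = j ∧ Agree s s' ∧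
        (∀ a, (a < L.w.length ∨ L.w.length + n ≤ a) → (a < p ∨ p + n ≤ a) →
          s'.mem a = s.mem a) ∧
        ∀ v : Fin n, s'.mem (p + v) = if v ∈ L.A.attr X τ T (j + 1) then 4 else s.mem (p + v))
        ?_ ?_ (by omega)
      swap
      · rintro s' ⟨h1, h2, h3, h4⟩
        refine Runs.of_wp ?_ (by simp [Prog.time, Prog.inc, Exp.cost])
        simp [Prog.wp, Prog.inc, Exp.Ok, Exp.val, h1]
        exact ⟨by omega, h2.set (by omega) _ _, h3, h4⟩
      refine Runs.seq (T₂ := L.es.length * 45 + 6 + (n * 32 + 6)) (runs_clearProg hs₁) ?_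
        (by omega)
      rintro s₂ ⟨g1, g2, g3, g4⟩
      have hs₂ : L.Holds s₂ := hs₁.of_agree g1 fun a ha => g3 a (Or.inl ha)
      refine Runs.seq (runs_markProg hs₂ (τ := τ) (p := p) ?_ ?_ hp1 hp2 g4) ?_ le_rfl
      · rw [g1 12 (by omega), h2 12 (by omega), hp]
      · rw [g1 13 (by omega), h2 13 (by omega), hτ]
      rintro s₃ ⟨i1, i2, i3, i4⟩
      have hs₃ : L.Holds s₃ := hs₂.of_agree i1 fun a ha => i3 a (Or.inl ha)
      refine (runs_growProg hs₃ (τ := τ) (p := p) ?_ ?_ hp1 hp2 i4).mono le_rfl ?_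
      · rw [i1 12 (by omega), g1 12 (by omega), h2 12 (by omega), hp]
      · rw [i1 13 (by omega), g1 13 (by omega), h2 13 (by omega), hτ]
      rintro s₄ ⟨k1, k2, k3, k4⟩
      refine ⟨by omega, (h2.trans g1).trans (i1.trans k1), fun a ha ha' => ?_, fun v => ?_⟩
      · rw [k3 a ha', i3 a ha, g3 a ha, h3 a ha ha']
      · have e2 : ∀ v : Fin n, s₂.mem (p + v) = s₁.mem (p + v) := fun v => g3 _ (Or.inr (by omega))
        have e3 : ∀ v : Fin n, s₃.mem (p + v) = s₁.mem (p + v) := fun v => by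
          rw [i3 _ (Or.inr (by omega)), e2]
        have c4 : ∀ v : Fin n, s₁.mem (p + v) = 4 ↔ v ∈ L.A.attr X τ T j := fun v => by
          rw [h4 v]
          split_ifs with h
          · simp [h]
          · rw [hc4 v]
            exact ⟨fun hv => absurd (Arena.attr_mono (Nat.zero_le j) hv) h, fun hv => absurd hv h⟩
        have c2 : ∀ v : Fin n, s₁.mem (p + v) = 2 ↔ v ∈ X ∧ v ∉ L.A.attr X τ T j := fun v => by
          rw [h4 v]
          split_ifs with h
          · simp [h]
          · rw [hc2 v]
            exact ⟨fun hv => ⟨hv.1, h⟩, fun hv => ⟨hv.1, fun hvT =>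
              h (Arena.attr_mono (Nat.zero_le j) hvT)⟩⟩
        have hmk : Marked L τ s₂ p L.es v ↔ ∃ u, (v, u) ∈ L.A.edges ∧
            s₁.mem (p + u) = 2 + 2 * if L.A.owner v = τ then 1 else 0 := by
          constructor
          · rintro ⟨⟨a, u⟩, he, rfl, hm⟩
            exact ⟨u, (L.lists.2 _).1 he, by rw [← e2]; exact hm⟩
          · rintro ⟨u, he, hm⟩
            exact ⟨(v, u), (L.lists.2 _).2 he, rfl, by rw [e2]; exact hm⟩
        -- One round of marking and growing adds precisely the difference between two successive
        -- stages.
        have key : (s₁.mem (p + v) = 2 ∧ (Marked L τ s₂ p L.es v ↔ L.A.owner v = τ)) ↔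
            (v ∉ L.A.attr X τ T j ∧ v ∈ L.A.attr X τ T (j + 1)) := by
          rw [hmk, c2, Arena.attr]
          by_cases ho : L.A.owner v = τ
          · simp [ho, c4]
            tauto
          · simp [ho, c2]
            tauto
        rw [k4 v, e3 v]
        simp only [key]
        by_cases hv : v ∈ L.A.attr X τ T j
        · have hv' : v ∈ L.A.attr X τ T (j + 1) := Arena.attr_mono (Nat.le_succ j) hv
          rw [if_neg (by simp [hv]), if_pos hv']
          exact (c4 v).2 hv
        · rw [h4 v, if_neg hv]
          simp [hv]
    · rintro s' ⟨-, h2, h3, h4⟩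
      exact ⟨h2, h3, h4⟩
  · rintro s₁ ⟨h2, h3, h4⟩
    have hs₁ : L.Holds s₁ := hs.of_agree h2 fun a ha => h3 a (Or.inl ha) (Or.inl (by omega))
    refine (runs_recodeProg hs₁ (p := p) (x := x) ?_ ?_ hp1 hp2).mono le_rfl ?_
    · rw [h2 12 (by omega), hp]
    · rw [h2 14 (by omega), hx]
    rintro s' ⟨g1, g2, g3⟩
    refine ⟨h2.trans g1, fun a ha ha' => by rw [g2 a ha', h3 a ha ha'], fun v => ?_⟩
    have hat : L.A.attractor X τ T = L.A.attr X τ T n := by simp [Arena.attractor]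
    rw [g3 v, h4 v, hat]
    by_cases hv : v ∈ L.A.attr X τ T n
    · simp [hv]
    · have : s.mem (p + v) ≠ 4 := fun h =>
        hv (Arena.attr_mono (Nat.zero_le n) ((hc4 v).1 h))
      simp [hv, this]

end Attractor

end RegularGames

namespace RegularGames

/-! ### The main loop -/

section MainLoop

open Prog Exp

/-- The frame at `reg 5` describes a sub-arena `X` by the code `2`. Store who wins if all of `X` is
visited infinitely often, and start with the first position. -/
def startProg (ev : Prog) : Prog :=
  .seq ev
  (.seq (.store (.add (.reg 5) (.reg 0)) (.reg 20))
  (.seq (.store (.add (.add (.reg 5) (.reg 0)) (.lit 1)) (.lit 0)) (.set 7 (.lit 1))))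

/-- Copy the sub-arena to the frame at `reg 12`. -/
def copyProg : Prog := .forTo 21 0
  (.store (.add (.reg 12) (.reg 21))
    (.sub (.lit 3) (.eq (.mem (.add (.reg 5) (.reg 21))) (.lit 2))))

/-- Make a new frame for the part of the sub-arena outside the attractor of `reg 24`. -/
def pushProg : Prog :=
  .seq (.set 12 (.add (.reg 5) (.reg 11)))
  (.seq copyProg
  (.seq
    (.seq (.store (.add (.reg 12) (.reg 24)) (.lit 4))
      (.seq (.set 13 (.mem (.add (.reg 5) (.reg 0)))) (.set 14 (.lit 3))))
  (.seq attrProg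
    (.seq (.set 5 (.reg 12)) (.seq (.set 6 (.add (.reg 6) (.lit 1))) (.set 7 (.lit 0)))))))

/-- Assign the rest of the sub-arena to the player stored in the frame. -/
def assignProg : Prog := .forTo 21 0
  (.ite (.eq (.mem (.add (.reg 5) (.reg 21))) (.lit 2))
    (.store (.add (.reg 5) (.reg 21)) (.mem (.add (.reg 5) (.reg 0)))) .skip)

/-- Assign the rest of the sub-arena and return to the previous frame. -/
def finishProg : Prog :=
  .seq assignProg
    (.seq (.set 7 (.lit 2)) (.seq (.set 6 (.sub (.reg 6) (.lit 1)))
      (.set 5 (.sub (.reg 5) (.reg 11)))))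

/-- Try the next position. -/
def tryProg : Prog :=
  .seq (.set 24 (.mem (.add (.add (.reg 5) (.reg 0)) (.lit 1))))
  (.ite (.lt (.reg 24) (.reg 0))
    (.seq (.store (.add (.add (.reg 5) (.reg 0)) (.lit 1)) (.add (.reg 24) (.lit 1)))
      (.ite (.eq (.mem (.add (.reg 5) (.reg 24))) (.lit 2)) pushProg .skip))
    finishProg)

/-- Mark the positions that Player `reg 13` wins in the frame at `reg 25`. -/
def scanProg : Prog := .forTo 21 0
  (.ite (.eq (.mem (.add (.reg 25) (.reg 21))) (.reg 13))
    (.seq (.store (.add (.reg 5) (.reg 21)) (.lit 4)) (.set 24 (.lit 1))) .skip)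

/-- Use the result in the next frame. -/
def resumeProg : Prog :=
  .seq
    (.seq (.set 13 (.sub (.lit 1) (.mem (.add (.reg 5) (.reg 0)))))
    (.seq (.set 14 (.reg 13))
    (.seq (.set 12 (.reg 5))
    (.seq (.set 25 (.add (.reg 5) (.reg 11))) (.set 24 (.lit 0))))))
  (.seq scanProg
    (.ite (.reg 24) (.seq attrProg (.set 7 (.lit 0))) (.set 7 (.lit 1))))

/-- One step of the main loop. -/
def stepProg (ev : Prog) : Prog :=
  .ite (.eq (.reg 7) (.lit 0)) (startProg ev)
    (.ite (.eq (.reg 7) (.lit 1)) tryProg resumeProg)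

/-- The main loop: solve the sub-arenas in the frames until `reg 6` is `0`. -/
def mainLoop (ev : Prog) : Prog := .loop (.reg 6) (stepProg ev)

variable {n : ℕ} {L : Layout n} {s : State} {p d : ℕ} {cond : Set (Fin n) → Prop}

theorem Layout.Holds.set (h : L.Holds s) {i : ℕ} (hi : 20 ≤ i ∨ i ∈ [5, 6, 7, 12, 13, 14])
    (x : ℕ) : L.Holds ⟨Function.update s.reg i x, s.mem⟩ := by
  have key : ∀ j, j ∈ [0, 1, 2, 3, 4, 8, 9, 10, 11] →
      Function.update s.reg i x j = s.reg j := by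
    intro j hj
    refine Function.update_of_ne ?_ _ _
    simp at hi hj
    omega
  exact ⟨(key 0 (by simp)).trans h.r0, (key 1 (by simp)).trans h.r1, (key 2 (by simp)).trans h.r2,
    (key 3 (by simp)).trans h.r3, (key 4 (by simp)).trans h.r4, (key 8 (by simp)).trans h.r8,
    (key 9 (by simp)).trans h.r9, (key 10 (by simp)).trans h.r10, (key 11 (by simp)).trans h.r11,
    h.input⟩

theorem Layout.Holds.store (h : L.Holds s) {a : ℕ} (ha : L.w.length ≤ a) (x : ℕ) :
    L.Holds ⟨s.reg, Function.update s.mem a x⟩ := by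
  refine h.of_agree (fun _ _ => rfl) fun b hb => ?_
  exact Function.update_of_ne (by omega) _ _

/-- The main loop is at the frame `p` at depth `d`, in mode `m`. -/
structure Layout.At (L : Layout n) (s : State) (p d m : ℕ) : Prop extends L.Holds s where
  frame : s.reg 5 = p
  depth : s.reg 6 = d
  mode : s.reg 7 = m

theorem Layout.At.of_agree {m : ℕ} {s' : State} (h : L.At s p d m) (ha : Agree s s')
    (hm : ∀ a < L.w.length, s'.mem a = s.mem a) : L.At s' p d m :=
  ⟨h.toHolds.of_agree ha hm, (ha 5 (by omega)).trans h.frame, (ha 6 (by omega)).trans h.depth,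
    (ha 7 (by omega)).trans h.mode⟩

open Classical in
/-- The winner of the plays with infinity set `X`. -/
noncomputable def winner (cond : Set (Fin n) → Prop) (X : Set (Fin n)) : Player :=
  if cond X then 0 else 1

theorem winner_spec (cond : Set (Fin n) → Prop) (X : Set (Fin n)) :
    if winner cond X = 0 then cond X else ¬ cond X := by
  unfold winner
  by_cases h : cond X <;> simp [h]

/-- The positions with code `2` in the frame `p`. -/
def codeSet (s : State) (n p : ℕ) : Set (Fin n) := {v | s.mem (p + v) = 2}

/-- The program `ev` computes the winner for the set in the frame at `reg 5` in time `T`. -/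
def Evaluates (L : Layout n) (cond : Set (Fin n) → Prop) (ev : Prog) (T : ℕ) : Prop :=
  ∀ s, L.Holds s → s.reg 5 + n ≤ L.S → Runs L.S ev s T fun s' =>
    Agree s s' ∧ s'.mem = s.mem ∧ s'.reg 20 = winner cond (codeSet s n (s.reg 5))

theorem runs_startProg {ev : Prog} {T : ℕ} (hev : Evaluates L cond ev T) (hs : L.At s p d 0)
    (hp1 : L.w.length ≤ p) (hp2 : p + n + 1 < L.S) :
    Runs L.S (startProg ev) s (T + 20) fun s' => L.At s' p d 1 ∧
      (∀ a, a < p + n ∨ p + n + 2 ≤ a → s'.mem a = s.mem a) ∧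
      s'.mem (p + n) = winner cond (codeSet s n p) ∧ s'.mem (p + n + 1) = 0 := by
  have hS := L.le_S
  refine Runs.seq (hev s hs.toHolds (by rw [hs.frame]; omega)) ?_ le_rfl
  rintro s₁ ⟨h1, h2, h3⟩
  have hs₁ : L.At s₁ p d 0 := hs.of_agree h1 fun a _ => by rw [h2]
  rw [hs.frame] at h3
  refine Runs.of_wp ?_ (by simp [Prog.time, Exp.cost])
  simp [Prog.wp, Exp.Ok, Exp.val, hs₁.frame, hs₁.r0, h3]
  refine ⟨by omega, by omega, ⟨?_, ?_, ?_, ?_⟩, fun a ha => ?_⟩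
  · exact ((hs₁.toHolds.store (by omega) _).store (a := p + n + 1) (by omega) 0).set (by simp) 1
  · simp [hs₁.frame]
  · simp [hs₁.depth]
  · simp
  · rw [Function.update_of_ne (by omega), Function.update_of_ne (by omega), h2]

theorem runs_copyProg (hs : L.Holds s) {q : ℕ} (hp : s.reg 5 = p) (hq : s.reg 12 = q)
    (hpq : p + n ≤ q) (hqS : q + n ≤ L.S) :
    Runs L.S copyProg s (n * 20 + 6) fun s' => Agree s s' ∧ s'.reg 24 = s.reg 24 ∧
      (∀ a, a < q ∨ q + n ≤ a → s'.mem a = s.mem a) ∧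
      ∀ v : Fin n, s'.mem (q + v) = if s.mem (p + v) = 2 then 2 else 3 := by
  refine Runs.forTo (N := n) (T := 16) (fun j s' => s'.reg 21 = j ∧ Agree s s' ∧
    s'.reg 24 = s.reg 24 ∧ (∀ a, a < q ∨ q + n ≤ a → s'.mem a = s.mem a) ∧
    ∀ v : Fin n, v < j → s'.mem (q + v) = if s.mem (p + v) = 2 then 2 else 3)
    ?_ ?_ ?_ ?_ (by omega)
  · rintro j s' ⟨h1, h2, -⟩
    exact ⟨h1, by rw [h2 0 (by omega), hs.r0]⟩
  · exact ⟨by simp, (Agree.refl s).set (by omega) _ _, by simp, fun _ _ => rfl, by simp⟩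
  · rintro j hj s' ⟨h1, h2, h3, h4, h5⟩
    have e5 : s'.reg 5 = p := by rw [h2 5 (by omega), hp]
    have e12 : s'.reg 12 = q := by rw [h2 12 (by omega), hq]
    have m1 : s'.mem (p + j) = s.mem (p + j) := h4 _ (Or.inl (by omega))
    refine Runs.of_wp ?_ (by simp [Prog.time, Prog.inc, Exp.cost])
    simp [Prog.wp, Prog.inc, Exp.Ok, Exp.val, h1, e5, e12, m1, -Order.lt_add_one_iff]
    refine ⟨by omega, by omega, by omega, h2.set (by omega) _ _, h3, fun a ha => ?_,
      fun v hv => ?_⟩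
    · rw [Function.update_of_ne (by omega), h4 a ha]
    · rw [Function.update_apply]
      by_cases hv' : (v : ℕ) = j
      · rw [if_pos (by omega), hv']
        split_ifs <;> rfl
      · rw [if_neg (by omega), h5 v (by omega)]
  · rintro s' ⟨-, h2, h3, h4, h5⟩
    exact ⟨h2, h3, h4, fun v => h5 v v.2⟩

/-- The time for the computation of an attractor. -/
def Layout.attrTime (L : Layout n) : ℕ := n * (n * 45 + L.es.length * 45 + 26) + n * 20 + 12

/-- Results already stored in the parent frame are hidden in the copy: every code other than `2`
becomes `3`. That the new frame holds only `2` and `3` ensures that a code `0` or `1` found there on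
return is a result of the smaller game. -/
theorem runs_pushProg (hs : L.At s p d 1) {σ : Player} {c : Fin n} (hc : s.reg 24 = c)
    (hcX : c ∈ codeSet s n p) (hσ : s.mem (p + n) = σ)
    (hp1 : L.w.length + n ≤ p) (hp2 : p + 2 * (n + 2) ≤ L.S) (hd : d + 1 < L.S) :
    Runs L.S pushProg s (L.attrTime + n * 20 + 40) fun s' => L.At s' (p + (n + 2)) (d + 1) 0 ∧
      (∀ a < p + (n + 2), (a < L.w.length ∨ L.w.length + n ≤ a) → s'.mem a = s.mem a) ∧
      (∀ v : Fin n, s'.mem (p + (n + 2) + v) = 2 ∨ s'.mem (p + (n + 2) + v) = 3) ∧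
      codeSet s' n (p + (n + 2)) = codeSet s n p \ L.A.attractor (codeSet s n p) σ {c} := by
  have hS := L.le_S
  refine Runs.seq (T₁ := 4) (T₂ := L.attrTime + n * 20 + 36) (R := fun s' => L.At s' p d 1 ∧
    s'.reg 12 = p + (n + 2) ∧ s'.reg 24 = c ∧ s'.mem = s.mem)
    (Runs.of_wp ?_ (by simp [Prog.time, Exp.cost])) ?_ (by omega)
  · simp [Prog.wp, Exp.Ok, Exp.val, hs.frame, hs.r11, hc]
    exact ⟨by omega, hs.toHolds.set (by simp) _, by simp [hs.frame], by simp [hs.depth],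
      by simp [hs.mode]⟩
  rintro s₁ ⟨h1, h2, h3, h4⟩
  refine Runs.seq (T₂ := L.attrTime + 30) (runs_copyProg h1.toHolds h1.frame h2 (by omega)
    (by omega)) ?_ (by omega)
  rintro s₂ ⟨a1, a2, a3, a4⟩
  have hs₂ : L.At s₂ p d 1 := h1.of_agree a1 fun a ha => a3 a (Or.inl (by omega))
  have b12 : s₂.reg 12 = p + (n + 2) := by rw [a1 12 (by omega), h2]
  have b24 : s₂.reg 24 = c := by rw [a2, h3]
  have bn : s₂.mem (p + n) = σ := by rw [a3 _ (Or.inl (by omega)), h4, hσ]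
  refine Runs.seq (T₁ := 12) (T₂ := L.attrTime + 18) (R := fun s' => L.At s' p d 1 ∧
    s'.reg 12 = p + (n + 2) ∧ s'.reg 13 = σ ∧ s'.reg 14 = 3 ∧
    s'.mem = Function.update s₂.mem (p + (n + 2) + c) 4)
    (Runs.of_wp ?_ (by simp [Prog.time, Exp.cost])) ?_ (by omega)
  · have : p + n ≠ p + (n + 2) + c := by omega
    simp [Prog.wp, Exp.Ok, Exp.val, hs₂.frame, hs₂.r0, b12, b24, Function.update_of_ne this, bn]
    exact ⟨by omega, by omega, ((hs₂.toHolds.store (by omega) _).set (by simp) _).set (by simp) _,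
      by simp [hs₂.frame], by simp [hs₂.depth], by simp [hs₂.mode]⟩
  rintro s₃ ⟨c1, c2, c3, c4, c5⟩
  have code : ∀ v : Fin n, s₃.mem (p + (n + 2) + v) =
      if v = c then 4 else if s.mem (p + v) = 2 then 2 else 3 := by
    intro v
    rw [c5, Function.update_apply]
    by_cases hv : v = c
    · simp [hv]
    · rw [if_neg (fun h => hv (Fin.ext (by omega))), if_neg hv, a4, h4]
  have memX : ∀ v : Fin n, v ∈ codeSet s n p ↔ s.mem (p + v) = 2 := fun v => Iff.rfl
  refine Runs.seq (T₂ := 18) (runs_attrProg c1.toHolds c2 c3 c4 (by omega) (by omega)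
    (X := codeSet s n p) (T := {c}) ?_ ?_) ?_ (by rw [Layout.attrTime])
  · intro v
    rw [code v, Set.mem_singleton_iff]
    split_ifs <;> simp_all
  · intro v
    rw [code v, Set.mem_sdiff, Set.mem_singleton_iff, memX]
    split_ifs <;> simp_all
  rintro s₄ ⟨e1, e2, e3⟩
  have hs₄ : L.At s₄ p d 1 := c1.of_agree e1 fun a ha => e2 a (Or.inl ha) (Or.inl (by omega))
  have f12 : s₄.reg 12 = p + (n + 2) := by rw [e1 12 (by omega), c2]
  refine Runs.of_wp ?_ (by simp [Prog.time, Exp.cost])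
  simp [Prog.wp, Exp.Ok, Exp.val, f12, hs₄.depth]
  refine ⟨by omega, ⟨((hs₄.toHolds.set (by simp) _).set (by simp) _).set (by simp) _, by simp,
    by simp, by simp⟩, fun a ha ha' => ?_, fun v => ?_, ?_⟩
  · rw [e2 a ha' (Or.inl ha), c5, Function.update_of_ne (by omega), a3 _ (Or.inl ha), h4]
  · rw [e3 v, code v]
    by_cases hv : v = c
    · subst hv
      rw [if_pos (Arena.subset_attractor (Set.mem_singleton _))]
      exact Or.inr rfl
    · rw [if_neg hv]
      split_ifs <;> omega
  · ext v
    have : v ∈ codeSet s₄ n (p + (n + 2)) ↔ s₄.mem (p + (n + 2) + v) = 2 := Iff.rfl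
    refine Iff.trans this ?_
    rw [e3 v, code v, Set.mem_sdiff, memX]
    by_cases hv : v = c
    · subst hv
      have : v ∈ L.A.attractor (codeSet s n p) σ {v} := Arena.subset_attractor (Set.mem_singleton _)
      simp [this]
    · by_cases hv' : v ∈ L.A.attractor (codeSet s n p) σ {c} <;> simp [hv, hv']

theorem runs_assignProg (hs : L.Holds s) {x : ℕ} (hp : s.reg 5 = p) (hx : s.mem (p + n) = x)
    (hp2 : p + n < L.S) :
    Runs L.S assignProg s (n * 23 + 6) fun s' => Agree s s' ∧
      (∀ a, a < p ∨ p + n ≤ a → s'.mem a = s.mem a) ∧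
      ∀ v : Fin n, s'.mem (p + v) = if s.mem (p + v) = 2 then x else s.mem (p + v) := by
  refine Runs.forTo (N := n) (T := 19) (fun j s' => s'.reg 21 = j ∧ Agree s s' ∧
    (∀ a, a < p ∨ p + n ≤ a → s'.mem a = s.mem a) ∧
    ∀ v : Fin n, s'.mem (p + v) =
        if v < j ∧ s.mem (p + v) = 2 then x else s.mem (p + v))
    ?_ ?_ ?_ ?_ (by omega)
  · rintro j s' ⟨h1, h2, -⟩
    exact ⟨h1, by rw [h2 0 (by omega), hs.r0]⟩
  · exact ⟨by simp, (Agree.refl s).set (by omega) _ _, fun _ _ => rfl, by simp⟩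
  · rintro j hj s' ⟨h1, h2, h4, h5⟩
    have e0 : s'.reg 0 = n := by rw [h2 0 (by omega), hs.r0]
    have e5 : s'.reg 5 = p := by rw [h2 5 (by omega), hp]
    have e : s'.mem (p + n) = x := by rw [h4 _ (Or.inr le_rfl), hx]
    have m2 : s'.mem (p + j) = s.mem (p + j) := by
      have := h5 ⟨j, hj⟩
      simpa using this
    refine Runs.of_wp ?_ (by simp [Prog.time, Prog.inc, Exp.cost])
    simp [Prog.wp, Prog.inc, Exp.Ok, Exp.val, h1, e0, e5, e, m2, -Order.lt_add_one_iff]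
    refine ⟨by omega, fun hc => ⟨by omega, by omega, by omega, h2.set (by omega) _ _,
      fun a ha => ?_, fun v => ?_⟩, fun hc => ⟨by omega, h2.set (by omega) _ _, h4, fun v => ?_⟩⟩
    · rw [Function.update_of_ne (by omega), h4 a ha]
    · rw [Function.update_apply]
      by_cases hv : (v : ℕ) = j
      · rw [if_pos (by omega), if_pos ⟨by omega, by rw [hv]; exact hc⟩]
      · rw [if_neg (by omega), h5 v]
        congr 2
        exact propext ⟨fun h => by omega, fun h => by omega⟩
    · rw [h5 v]
      by_cases hv : (v : ℕ) = j
      · rw [if_neg (by omega), if_neg (by rw [hv]; tauto)]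
      · congr 2
        exact propext ⟨fun h => by omega, fun h => by omega⟩
  · rintro s' ⟨-, h2, h4, h5⟩
    exact ⟨h2, h4, fun v => by simpa using h5 v⟩

theorem runs_finishProg (hs : L.At s p d 1) {x : ℕ} (hx : s.mem (p + n) = x)
    (hp1 : L.w.length ≤ p) (hp2 : p + n < L.S) :
    Runs L.S finishProg s (n * 23 + 20) fun s' => L.At s' (p - (n + 2)) (d - 1) 2 ∧
      (∀ a, a < p ∨ p + n ≤ a → s'.mem a = s.mem a) ∧
      ∀ v : Fin n, s'.mem (p + v) = if s.mem (p + v) = 2 then x else s.mem (p + v) := by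
  refine Runs.seq (T₂ := 14) (runs_assignProg hs.toHolds hs.frame hx hp2) ?_ (by omega)
  rintro s₁ ⟨h1, h2, h3⟩
  have hs₁ : L.At s₁ p d 1 := hs.of_agree h1 fun a ha => h2 a (Or.inl (by omega))
  refine Runs.of_wp ?_ (by simp [Prog.time, Exp.cost])
  simp [Prog.wp, Exp.Ok, Exp.val, hs₁.depth, hs₁.frame, hs₁.r11]
  exact ⟨⟨((hs₁.toHolds.set (by simp) _).set (by simp) _).set (by simp) _, by simp, by simp,
    by simp⟩, h2, h3⟩

/-- The cell `p + n + 1` of the frame holds the next candidate. It is advanced before the push, so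
that the search continues correctly after the return. The two theorems on `tryProg` further below
cover a candidate outside the sub-arena and the end of the search. -/
theorem runs_tryProg_of_mem (hs : L.At s p d 1) {σ : Player} {c : Fin n}
    (hc : s.mem (p + n + 1) = c) (hcX : c ∈ codeSet s n p) (hσ : s.mem (p + n) = σ)
    (hp1 : L.w.length + n ≤ p) (hp2 : p + 2 * (n + 2) ≤ L.S) (hd : d + 1 < L.S) :
    Runs L.S tryProg s (L.attrTime + n * 22 + 80) fun s' => L.At s' (p + (n + 2)) (d + 1) 0 ∧
      (∀ a < p + n + 1, (a < L.w.length ∨ L.w.length + n ≤ a) → s'.mem a = s.mem a) ∧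
      s'.mem (p + n + 1) = c + 1 ∧
      (∀ v : Fin n, s'.mem (p + (n + 2) + v) = 2 ∨ s'.mem (p + (n + 2) + v) = 3) ∧
      codeSet s' n (p + (n + 2)) = codeSet s n p \ L.A.attractor (codeSet s n p) σ {c} := by
  have hS := L.le_S
  have hcX' : s.mem (p + c) = 2 := hcX
  refine Runs.seq (T₁ := 7) (T₂ := L.attrTime + n * 22 + 70)
    (R := fun s' => L.At s' p d 1 ∧ s'.reg 24 = c ∧ s'.mem = s.mem)
    (Runs.of_wp ?_ (by simp [Prog.time, Exp.cost])) ?_ (by omega)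
  · simp [Prog.wp, Exp.Ok, Exp.val, hs.frame, hs.r0, hc]
    exact ⟨by omega, hs.toHolds.set (by simp) _, by simp [hs.frame], by simp [hs.depth],
      by simp [hs.mode]⟩
  rintro s₁ ⟨h1, h2, h3⟩
  refine Runs.ite (T₁ := L.attrTime + n * 22 + 66) (by simp [Exp.Ok]) (fun _ => ?_)
    (fun h => ?_) (by simp [Exp.cost]; omega)
  swap
  · simp [Exp.val, h2, h1.r0] at h
  refine Runs.seq (T₁ := 10) (T₂ := L.attrTime + n * 22 + 50)
    (R := fun s' => L.At s' p d 1 ∧ s'.reg 24 = c ∧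
      s'.mem = Function.update s.mem (p + n + 1) (c + 1))
    (Runs.of_wp ?_ (by simp [Prog.time, Exp.cost])) ?_ (by omega)
  · simp [Prog.wp, Exp.Ok, Exp.val, h1.frame, h1.r0, h2, h3]
    refine ⟨by omega, by omega, ?_, by simp [h1.frame], by simp [h1.depth], by simp [h1.mode]⟩
    rw [← h3]
    exact h1.toHolds.store (by omega) _
  rintro s₂ ⟨a1, a2, a3⟩
  have hcode : codeSet s₂ n p = codeSet s n p := by
    ext v
    simp only [codeSet, Set.mem_ofPred_eq, a3]
    rw [Function.update_of_ne (by omega)]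
  refine Runs.ite (T₁ := L.attrTime + n * 20 + 40) ?_ (fun _ => ?_) (fun h => ?_)
    (by simp [Exp.cost]; omega)
  · simp [Exp.Ok, Exp.val, a1.frame, a2]
    omega
  · refine (runs_pushProg a1 a2 (hcode ▸ hcX) (σ := σ) ?_ hp1 hp2 hd).mono le_rfl ?_
    · rw [a3, Function.update_of_ne (by omega), hσ]
    · rintro s' ⟨b1, b2, b3, b4⟩
      refine ⟨b1, fun a ha ha' => ?_, ?_, b3, by rw [b4, hcode]⟩
      · rw [b2 a (by omega) ha', a3, Function.update_of_ne (by omega)]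
      · rw [b2 _ (by omega) (Or.inr (by omega)), a3, Function.update_self]
  · exfalso
    have : s₂.mem (p + c) = 2 := by rw [a3, Function.update_of_ne (by omega), hcX']
    simp [Exp.val, a1.frame, a2, this] at h

theorem runs_tryProg_of_notMem (hs : L.At s p d 1) {c : Fin n}
    (hc : s.mem (p + n + 1) = c) (hcX : c ∉ codeSet s n p)
    (hp1 : L.w.length + n ≤ p) (hp2 : p + (n + 2) ≤ L.S) :
    Runs L.S tryProg s 40 fun s' => L.At s' p d 1 ∧
      (∀ a, a ≠ p + n + 1 → s'.mem a = s.mem a) ∧ s'.mem (p + n + 1) = c + 1 := by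
  have hS := L.le_S
  have hcX' : s.mem (p + c) ≠ 2 := hcX
  refine Runs.seq (T₁ := 7) (T₂ := 33)
    (R := fun s' => L.At s' p d 1 ∧ s'.reg 24 = c ∧ s'.mem = s.mem)
    (Runs.of_wp ?_ (by simp [Prog.time, Exp.cost])) ?_ (by omega)
  · simp [Prog.wp, Exp.Ok, Exp.val, hs.frame, hs.r0, hc]
    exact ⟨by omega, hs.toHolds.set (by simp) _, by simp [hs.frame], by simp [hs.depth],
      by simp [hs.mode]⟩
  rintro s₁ ⟨h1, h2, h3⟩
  refine Runs.ite (T₁ := 29) (by simp [Exp.Ok]) (fun _ => ?_)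
    (fun h => ?_) (by simp [Exp.cost])
  swap
  · simp [Exp.val, h2, h1.r0] at h
  refine Runs.seq (T₁ := 10) (T₂ := 19)
    (R := fun s' => L.At s' p d 1 ∧ s'.reg 24 = c ∧
      s'.mem = Function.update s.mem (p + n + 1) (c + 1))
    (Runs.of_wp ?_ (by simp [Prog.time, Exp.cost])) ?_ (by omega)
  · simp [Prog.wp, Exp.Ok, Exp.val, h1.frame, h1.r0, h2, h3]
    refine ⟨by omega, by omega, ?_, by simp [h1.frame], by simp [h1.depth], by simp [h1.mode]⟩
    rw [← h3]
    exact h1.toHolds.store (by omega) _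
  rintro s₂ ⟨a1, a2, a3⟩
  refine Runs.ite (T₁ := 1) ?_ (fun h => ?_) (fun _ => ?_) (by simp [Exp.cost])
  · simp [Exp.Ok, Exp.val, a1.frame, a2]
    omega
  · exfalso
    have : s₂.mem (p + c) ≠ 2 := by rw [a3, Function.update_of_ne (by omega)]; exact hcX'
    simp [Exp.val, a1.frame, a2, this] at h
  · refine Runs.of_wp ⟨a1, fun a ha => ?_, ?_⟩ le_rfl
    · rw [a3, Function.update_of_ne ha]
    · rw [a3, Function.update_self]

theorem runs_tryProg_of_eq (hs : L.At s p d 1) {x : ℕ} (hx : s.mem (p + n) = x)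
    (hc : s.mem (p + n + 1) = n) (hp1 : L.w.length ≤ p) (hp2 : p + n + 1 < L.S) :
    Runs L.S tryProg s (n * 23 + 40) fun s' => L.At s' (p - (n + 2)) (d - 1) 2 ∧
      (∀ a, a < p ∨ p + n ≤ a → s'.mem a = s.mem a) ∧
      ∀ v : Fin n, s'.mem (p + v) = if s.mem (p + v) = 2 then x else s.mem (p + v) := by
  refine Runs.seq (T₁ := 7) (T₂ := n * 23 + 33)
    (R := fun s' => L.At s' p d 1 ∧ s'.reg 24 = n ∧ s'.mem = s.mem)
    (Runs.of_wp ?_ (by simp [Prog.time, Exp.cost])) ?_ (by omega)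
  · simp [Prog.wp, Exp.Ok, Exp.val, hs.frame, hs.r0, hc]
    exact ⟨by omega, hs.toHolds.set (by simp) _, by simp [hs.frame], by simp [hs.depth],
      by simp [hs.mode]⟩
  rintro s₁ ⟨h1, h2, h3⟩
  refine Runs.ite (T₁ := n * 23 + 20) (by simp [Exp.Ok]) (fun h => ?_)
    (fun _ => ?_) (by simp [Exp.cost]; omega)
  · simp [Exp.val, h2, h1.r0] at h
  · rw [← h3] at hx ⊢
    exact runs_finishProg h1 hx hp1 (by omega)

open Classical in
-- As `p + n ≤ q`, the writes to the parent frame do not disturb the child frame that is being read.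
theorem runs_scanProg (hs : L.Holds s) {q x : ℕ} (hp : s.reg 5 = p) (hq : s.reg 25 = q)
    (hx : s.reg 13 = x) (h0 : s.reg 24 = 0) (hp2 : p + n ≤ q)
    (hp3 : q + n ≤ L.S) :
    Runs L.S scanProg s (n * 25 + 6) fun s' => Agree s s' ∧
      (s'.reg 24 = if ∃ v : Fin n, s.mem (q + v) = x then 1 else 0) ∧
      (∀ a, a < p ∨ p + n ≤ a → s'.mem a = s.mem a) ∧
      ∀ v : Fin n, s'.mem (p + v) = if s.mem (q + v) = x then 4 else s.mem (p + v) := by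
  refine Runs.forTo (N := n) (T := 21) (fun j s' => s'.reg 21 = j ∧ Agree s s' ∧
    s'.reg 25 = q ∧
    (s'.reg 24 = if ∃ v : Fin n, v < j ∧ s.mem (q + v) = x then 1 else 0) ∧
    (∀ a, a < p ∨ p + n ≤ a → s'.mem a = s.mem a) ∧
    ∀ v : Fin n, s'.mem (p + v) =
        if v < j ∧ s.mem (q + v) = x then 4 else s.mem (p + v))
    ?_ ?_ ?_ ?_ (by omega)
  · rintro j s' ⟨h1, h2, -⟩
    exact ⟨h1, by rw [h2 0 (by omega), hs.r0]⟩
  · exact ⟨by simp, (Agree.refl s).set (by omega) _ _, by simp [hq], by simp [h0],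
      fun _ _ => rfl, by simp⟩
  · rintro j hj s' ⟨h1, h2, h3, h4, h5, h6⟩
    have e5 : s'.reg 5 = p := by rw [h2 5 (by omega), hp]
    have e13 : s'.reg 13 = x := by rw [h2 13 (by omega), hx]
    have m : s'.mem (q + j) = s.mem (q + j) := h5 _ (Or.inr (by omega))
    refine Runs.of_wp ?_ (by simp [Prog.time, Prog.inc, Exp.cost])
    simp [Prog.wp, Prog.inc, Exp.Ok, Exp.val, h1, h3, e5, e13, m, -Order.lt_add_one_iff]
    refine ⟨by omega, fun hc => ⟨by omega, by omega, (h2.set (by omega) _ s'.mem).set (by omega) _ _,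
      ⟨⟨j, hj⟩, by simp, hc⟩, fun a ha => ?_, fun v => ?_⟩, fun hc => ⟨by omega,
      h2.set (by omega) _ _, ?_, h5, fun v => ?_⟩⟩
    · rw [Function.update_of_ne (by omega), h5 a ha]
    · rw [Function.update_apply]
      by_cases hv : (v : ℕ) = j
      · rw [if_pos (by omega), if_pos ⟨by omega, by rw [hv]; exact hc⟩]
      · rw [if_neg (by omega), h6 v]
        congr 2
        exact propext ⟨fun h => by omega, fun h => by omega⟩
    · rw [h4]
      congr 1
      refine propext ⟨fun ⟨v, hv, hx⟩ => ⟨v, by omega, hx⟩, fun ⟨v, hv, hx⟩ => ⟨v, ?_, hx⟩⟩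
      have : (v : ℕ) ≠ j := by rintro rfl; exact hc hx
      omega
    · rw [h6 v]
      by_cases hv : (v : ℕ) = j
      · rw [if_neg (by omega), if_neg (by rw [hv]; tauto)]
      · congr 2
        exact propext ⟨fun h => by omega, fun h => by omega⟩
  · rintro s' ⟨-, h2, h3, h4, h5, h6⟩
    refine ⟨h2, by rw [h4]; simp, h5, fun v => by simpa using h6 v⟩

/-- The bound `hle` keeps the code `4` free for marking `W`. The attractor of `W` receives its final
code `τ` at once; the positions that keep the code `2` form the sub-arena for the restart in the
same frame. -/
theorem runs_resumeProg (hs : L.At s p d 2) {σ τ : Player} (hσ : s.mem (p + n) = σ)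
    (hτ : τ = 1 - σ) {W : Set (Fin n)} (hW : ∀ v : Fin n, s.mem (p + (n + 2) + v) = τ ↔ v ∈ W)
    (hle : ∀ v : Fin n, s.mem (p + v) ≤ 3)
    (hp1 : L.w.length + n ≤ p) (hp2 : p + 2 * (n + 2) ≤ L.S) :
    Runs L.S resumeProg s (L.attrTime + n * 25 + 50) fun s' =>
      (W = ∅ → L.At s' p d 1 ∧ s'.mem = s.mem) ∧
      (W.Nonempty → L.At s' p d 0 ∧
        (∀ a, (a < L.w.length ∨ L.w.length + n ≤ a) → (a < p ∨ p + n ≤ a) →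
          s'.mem a = s.mem a) ∧
        (∀ v ∈ L.A.attractor (codeSet s n p) τ W, s'.mem (p + v) = τ) ∧
        ∀ v ∉ L.A.attractor (codeSet s n p) τ W, s'.mem (p + v) = s.mem (p + v)) := by
  classical
  have hS := L.le_S
  have hτ' : 1 - (σ : ℕ) = τ := by
    have : ∀ σ : Player, 1 - (σ : ℕ) = (1 - σ : Player) := by decide
    rw [hτ, this]
  refine Runs.seq (T₁ := 20) (T₂ := L.attrTime + n * 25 + 30) (R := fun s' => L.At s' p d 2 ∧
    s'.reg 13 = τ ∧ s'.reg 14 = τ ∧ s'.reg 12 = p ∧ s'.reg 25 = p + (n + 2) ∧ s'.reg 24 = 0 ∧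
    s'.mem = s.mem) (Runs.of_wp ?_ (by simp [Prog.time, Exp.cost])) ?_ (by omega)
  · simp [Prog.wp, Exp.Ok, Exp.val, hs.frame, hs.r0, hs.r11, hσ, hτ']
    exact ⟨by omega, by omega, ((((hs.toHolds.set (by simp) _).set (by simp) _).set
      (by simp) _).set (by simp) _).set (by simp) _, by simp [hs.frame], by simp [hs.depth],
      by simp [hs.mode]⟩
  rintro s₁ ⟨h1, h13, h14, h12, h25, h24, hm⟩
  refine Runs.seq (T₂ := L.attrTime + 20) (runs_scanProg h1.toHolds h1.frame h25 h13 h24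
    (by omega) (by omega)) ?_ (by omega)
  rintro s₂ ⟨a1, a2, a3, a4⟩
  rw [hm] at a2
  have hs₂ : L.At s₂ p d 2 := h1.of_agree a1 fun a ha => a3 a (Or.inl (by omega))
  have code : ∀ v : Fin n, s₂.mem (p + v) = if v ∈ W then 4 else s.mem (p + v) := by
    intro v
    rw [a4, hm]
    simp only [hW]
  refine Runs.ite (T₁ := L.attrTime + 4) (by simp [Exp.Ok]) (fun h => ?_) (fun h => ?_)
    (by simp [Exp.cost]; omega)
  · have hne : W.Nonempty := by
      by_contra hne
      rw [Set.not_nonempty_iff_eq_empty] at hne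
      simp [Exp.val, a2, hW, hne] at h
    refine Runs.seq (T₂ := 4) (runs_attrProg hs₂.toHolds (p := p) (x := τ) (τ := τ)
      (X := codeSet s n p) (T := W) ?_ ?_ ?_ hp1 (by omega) ?_ ?_) ?_ (by rw [Layout.attrTime])
    · rw [a1 12 (by omega), h12]
    · rw [a1 13 (by omega), h13]
    · rw [a1 14 (by omega), h14]
    · intro v
      have := hle v
      rw [code v]
      split_ifs with hv
      · simp [hv]
      · simp only [hv, iff_false]; omega
    · intro v
      have e : v ∈ codeSet s n p ↔ s.mem (p + v) = 2 := Iff.rfl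
      rw [code v, Set.mem_sdiff, e]
      split_ifs with hv <;> simp [hv]
    rintro s₃ ⟨b1, b2, b3⟩
    have hs₃ : L.At s₃ p d 2 := hs₂.of_agree b1 fun a ha => b2 a (Or.inl ha) (Or.inl (by omega))
    refine Runs.of_wp ?_ (by simp [Prog.time, Exp.cost])
    refine ⟨by simp [Exp.Ok], fun h => absurd h hne.ne_empty, fun _ => ⟨⟨hs₃.toHolds.set (by simp) _,
      by simp [hs₃.frame], by simp [hs₃.depth], by simp [Exp.val]⟩, fun a ha ha' => ?_, fun v hv => ?_,
      fun v hv => ?_⟩⟩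
    · simp only
      rw [b2 a ha ha', a3 a ha', hm]
    · simp only
      rw [b3, if_pos hv]
    · simp only
      rw [b3, if_neg hv, code, if_neg fun h => hv (Arena.subset_attractor h)]
  · have hemp : W = ∅ := by
      by_contra hne
      obtain ⟨v, hv⟩ := Set.nonempty_iff_ne_empty.2 hne
      have : ∃ v, v ∈ W := ⟨v, hv⟩
      simp [Exp.val, a2, hW, this] at h
    refine Runs.of_wp ?_ (by simp [Prog.time, Exp.cost])
    refine ⟨by simp [Exp.Ok], fun _ => ⟨⟨hs₂.toHolds.set (by simp) _,
      by simp [hs₂.frame], by simp [hs₂.depth], by simp [Exp.val]⟩, ?_⟩,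
      fun h => absurd hemp h.ne_empty⟩
    funext a
    simp only
    by_cases ha : a < p ∨ p + n ≤ a
    · rw [a3 a ha, hm]
    · have := code ⟨a - p, by omega⟩
      simp only [Nat.add_sub_cancel' (show p ≤ a by omega)] at this
      rw [this, if_neg (by simp [hemp])]

end MainLoop

end RegularGames

namespace RegularGames

/-! ### The recurrence for the time, and correctness of the main loop -/

section Recursion

variable {n : ℕ} {L : Layout n} {s : State} {p d : ℕ} {cond : Set (Fin n) → Prop} {ev : Prog}

/-- The time for the solution of a sub-arena with `m` positions, in units of the time for one step
of the main loop. -/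
def nodeTime : ℕ → ℕ
  | 0 => 3
  | 1 => 3
  | m + 2 => (m + 2) * (nodeTime (m + 1) + 2) + nodeTime m + 3

/-- The time for the rest of a sub-arena with `m` positions after the first restart. -/
def restTime : ℕ → ℕ
  | 0 => 0
  | 1 => 0
  | m + 2 => nodeTime m

/-- Induction needs a bound slightly better than a multiple of `k!`. For `k = m + 2` the claim is
`nodeTime k ≤ 24 * (k - 1) / (k + 1) * k!`; the factor `1 - 2 / (k + 1)` grows with `k`, and its
growth pays for the terms `nodeTime (k - 2)` and `2 * k + 3` of the recurrence. -/
theorem nodeTime_bound (m : ℕ) :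
    (m + 3) * nodeTime (m + 2) ≤ 24 * ((m + 1) * (m + 2).factorial) := by
  induction m using Nat.strong_induction_on with
  | _ m ih =>
    match m with
    -- The constant `24` is dictated by this case, which is an equality: `nodeTime 2 = 16`.
    | 0 => decide
    | 1 => decide
    | m + 2 =>
      have h1 := ih (m + 1) (by omega)
      have h0 := ih m (by omega)
      have e : nodeTime (m + 2 + 2) =
        (m + 2 + 2) * (nodeTime (m + 1 + 2) + 2) + nodeTime (m + 2) + 3 := rfl
      have f1 : (m + 1 + 2).factorial = (m + 3) * (m + 2).factorial := rfl
      have f2 : (m + 2 + 2).factorial = (m + 4) * ((m + 3) * (m + 2).factorial) := rfl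
      have hf : m + 2 ≤ (m + 2).factorial := Nat.self_le_factorial _
      rw [f1] at h1
      rw [e, f2]
      generalize (m + 2).factorial = a at *
      generalize nodeTime (m + 1 + 2) = x at *
      generalize nodeTime (m + 2) = y at *
      -- The factor `m + 3` clears the denominator in the induction hypothesis for `m`.
      refine Nat.le_of_mul_le_mul_left (c := m + 3) ?_ (by omega)
      calc (m + 3) * ((m + 2 + 3) * ((m + 2 + 2) * (x + 2) + y + 3))
          = (m + 3) * (m + 5) * ((m + 1 + 3) * x) + (m + 5) * ((m + 3) * y) +
            (m + 3) * (m + 5) * (2 * m + 11) := by ring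
        _ ≤ (m + 3) * (m + 5) * (24 * ((m + 1 + 1) * ((m + 3) * a))) +
            (m + 5) * (24 * ((m + 1) * a)) + (m + 3) * (m + 5) * (2 * m + 11) := by gcongr
        _ ≤ (m + 3) * (m + 5) * (24 * ((m + 1 + 1) * ((m + 3) * a))) +
            (m + 5) * (24 * ((m + 1) * a)) + 24 * (((m + 3) ^ 2 + 4) * a) := by
          refine Nat.add_le_add_left ?_ _
          calc (m + 3) * (m + 5) * (2 * m + 11)
              ≤ 24 * (((m + 3) ^ 2 + 4) * (m + 2)) := by
                nlinarith [Nat.zero_le (m ^ 3), Nat.zero_le (m ^ 2)]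
            _ ≤ _ := by gcongr
        _ = (m + 3) * (24 * ((m + 2 + 1) * ((m + 4) * ((m + 3) * a)))) := by ring

theorem nodeTime_le (m : ℕ) : nodeTime m ≤ 24 * m.factorial := by
  match m with
  | 0 => decide
  | 1 => decide
  | m + 2 =>
    have := nodeTime_bound m
    refine Nat.le_of_mul_le_mul_left (c := m + 3) (this.trans ?_) (by omega)
    calc 24 * ((m + 1) * (m + 2).factorial) ≤ 24 * ((m + 3) * (m + 2).factorial) := by
          gcongr; omega
      _ = _ := by ring

/-- One turn of the loop in mode `0`. Testing the guard costs 2 and each test of the mode costs 4,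
hence `6` here and `10` in the other two modes. -/
theorem runs_mainLoop_start {T₁ T₂ T : ℕ} {R : State → Prop} (hs : L.At s p (d + 1) 0)
    (h : Runs L.S (startProg ev) s T₁ fun s' => Runs L.S (mainLoop ev) s' T₂ R)
    (hT : T₁ + T₂ + 6 ≤ T) : Runs L.S (mainLoop ev) s T R := by
  refine Runs.loop (by simp [Exp.Ok]) (by simp [Exp.val, hs.depth])
    (Runs.ite (by simp [Exp.Ok]) (fun _ => h) (fun h => ?_) le_rfl)
    (by simp [Exp.cost]; omega)
  simp [Exp.val, hs.mode] at h

theorem runs_mainLoop_try {T₁ T₂ T : ℕ} {R : State → Prop} (hs : L.At s p (d + 1) 1)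
    (h : Runs L.S tryProg s T₁ fun s' => Runs L.S (mainLoop ev) s' T₂ R)
    (hT : T₁ + T₂ + 10 ≤ T) : Runs L.S (mainLoop ev) s T R := by
  refine Runs.loop (by simp [Exp.Ok]) (by simp [Exp.val, hs.depth])
    (Runs.ite (by simp [Exp.Ok]) (fun h => ?_)
      (fun _ => Runs.ite (by simp [Exp.Ok]) (fun _ => h) (fun h => ?_) le_rfl) le_rfl)
    (by simp [Exp.cost]; omega)
  · simp [Exp.val, hs.mode] at h
  · simp [Exp.val, hs.mode] at h

theorem runs_mainLoop_resume {T₁ T₂ T : ℕ} {R : State → Prop} (hs : L.At s p (d + 1) 2)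
    (h : Runs L.S resumeProg s T₁ fun s' => Runs L.S (mainLoop ev) s' T₂ R)
    (hT : T₁ + T₂ + 10 ≤ T) : Runs L.S (mainLoop ev) s T R := by
  refine Runs.loop (by simp [Exp.Ok]) (by simp [Exp.val, hs.depth])
    (Runs.ite (by simp [Exp.Ok]) (fun h => ?_)
      (fun _ => Runs.ite (by simp [Exp.Ok]) (fun h => ?_) (fun _ => h) le_rfl) le_rfl)
    (by simp [Exp.cost]; omega)
  · simp [Exp.val, hs.mode] at h
  · simp [Exp.val, hs.mode] at h

/-- The main loop returns from the frame `p` with a solution of the game on the sub-arena `X`, and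
continues as after any such return. -/
theorem runs_mainLoop {TE B : ℕ} (hev : Evaluates L cond ev TE)
    (hB : TE + L.attrTime + n * 100 + 100 ≤ B) (m : ℕ) :
    ∀ (X : Set (Fin n)) (s : State) (p d : ℕ), X.ncard ≤ m → L.A.IsSub X →
      L.At s p (d + 1) 0 → codeSet s n p = X → (∀ v : Fin n, s.mem (p + v) ≤ 3) →
      L.w.length + n ≤ p → p + (m + 1) * (n + 2) ≤ L.S → d + m ≤ n →
      ∀ (T : ℕ) (R : State → Prop),
        (∀ s' c, L.At s' (p - (n + 2)) d 2 →
          (∀ a < p, (a < L.w.length ∨ L.w.length + n ≤ a) → s'.mem a = s.mem a) →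
          (∀ v : Fin n, v ∉ X → s'.mem (p + v) = s.mem (p + v)) →
          L.A.Solved cond X c → (∀ v ∈ X, s'.mem (p + v) = c v) →
          Runs L.S (mainLoop ev) s' T R) →
        Runs L.S (mainLoop ev) s (T + nodeTime m * B) R := by
  classical
  have hnn : Nonempty (Fin n) := ⟨⟨0, L.pos⟩⟩
  have hS := L.le_S
  have how := L.ow_le
  -- The claim is in continuation style: the loop has no call and return of its own, so a solved
  -- frame is described by what the remaining run does from any state that such a return may
  -- produce.
  induction m using Nat.strong_induction_on with
  | _ m ih =>
  intro X s p d hXm hX hs hcode hle hp1 hp2 hd T R hcont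
  have hp3 : p + (n + 2) ≤ L.S := by nlinarith
  set σ := winner cond X with hσ
  -- the positions from `c` on are tried one after the other
  have key : ∀ j c s₁, c + j = n → L.At s₁ p (d + 1) 1 →
      (∀ a < p, (a < L.w.length ∨ L.w.length + n ≤ a) → s₁.mem a = s.mem a) →
      (∀ v : Fin n, s₁.mem (p + v) = s.mem (p + v)) →
      s₁.mem (p + n) = σ → s₁.mem (p + n + 1) = c →
      (∀ v ∈ X, (v : ℕ) < c →
        L.A.WinsOn cond (X \ L.A.attractor X σ {v}) σ (X \ L.A.attractor X σ {v})) →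
      Runs L.S (mainLoop ev) s₁ (T + ({v : Fin n | v ∈ X ∧ c ≤ v}.ncard *
        (nodeTime (m - 1) + 2) + restTime m + 1) * B + j * 60) R := by
    intro j
    induction j with
    | zero =>
      intro c s₁ hc h1 h2 h3 h4 h5 h6
      obtain rfl : c = n := by omega
      refine runs_mainLoop_try (T₂ := T) h1 ((runs_tryProg_of_eq h1 h4 h5 (by omega)
        (by omega)).mono le_rfl ?_) ?_
      · rintro s' ⟨a1, a2, a3⟩
        refine hcont s' (fun _ => σ) a1 (fun a ha ha' => by rw [a2 a (Or.inl ha), h2 a ha ha'])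
          (fun v hv => ?_) (Arena.solved_const hX (winner_spec cond X) fun v hv => h6 v hv v.2)
          (fun v hv => ?_)
        · have : s.mem (p + v) ≠ 2 := fun h => hv (hcode ▸ h)
          rw [a3, h3, if_neg this]
        · have : s.mem (p + v) = 2 := by rw [← hcode] at hv; exact hv
          rw [a3, h3, if_pos this]
      -- The summand `1` in the budget pays for this last step, in which the rest of the frame is
      -- assigned to `σ`.
      · have : B ≤ ({v : Fin c | v ∈ X ∧ c ≤ v}.ncard * (nodeTime (m - 1) + 2) +
          restTime m + 1) * B := Nat.le_mul_of_pos_left _ (by omega)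
        omega
    | succ j ihj =>
      intro c s₁ hc h1 h2 h3 h4 h5 h6
      obtain ⟨c, rfl⟩ : ∃ c' : Fin n, c = c' := ⟨⟨c, by omega⟩, rfl⟩
      have hcode₁ : codeSet s₁ n p = X := by
        rw [← hcode]
        ext v
        simp only [codeSet, h3]
      by_cases hcX : c ∈ X
      · obtain ⟨m, rfl⟩ : ∃ m', m = m' + 2 := by
          have := hX.two_le_ncard ⟨c, hcX⟩
          exact ⟨m - 2, by omega⟩
        have hp4 : p + (n + 2) + (m + 1 + 1) * (n + 2) ≤ L.S := by
          have : (m + 2 + 1) * (n + 2) = (n + 2) + (m + 1 + 1) * (n + 2) := by ring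
          omega
        have hp5 : p + 2 * (n + 2) ≤ L.S := by nlinarith
        set x := nodeTime (m + 1) with hx
        set y := nodeTime m with hy
        have hcard : {v : Fin n | v ∈ X ∧ (c : ℕ) ≤ v}.ncard =
            {v : Fin n | v ∈ X ∧ (c : ℕ) + 1 ≤ v}.ncard + 1 := by
          rw [← Set.ncard_insert_of_notMem (a := c) (by simp)]
          congr 1
          ext v
          simp only [Set.mem_insert_iff, Set.mem_ofPred_eq]
          constructor
          · rintro ⟨hv, hcv⟩
            by_cases hvc : v = c
            · exact Or.inl hvc
            · exact Or.inr ⟨hv, by have : (v : ℕ) ≠ c := fun h => hvc (Fin.ext h); omega⟩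
          · rintro (rfl | ⟨hv, hcv⟩)
            · exact ⟨hcX, le_rfl⟩
            · exact ⟨hv, by omega⟩
        set K := {v : Fin n | v ∈ X ∧ (c : ℕ) + 1 ≤ v}.ncard with hK
        -- For this candidate, `x * B` pays for the smaller game and two further units `B` for the
        -- steps that push and resume. The remaining `Z` contains the later candidates and the
        -- reserve `y` for a restart.
        have htime : ({v : Fin n | v ∈ X ∧ (c : ℕ) ≤ v}.ncard * (nodeTime (m + 2 - 1) + 2) +
            restTime (m + 2) + 1) * B =
            (K * (x + 2) + y + 1) * B + x * B + B + B := by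
          rw [hcard]
          simp only [show m + 2 - 1 = m + 1 by omega, restTime, ← hx, ← hy]
          ring
        have htime' : y * B ≤ (K * (x + 2) + y + 1) * B := Nat.mul_le_mul_right _ (by omega)
        rw [htime]
        set Z := (K * (x + 2) + y + 1) * B with hZ
        refine runs_mainLoop_try (T₁ := L.attrTime + n * 22 + 80)
          (T₂ := (T + Z + j * 60 + B) + x * B) h1
          ((runs_tryProg_of_mem h1 h5 (hcode₁ ▸ hcX) h4 hp1 hp5 (by omega)).mono le_rfl ?_)
          (by omega)
        rintro s₂ ⟨a1, a2, a3, a4, a5⟩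
        rw [hcode₁] at a5
        -- The continuation of this call is the whole rest of the work on `X`: resuming, then either
        -- the next candidate or the restart.
        refine ih (m + 1) (by omega) (X \ L.A.attractor X σ {c}) s₂ _ _ ?_ hX.diff_attractor a1 a5
          (fun v => by have := a4 v; omega) (by omega) hp4 (by omega) _ _ ?_
        · have : (X \ L.A.attractor X σ {c}).ncard < X.ncard :=
            Set.ncard_lt_ncard ⟨Set.sdiff_subset, fun h =>
              (h hcX).2 (Arena.subset_attractor (Set.mem_singleton _))⟩
          omega
        intro s₃ cY b1 b2 b3 b4 b5
        rw [Nat.add_sub_cancel] at b1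
        have hle₃ : ∀ v : Fin n, s₃.mem (p + v) = s.mem (p + v) := fun v => by
          rw [b2 _ (by omega) (Or.inr (by omega)), a2 _ (by omega) (Or.inr (by omega)), h3]
        have hcode₃ : codeSet s₃ n p = X := by
          rw [← hcode]
          ext v
          simp only [codeSet, hle₃]
        have hlow₃ : ∀ a < p, (a < L.w.length ∨ L.w.length + n ≤ a) → s₃.mem a = s.mem a :=
          fun a ha ha' => by rw [b2 a (by omega) ha', a2 a (by omega) ha', h2 a ha ha']
        have hσ₃ : s₃.mem (p + n) = σ := by
          rw [b2 _ (by omega) (Or.inr (by omega)), a2 _ (by omega) (Or.inr (by omega)), h4]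
        have hτσ : (1 - σ : Player) ≠ σ := by
          have : ∀ σ : Player, 1 - σ ≠ σ := by decide
          exact this σ
        have hpl : ∀ a b : Player, a ≠ 1 - b → a = b := by decide
        set τ : Player := 1 - σ with hτ
        set W : Set (Fin n) := {v | v ∈ X \ L.A.attractor X σ {c} ∧ cY v = τ} with hW
        have hWmem : ∀ v : Fin n, s₃.mem (p + (n + 2) + v) = τ ↔ v ∈ W := by
          intro v
          by_cases hv : v ∈ X \ L.A.attractor X σ {c}
          · rw [b5 v hv, hW]
            simp only [Set.mem_ofPred_eq, Fin.val_inj, hv, true_and]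
          · rw [b3 v hv]
            have h2 : v ∉ W := fun h => hv h.1
            simp only [h2, iff_false]
            have := a4 v
            omega
        have hWX : W ⊆ X := fun v hv => hv.1.1
        refine runs_mainLoop_resume (T₁ := L.attrTime + n * 25 + 50) (T₂ := T + Z + j * 60) b1
          ((runs_resumeProg b1 hσ₃ hτ hWmem 
            (fun v => by rw [hle₃]; exact hle v) hp1 hp5).mono le_rfl ?_) (by omega)
        rintro s₄ ⟨e1, e2⟩
        rcases W.eq_empty_or_nonempty with hemp | hne
        · obtain ⟨e1, e3⟩ := e1 hemp
          have := ihj (c + 1) s₄ (by omega) e1 (by rwa [e3]) (by rwa [e3]) (by rwa [e3])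
            (by rw [e3, b2 _ (by omega) (Or.inr (by omega)), a3]) ?_
          · simp only [show m + 2 - 1 = m + 1 by omega, show restTime (m + 2) = nodeTime m from rfl] at this
            exact this
          · intro v hv hvc
            by_cases hvc' : (v : ℕ) < c
            · exact h6 v hv hvc'
            · obtain rfl : v = c := Fin.ext (by omega)
              refine b4.winsOn_of_forall fun u hu => hpl _ _ fun h => ?_
              have : u ∈ W := ⟨hu, h⟩
              rw [hemp] at this
              exact this
        · obtain ⟨e1, e3, e4, e5⟩ := e2 hne
          rw [hcode₃] at e4 e5
          set D := L.A.attractor X τ W with hD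
          have hDX : D ⊆ X := Arena.attractor_subset hWX
          have hcode₄ : codeSet s₄ n p = X \ D := by
            ext v
            have h0 : v ∈ codeSet s₄ n p ↔ s₄.mem (p + v) = 2 := Iff.rfl
            have h1 : v ∈ codeSet s₃ n p ↔ s₃.mem (p + v) = 2 := Iff.rfl
            rw [h0, Set.mem_sdiff]
            by_cases hv : v ∈ D
            · rw [e4 v hv]
              simp only [hv, not_true_eq_false, and_false, iff_false]
              omega
            · rw [e5 v hv, ← h1, hcode₃]
              simp [hv]
          have hDc : 2 ≤ D.ncard := b4.two_le_ncard_attractor hW hne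
          -- The restart is a call on at most `m` of the `m + 2` positions, because `D` has at least
          -- two. It reuses the frame `p` and returns directly to the caller of `X`, so it may take
          -- over the continuation `T`, `R`.
          refine Runs.mono (ih m (by omega) (X \ D) s₄ p d ?_ hX.diff_attractor e1 hcode₄ ?_ hp1
            (by nlinarith) (by omega) T R ?_) (T₁ := T + y * B) (by omega) (fun _ h => h)
          · have := Set.ncard_sdiff_add_ncard_of_subset hDX
            omega
          · intro v
            by_cases hv : v ∈ D
            · rw [e4 v hv]; omega
            · rw [e5 v hv, hle₃]; exact hle v
          · intro s₅ c' f1 f2 f3 f4 f5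
            refine hcont s₅ _ f1 (fun a ha ha' => ?_) (fun v hv => ?_)
              (b4.step hX hτσ hW hne hD f4) (fun v hv => ?_)
            · rw [f2 a ha ha', e3 a ha' (Or.inl ha), hlow₃ a ha ha']
            · rw [f3 v (fun h => hv h.1), e5 v (fun h => hv (hDX h)), hle₃]
            · by_cases hvD : v ∈ D
              · rw [if_pos hvD, f3 v (fun h => h.2 hvD), e4 v hvD]
              · rw [if_neg hvD, f5 v ⟨hv, hvD⟩]
      · refine runs_mainLoop_try (T₁ := 40) h1 ((runs_tryProg_of_notMem h1 h5 (hcode₁ ▸ hcX) hp1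
          (by omega)).mono le_rfl ?_) (T₂ := T + ({v : Fin n | v ∈ X ∧ (c : ℕ) + 1 ≤ v}.ncard *
            (nodeTime (m - 1) + 2) + restTime m + 1) * B + j * 60) ?_
        · rintro s₂ ⟨a1, a2, a3⟩
          refine ihj (c + 1) s₂ (by omega) a1 (fun a ha ha' => ?_) (fun v => ?_) ?_ a3 ?_
          · rw [a2 a (by omega), h2 a ha ha']
          · rw [a2 _ (by omega), h3]
          · rw [a2 _ (by omega), h4]
          · intro v hv hvc
            refine h6 v hv ?_
            have : (v : ℕ) ≠ c := fun h => hcX (Fin.ext h ▸ hv)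
            omega
        · have : {v : Fin n | v ∈ X ∧ (c : ℕ) + 1 ≤ v}.ncard ≤
              {v : Fin n | v ∈ X ∧ (c : ℕ) ≤ v}.ncard :=
            Set.ncard_le_ncard fun v hv => ⟨hv.1, by have := hv.2; omega⟩
          have : ({v : Fin n | v ∈ X ∧ (c : ℕ) + 1 ≤ v}.ncard *
            (nodeTime (m - 1) + 2) + restTime m + 1) * B ≤
            ({v : Fin n | v ∈ X ∧ (c : ℕ) ≤ v}.ncard *
            (nodeTime (m - 1) + 2) + restTime m + 1) * B := by gcongr
          omega
  -- Two of the three constant units in `nodeTime` are used here: one `B` for the start step, one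
  -- for skipping up to `n` candidates at cost `60` each.
  have htotal : ({v : Fin n | v ∈ X ∧ 0 ≤ (v : ℕ)}.ncard * (nodeTime (m - 1) + 2) +
      restTime m + 1) * B + B + B ≤ nodeTime m * B := by
    have e : {v : Fin n | v ∈ X ∧ 0 ≤ (v : ℕ)} = X := by ext v; simp
    rw [e]
    have : X.ncard * (nodeTime (m - 1) + 2) + restTime m + 3 ≤ nodeTime m := by
      match m with
      | 0 | 1 =>
        -- A sub-arena with at most one position is empty, so no candidate is ever pushed.
        have : X.ncard = 0 := by
          by_contra hne
          have := hX.two_le_ncard (Set.nonempty_of_ncard_ne_zero hne)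
          omega
        rw [this]
        decide
      | m + 2 =>
        have : X.ncard * (nodeTime (m + 1) + 2) ≤ (m + 2) * (nodeTime (m + 1) + 2) := by gcongr
        exact Nat.add_le_add_right (Nat.add_le_add_right this _) _
    calc _ = (X.ncard * (nodeTime (m - 1) + 2) + restTime m + 3) * B := by ring
      _ ≤ _ := by gcongr
  refine runs_mainLoop_start (T₁ := TE + 20) hs ((runs_startProg hev hs (by omega)
    (by omega)).mono le_rfl ?_) (T₂ := T + ({v : Fin n | v ∈ X ∧ 0 ≤ (v : ℕ)}.ncard *
      (nodeTime (m - 1) + 2) + restTime m + 1) * B + n * 60) (by omega)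
  rintro s₁ ⟨a1, a2, a3, a4⟩
  refine key n 0 s₁ (by omega) a1 (fun a ha _ => a2 a (Or.inl (by omega)))
    (fun v => a2 _ (Or.inl (by omega))) (by rw [a3, hcode]) a4 (fun v _ h => by omega)

end Recursion

end RegularGames

namespace RegularGames

/-! ### Evaluation of the winning conditions -/

section Evaluation

open Prog Exp

/-- The list `l` stands in the memory from address `a` on. -/
def Reads (s : State) (a : ℕ) (l : List ℕ) : Prop :=
  ∀ j (h : j < l.length), s.mem (a + j) = l[j]

theorem reads_append {s : State} {a : ℕ} {l l' : List ℕ} :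
    Reads s a (l ++ l') ↔ Reads s a l ∧ Reads s (a + l.length) l' := by
  constructor
  · intro h
    refine ⟨fun j hj => ?_, fun j hj => ?_⟩
    · rw [h j (by rw [List.length_append]; omega), List.getElem_append_left]
    · rw [add_assoc, h (l.length + j) (by rw [List.length_append]; omega),
        List.getElem_append_right (by omega)]
      simp
  · rintro ⟨h, h'⟩ j hj
    rw [List.length_append] at hj
    by_cases hjl : j < l.length
    · rw [List.getElem_append_left hjl, h j hjl]
    · rw [List.getElem_append_right (by omega), ← h' (j - l.length) (by omega)]
      congr 1
      omega

theorem reads_cons {s : State} {a x : ℕ} {l : List ℕ} :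
    Reads s a (x :: l) ↔ s.mem a = x ∧ Reads s (a + 1) l := by
  have := reads_append (s := s) (a := a) (l := [x]) (l' := l)
  rw [List.singleton_append] at this
  rw [this]
  refine and_congr_left' ⟨fun h => h 0 (by simp), fun h j hj => ?_⟩
  have : j = 0 := by simpa using hj
  subst this
  simpa using h

theorem Reads.congr {s s' : State} {a : ℕ} {l : List ℕ} (h : Reads s a l) (hm : s'.mem = s.mem) :
    Reads s' a l := fun j hj => by rw [hm]; exact h j hj

theorem setCode_eq {n : ℕ} (l : List (Fin n)) : setCode l = l.length :: l.map Fin.val := by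
  induction l with
  | nil => rfl
  | cons v l ih =>
    simp only [setCode, List.cons.injEq, true_and] at ih ⊢
    simp_all

/-- Count in register `27` the members of the set listed at `reg 26` that have the code `2`. -/
def countProg : Prog :=
  .seq (.seq (.set 27 (.lit 0)) (.seq (.set 28 (.mem (.reg 26))) (inc 26)))
  (.forTo 29 28 (.seq
    (.set 27 (.add (.reg 27) (.eq (.mem (.add (.reg 5) (.mem (.reg 26)))) (.lit 2)))) (inc 26)))

variable {n S : ℕ}

open Classical in
theorem runs_countProg {s : State} {a p : ℕ} {l : List (Fin n)} (ha : s.reg 26 = a)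
    (hl : l.length ≤ n) (hr : Reads s a (setCode l)) (haS : a + (setCode l).length < S)
    (hp : s.reg 5 = p) (hpS : p + n ≤ S) :
    Runs S countProg s (n * 22 + 20) fun s' => (∀ i < 26, s'.reg i = s.reg i) ∧
      s'.mem = s.mem ∧ s'.reg 26 = a + (setCode l).length ∧
      s'.reg 27 = l.countP fun v => v ∈ codeSet s n p := by
  rw [setCode_eq, reads_cons] at hr
  have hlen : (setCode l).length = l.length + 1 := by simp [setCode_eq]
  rw [hlen] at haS ⊢
  refine Runs.seq (T₁ := 9) (T₂ := l.length * 22 + 6) (R := fun s' =>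
    (∀ i < 26, s'.reg i = s.reg i) ∧ s'.mem = s.mem ∧ s'.reg 26 = a + 1 ∧ s'.reg 27 = 0 ∧
    s'.reg 28 = l.length) (Runs.of_wp ?_ (by simp [Prog.time, Prog.inc, Exp.cost])) ?_ (by omega)
  · simp [Prog.wp, Prog.inc, Exp.Ok, Exp.val, ha, hr.1]
    refine ⟨by omega, fun i hi => ?_⟩
    rw [Function.update_of_ne (by omega), Function.update_of_ne (by omega),
      Function.update_of_ne (by omega)]
  rintro s₁ ⟨h1, h2, h3, h4, h5⟩
  refine Runs.forTo (N := l.length) (T := 18) (fun j s' => s'.reg 29 = j ∧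
    (∀ i < 26, s'.reg i = s.reg i) ∧ s'.mem = s.mem ∧ s'.reg 26 = a + 1 + j ∧
    s'.reg 28 = l.length ∧
    s'.reg 27 = (l.take j).countP fun v => v ∈ codeSet s n p) ?_ ?_ ?_ ?_ (by omega)
  · rintro j s' ⟨h1, -, -, -, h2, -⟩
    exact ⟨h1, h2⟩
  · refine ⟨by simp, fun i hi => ?_, h2, by simp [h3], by simp [h5], by simp [h4]⟩
    rw [← h1 i hi]
    exact Function.update_of_ne (by omega) _ _
  · rintro j hj s' ⟨g1, g2, g3, g4, g5, g6⟩
    have e5 : s'.reg 5 = p := by rw [g2 5 (by omega), hp]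
    have m1 : s.mem (a + 1 + j) = l[j] := by
      rw [hr.2 j (by simpa using hj)]
      simp
    have hlt := l[j].2
    have hc : (l.take j).countP (fun v => v ∈ codeSet s n p) ≤ j :=
      List.countP_le_length.trans (by simp)
    have hcount : (l.take (j + 1)).countP (fun v => v ∈ codeSet s n p) =
        (l.take j).countP (fun v => v ∈ codeSet s n p) +
          if s.mem (p + l[j]) = 2 then 1 else 0 := by
      have e : l[j] ∈ codeSet s n p ↔ s.mem (p + l[j]) = 2 := Iff.rfl
      rw [List.take_succ_eq_append_getElem hj, List.countP_append, List.countP_singleton]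
      simp only [e, decide_eq_true_eq]
    have hif : (if s.mem (p + l[j]) = 2 then 1 else 0) ≤ 1 := by split_ifs <;> omega
    refine Runs.of_wp ?_ (by simp [Prog.time, Prog.inc, Exp.cost])
    simp [Prog.wp, Prog.inc, Exp.Ok, Exp.val, g1, g3, g4, g5, e5, g6, m1,
      -Order.lt_add_one_iff]
    refine ⟨⟨by omega, by omega⟩, by omega, by omega, fun i hi => ?_, by omega, hcount.symm⟩
    rw [Function.update_of_ne (by omega), Function.update_of_ne (by omega),
      Function.update_of_ne (by omega), g2 i hi]
  · rintro s' ⟨-, g2, g3, g4, -, g6⟩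
    rw [List.take_length] at g6
    exact ⟨g2, g3, by omega, g6⟩

open Classical in
/-- A loop over all pairs that sets register `20` to `1` if the test is passed for some pair. -/
theorem runs_forTo_pairs {α : Type} {code : α → List ℕ} {test : α → Prop} {body : Prog} {T e : ℕ}
    {ps : List α} {s : State} {a : ℕ}
    (hbody : ∀ s', ∀ x ∈ ps, Agree s s' → s'.mem = s.mem → s'.reg 25 = s.reg 25 →
      Reads s' (s'.reg 26) (code x) → s'.reg 26 + (code x).length ≤ e →
      Runs S body s' T fun s'' => Agree s' s'' ∧ s''.mem = s'.mem ∧ s''.reg 25 = s'.reg 25 ∧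
        s''.reg 21 = s'.reg 21 ∧ s''.reg 26 = s'.reg 26 + (code x).length ∧
        s''.reg 20 = if test x then 1 else s'.reg 20)
    (hk : s.reg 8 = ps.length) (h0 : s.reg 20 = 0) (ha : s.reg 26 = a)
    (hr : Reads s a (ps.flatMap code)) (hlen : a + (ps.flatMap code).length = e)
    (hkS : ps.length < S) :
    Runs S (.forTo 21 8 body) s (ps.length * (T + 8) + 6) fun s' => Agree s s' ∧
      s'.mem = s.mem ∧ s'.reg 26 = e ∧ s'.reg 20 = if ∃ x ∈ ps, test x then 1 else 0 := by
  -- Invariant: register `26` points to the code of the pairs not yet read. Pairs have variable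
  -- length, so the pointer is moved by the body and not computed from `j`.
  refine Runs.forTo (N := ps.length) (T := T + 4) (fun j s' => s'.reg 21 = j ∧ Agree s s' ∧
    s'.mem = s.mem ∧ s'.reg 25 = s.reg 25 ∧ Reads s (s'.reg 26) ((ps.drop j).flatMap code) ∧
    s'.reg 26 + ((ps.drop j).flatMap code).length = e ∧
    s'.reg 20 = if ∃ x ∈ ps.take j, test x then 1 else 0) ?_ ?_ ?_ ?_ le_rfl
  · rintro j s' ⟨h1, h2, -⟩
    exact ⟨h1, by rw [h2 8 (by omega), hk]⟩
  · exact ⟨by simp, (Agree.refl s).set (by omega) _ _, rfl, by simp, by simpa [ha] using hr,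
      by simpa [ha] using hlen, by simp [h0]⟩
  · rintro j hj s' ⟨h1, h2, h3, h4, h5, h6, h7⟩
    rw [List.drop_eq_getElem_cons hj, List.flatMap_cons] at h5 h6
    rw [reads_append] at h5
    rw [List.length_append] at h6
    refine Runs.seq (hbody s' ps[j] (List.getElem_mem hj) h2 h3 h4 (h5.1.congr h3) (by omega))
      (T₂ := 4) ?_ le_rfl
    rintro s'' ⟨g1, g2, g3, g4, g5, g6⟩
    refine Runs.of_wp ?_ (by simp [Prog.time, Prog.inc, Exp.cost])
    simp [Prog.wp, Prog.inc, Exp.Ok, Exp.val, g4, h1]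
    refine ⟨by omega, (h2.trans g1).set (by omega) _ _, by rw [g2, h3], by rw [g3, h4],
      by rw [g5]; exact h5.2, ?_, ?_⟩
    · have h8 : s''.reg 26 + ((ps.drop (j + 1)).flatMap code).length = e := by omega
      simpa using h8
    · have hmem : ∀ x, x ∈ ps.take (j + 1) ↔ x ∈ ps.take j ∨ x = ps[j] := fun x => by
        rw [List.take_succ_eq_append_getElem hj, List.mem_append, List.mem_singleton]
      rw [g6, h7]
      by_cases ht : test ps[j]
      · rw [if_pos ht, if_pos ⟨ps[j], (hmem _).2 (Or.inr rfl), ht⟩]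
      · rw [if_neg ht]
        congr 1
        refine propext ⟨fun ⟨x, hx, hxt⟩ => ⟨x, (hmem x).2 (Or.inl hx), hxt⟩,
          fun ⟨x, hx, hxt⟩ => ?_⟩
        rcases (hmem x).1 hx with hx | rfl
        exacts [⟨x, hx, hxt⟩, absurd hxt ht]
  · rintro s' ⟨-, h2, h3, -, -, h6, h7⟩
    rw [List.take_length] at h7
    exact ⟨h2, h3, by simpa using h6, h7⟩

/-- The set `X` meets the first and not the second of two listed sets. -/
def PairTest (X : Set (Fin n)) (x : List (Fin n) × List (Fin n)) : Prop :=
  (∃ v ∈ x.1, v ∈ X) ∧ ¬ ∃ v ∈ x.2, v ∈ X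

/-- The set `X` contains the position and is contained in the listed set. -/
def KLTest (X : Set (Fin n)) (x : Fin n × List (Fin n)) : Prop :=
  x.1 ∈ X ∧ ∀ v ∈ X, v ∈ x.2

/-- Test whether the pair `(U, W)` at `reg 26` is such that `U` is hit and `W` is not. -/
def pairProg : Prog :=
  .seq countProg (.seq (.set 22 (.reg 27)) (.seq countProg
    (.ite (.reg 22) (.ite (.reg 27) .skip (.set 20 (.lit 1))) .skip)))

open Classical in
theorem runs_pairProg {s : State} {p : ℕ} {x : List (Fin n) × List (Fin n)}
    (h1 : x.1.length ≤ n) (h2 : x.2.length ≤ n)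
    (hr : Reads s (s.reg 26) (setCode x.1 ++ setCode x.2))
    (haS : s.reg 26 + (setCode x.1 ++ setCode x.2).length < S)
    (hp : s.reg 5 = p) (hpS : p + n ≤ S) :
    Runs S pairProg s (n * 44 + 60) fun s' => Agree s s' ∧ s'.mem = s.mem ∧
      s'.reg 25 = s.reg 25 ∧ s'.reg 21 = s.reg 21 ∧
      s'.reg 26 = s.reg 26 + (setCode x.1 ++ setCode x.2).length ∧
      s'.reg 20 = if PairTest (codeSet s n p) x then 1
        else s.reg 20 := by
  rw [reads_append] at hr
  rw [List.length_append] at haS ⊢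
  refine Runs.seq (T₂ := n * 22 + 40) (runs_countProg rfl h1 hr.1 (by omega) hp hpS) ?_ (by omega)
  rintro s₁ ⟨a1, a2, a3, a4⟩
  refine Runs.seq (T₁ := 2) (T₂ := n * 22 + 30) (R := fun s' =>
    (∀ i < 26, i ≠ 22 → s'.reg i = s.reg i) ∧ s'.mem = s.mem ∧
    s'.reg 26 = s.reg 26 + (setCode x.1).length ∧
    s'.reg 22 = x.1.countP fun v => v ∈ codeSet s n p)
    (Runs.of_wp ?_ (by simp [Prog.time, Exp.cost])) ?_ (by omega)
  · simp [Prog.wp, Exp.Ok, Exp.val, a2, a3, a4]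
    intro i hi hi'
    rw [Function.update_of_ne hi', a1 i hi]
  rintro s₂ ⟨b1, b2, b3, b4⟩
  have hcode : codeSet s₂ n p = codeSet s n p := by simp only [codeSet, b2]
  refine Runs.seq (T₂ := 8) (runs_countProg b3 h2 (hr.2.congr b2) (by omega)
    (by rw [b1 5 (by omega) (by omega), hp]) hpS) ?_ (by omega)
  rintro s₃ ⟨c1, c2, c3, c4⟩
  rw [hcode] at c4
  have c22 : s₃.reg 22 = x.1.countP fun v => v ∈ codeSet s n p := by rw [c1 22 (by omega), b4]
  have c' : ∀ i < 26, i ≠ 22 → s₃.reg i = s.reg i := fun i hi hi' => by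
    rw [c1 i hi, b1 i hi hi']
  have pos : ∀ l : List (Fin n), l.countP (fun v => v ∈ codeSet s n p) = 0 ↔
      ¬ ∃ v ∈ l, v ∈ codeSet s n p := by
    intro l
    simp
  refine Runs.of_wp ?_ (by simp [Prog.time, Exp.cost])
  simp only [Prog.wp, Exp.Ok, Exp.val, c22, c4, ne_eq, pos, not_not, true_and]
  have hag : Agree s s₃ := fun i hi => c' i (by omega) (by omega)
  refine ⟨fun hU => ⟨fun hW => ⟨hag, by rw [c2, b2], c' 25 (by omega) (by omega),
    c' 21 (by omega) (by omega), by omega, ?_⟩, fun hW => ⟨by omega, hag.set (by omega) _ _,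
    by rw [c2, b2], by simp [c' 25], by simp [c' 21], by simp; omega, ?_⟩⟩,
    fun hU => ⟨hag, by rw [c2, b2], c' 25 (by omega) (by omega),
    c' 21 (by omega) (by omega), by omega, ?_⟩⟩
  · rw [if_neg fun h => h.2 hW, c' 20 (by omega) (by omega)]
  · rw [if_pos ⟨hU, hW⟩]; simp
  · rw [if_neg fun h => hU h.1, c' 20 (by omega) (by omega)]

/-- Compute the winner in a Rabin game (`reg 10 = 0`) or Streett game (`reg 10 = 1`). -/
def evalPairsProg : Prog :=
  .seq (.seq (.set 20 (.lit 0)) (.set 26 (.reg 9)))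
    (.seq (.forTo 21 8 pairProg) (.set 20 (.eq (.reg 20) (.reg 10))))

/-- Test whether the pair `(u, S)` at `reg 26` is such that `u` is hit and no position outside `S`
is hit; register `25` holds the number of all positions that are hit. -/
def klPairProg : Prog :=
  .seq (.seq (.set 22 (.eq (.mem (.add (.reg 5) (.mem (.reg 26)))) (.lit 2))) (inc 26))
    (.seq countProg (.ite (.reg 22) (.ite (.eq (.reg 27) (.reg 25)) (.set 20 (.lit 1)) .skip) .skip))

/-- Lets inclusion of `X` in a listed set be tested by counting, in time linear in the list and
without random access to its members; absence of repetitions is essential. -/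
theorem countP_eq_ncard_iff {l : List (Fin n)} (hl : l.Nodup) (X : Set (Fin n))
    [DecidablePred (· ∈ X)] : l.countP (fun v => v ∈ X) = X.ncard ↔ ∀ v ∈ X, v ∈ l := by
  classical
  have h : l.countP (fun v => v ∈ X) = {v | v ∈ X ∧ v ∈ l}.ncard := by
    rw [List.countP_eq_length_filter, ← List.toFinset_card_of_nodup (hl.filter _),
      ← Set.ncard_coe_finset]
    congr 1
    ext v
    simp [and_comm]
  rw [h]
  constructor
  · intro he v hv
    have := Set.eq_of_subset_of_ncard_le (fun v hv => hv.1 : {v | v ∈ X ∧ v ∈ l} ⊆ X) he.ge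
    rw [← this] at hv
    exact hv.2
  · intro h
    congr 1
    ext v
    exact ⟨fun hv => hv.1, fun hv => ⟨hv, h v hv⟩⟩

open Classical in
theorem runs_klPairProg {s : State} {p : ℕ} {x : Fin n × List (Fin n)} (h2 : x.2.Nodup)
    (hr : Reads s (s.reg 26) ((x.1 : ℕ) :: setCode x.2))
    (haS : s.reg 26 + ((x.1 : ℕ) :: setCode x.2).length < S)
    (h25 : s.reg 25 = (codeSet s n p).ncard) (hp : s.reg 5 = p) (hpS : p + n ≤ S) :
    Runs S klPairProg s (n * 22 + 50) fun s' => Agree s s' ∧ s'.mem = s.mem ∧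
      s'.reg 25 = s.reg 25 ∧ s'.reg 21 = s.reg 21 ∧
      s'.reg 26 = s.reg 26 + ((x.1 : ℕ) :: setCode x.2).length ∧
      s'.reg 20 = if KLTest (codeSet s n p) x then 1
        else s.reg 20 := by
  rw [reads_cons] at hr
  rw [List.length_cons] at haS ⊢
  have hlen : x.2.length ≤ n := by simpa using h2.length_le_card
  have hx := x.1.2
  refine Runs.seq (T₁ := 12) (T₂ := n * 22 + 34) (R := fun s' =>
    (∀ i < 26, i ≠ 22 → s'.reg i = s.reg i) ∧ s'.mem = s.mem ∧
    s'.reg 26 = s.reg 26 + 1 ∧ s'.reg 22 = if x.1 ∈ codeSet s n p then 1 else 0)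
    (Runs.of_wp ?_ (by simp [Prog.time, Prog.inc, Exp.cost])) ?_ (by omega)
  · simp [Prog.wp, Prog.inc, Exp.Ok, Exp.val, hp, hr.1, codeSet]
    refine ⟨by omega, by omega, fun i hi hi' => ?_, by congr⟩
    rw [Function.update_of_ne (by omega), Function.update_of_ne hi']
  rintro s₂ ⟨b1, b2, b3, b4⟩
  have hcode : codeSet s₂ n p = codeSet s n p := by simp only [codeSet, b2]
  refine Runs.seq (T₂ := 14) (runs_countProg b3 hlen (hr.2.congr b2) (by omega)
    (by rw [b1 5 (by omega) (by omega), hp]) hpS) ?_ (by omega)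
  rintro s₃ ⟨c1, c2, c3, c4⟩
  rw [hcode] at c4
  have c22 : s₃.reg 22 = if x.1 ∈ codeSet s n p then 1 else 0 := by rw [c1 22 (by omega), b4]
  have c' : ∀ i < 26, i ≠ 22 → s₃.reg i = s.reg i := fun i hi hi' => by
    rw [c1 i hi, b1 i hi hi']
  have c25 : s₃.reg 25 = (codeSet s n p).ncard := by rw [c' 25 (by omega) (by omega), h25]
  refine Runs.of_wp ?_ (by simp [Prog.time, Exp.cost])
  have e1 : ((if x.1 ∈ codeSet s n p then 1 else 0 : ℕ) = 0) ↔ x.1 ∉ codeSet s n p := by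
    split_ifs <;> simp_all
  have e2 : ((if x.2.countP (fun v => v ∈ codeSet s n p) = (codeSet s n p).ncard
      then 1 else 0 : ℕ) = 0) ↔ ¬ ∀ v ∈ codeSet s n p, v ∈ x.2 := by
    rw [← countP_eq_ncard_iff h2]
    split_ifs <;> simp_all
  simp only [Prog.wp, Exp.Ok, Exp.val, c22, c4, c25, ne_eq, e1, e2, not_not, true_and]
  have hag : Agree s s₃ := fun i hi => c' i (by omega) (by omega)
  refine ⟨fun hU => ⟨fun hW => ⟨by omega, hag.set (by omega) _ _,
    by rw [c2, b2], by simp [h25, c25], by simp [c' 21], by simp; omega, ?_⟩, fun hW => ⟨hag,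
    by rw [c2, b2], h25.symm, c' 21 (by omega) (by omega), by omega, ?_⟩⟩,
    fun hU => ⟨hag, by rw [c2, b2], h25.symm,
    c' 21 (by omega) (by omega), by omega, ?_⟩⟩
  · rw [if_pos ⟨hU, hW⟩]; simp
  · rw [if_neg fun h => hW h.2, c' 20 (by omega) (by omega)]
  · rw [if_neg fun h => hU h.1, c' 20 (by omega) (by omega)]

/-- Count in register `25` the positions that have the code `2`. -/
def cardProg : Prog := .seq (.set 25 (.lit 0)) (.forTo 21 0
  (.set 25 (.add (.reg 25) (.eq (.mem (.add (.reg 5) (.reg 21))) (.lit 2)))))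

theorem runs_cardProg {s : State} {p : ℕ} (h0 : s.reg 0 = n) (hp : s.reg 5 = p)
    (hpS : p + n ≤ S) (hnS : n < S) :
    Runs S cardProg s (n * 17 + 8) fun s' => Agree s s' ∧ s'.mem = s.mem ∧
      s'.reg 20 = s.reg 20 ∧ s'.reg 26 = s.reg 26 ∧ s'.reg 25 = (codeSet s n p).ncard := by
  refine Runs.seq (T₁ := 2) (T₂ := n * 17 + 6) (R := fun s' => Agree s s' ∧ s'.mem = s.mem ∧
    s'.reg 20 = s.reg 20 ∧ s'.reg 26 = s.reg 26 ∧ s'.reg 25 = 0)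
    (Runs.of_wp ?_ (by simp [Prog.time, Exp.cost])) ?_ (by omega)
  · simp [Prog.wp, Exp.Ok, Exp.val]
    exact (Agree.refl s).set (by omega) _ _
  rintro s₁ ⟨h1, h2, h3, h4, h5⟩
  refine Runs.forTo (N := n) (T := 13) (fun j s' => s'.reg 21 = j ∧ Agree s s' ∧
    s'.mem = s.mem ∧ s'.reg 20 = s.reg 20 ∧ s'.reg 26 = s.reg 26 ∧
    s'.reg 25 = {v : Fin n | v < j ∧ v ∈ codeSet s n p}.ncard) ?_ ?_ ?_ ?_ (by omega)
  · rintro j s' ⟨h1, h2, -⟩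
    exact ⟨h1, by rw [h2 0 (by omega), h0]⟩
  · exact ⟨by simp, h1.set (by omega) _ _, h2, by simp [h3], by simp [h4], by simp [h5]⟩
  · rintro j hj s' ⟨g1, g2, g3, g4, g5, g6⟩
    have e5 : s'.reg 5 = p := by rw [g2 5 (by omega), hp]
    have hcard : {v : Fin n | v < j + 1 ∧ v ∈ codeSet s n p}.ncard =
        {v : Fin n | v < j ∧ v ∈ codeSet s n p}.ncard +
          if s.mem (p + j) = 2 then 1 else 0 := by
      split_ifs with h
      · rw [← Set.ncard_insert_of_notMem (a := (⟨j, hj⟩ : Fin n)) (by simp)]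
        congr 1
        ext v
        simp only [Set.mem_insert_iff, Set.mem_ofPred_eq]
        constructor
        · rintro ⟨hv, hvX⟩
          by_cases hvj : (v : ℕ) = j
          · exact Or.inl (Fin.ext hvj)
          · exact Or.inr ⟨by omega, hvX⟩
        · rintro (rfl | ⟨hv, hvX⟩)
          · exact ⟨by simp, h⟩
          · exact ⟨by omega, hvX⟩
      · rw [Nat.add_zero]
        congr 1
        ext v
        simp only [Set.mem_ofPred_eq]
        refine ⟨fun ⟨hv, hvX⟩ => ⟨?_, hvX⟩, fun ⟨hv, hvX⟩ => ⟨by omega, hvX⟩⟩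
        have : (v : ℕ) ≠ j := by rintro rfl; exact h hvX
        omega
    have hle : {v : Fin n | v < j + 1 ∧ v ∈ codeSet s n p}.ncard ≤ n := by
      refine (Set.ncard_le_ncard (Set.subset_univ _)).trans ?_
      rw [Set.ncard_univ, Nat.card_eq_fintype_card, Fintype.card_fin]
    refine Runs.of_wp ?_ (by simp [Prog.time, Prog.inc, Exp.cost])
    simp only [Prog.wp, Prog.inc, Exp.Ok, Exp.val, g1, g3, g6, e5]
    simp [g1, -Order.lt_add_one_iff]
    refine ⟨⟨by omega, by rw [← hcard]; omega⟩, by omega,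
      (g2.set (by omega) _ s'.mem).set (by omega) _ _, g4, g5, hcard.symm⟩
  · rintro s' ⟨-, g2, g3, g4, g5, g6⟩
    refine ⟨g2, g3, g4, g5, ?_⟩
    rw [g6]
    congr 1
    ext v
    simp

/-- Compute the winner in a KL game. -/
def evalKLProg : Prog :=
  .seq (.seq (.set 20 (.lit 0)) (.set 26 (.reg 9)))
    (.seq cardProg (.seq (.forTo 21 8 klPairProg) (.set 20 (.sub (.lit 1) (.reg 20)))))

open Classical in
-- Some pair passes the test iff Player 0 wins the Rabin game, and iff Player 1 wins the Streett
-- game. Comparing the outcome with the tag `0` or `1` therefore yields the number of the winner in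
-- both cases. Register `26` ends up behind the input, which is how the length of the input becomes
-- known.
theorem runs_evalPairsProg {s : State} {p e kind : ℕ} {ps : List (List (Fin n) × List (Fin n))}
    (hps : ∀ x ∈ ps, x.1.Nodup ∧ x.2.Nodup) (h8 : s.reg 8 = ps.length)
    (h10 : s.reg 10 = kind) (hr : Reads s (s.reg 9) (ps.flatMap fun l => setCode l.1 ++ setCode l.2))
    (he : s.reg 9 + (ps.flatMap fun l => setCode l.1 ++ setCode l.2).length = e) (heS : e < S)
    (hp : s.reg 5 = p) (hpS : p + n ≤ S) (hkS : ps.length < S) :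
    Runs S evalPairsProg s (ps.length * (n * 44 + 68) + 14) fun s' => Agree s s' ∧
      s'.mem = s.mem ∧ s'.reg 26 = e ∧ s'.reg 20 = if ((if ∃ x ∈ ps,
        PairTest (codeSet s n p) x then 1 else 0) = kind)
        then 1 else 0 := by
  refine Runs.seq (T₁ := 4) (T₂ := ps.length * (n * 44 + 68) + 10) (R := fun s' => Agree s s' ∧
    s'.mem = s.mem ∧ s'.reg 20 = 0 ∧ s'.reg 26 = s.reg 9)
    (Runs.of_wp ?_ (by simp [Prog.time, Exp.cost])) ?_ (by omega)
  · simp [Prog.wp, Exp.Ok, Exp.val]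
    exact ((Agree.refl s).set (by omega) _ s.mem).set (by omega) _ _
  rintro s₁ ⟨a1, a2, a3, a4⟩
  have hcode : ∀ s', s'.mem = s₁.mem → codeSet s' n p = codeSet s n p := fun s' h => by
    simp only [codeSet, h, a2]
  refine Runs.seq (T₂ := 4) (runs_forTo_pairs (e := e) (T := n * 44 + 60)
    (test := fun x => PairTest (codeSet s n p) x)
    (fun s' x hx h1 h2 _ h4 h5 => ?_) (by rw [a1 8 (by omega), h8]) a3 a4 (hr.congr a2) he hkS)
    ?_ (le_of_eq (by ring))
  · have := runs_pairProg (S := S) (s := s') (p := p) (x := x)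
      (by simpa using (hps x hx).1.length_le_card)
      (by simpa using (hps x hx).2.length_le_card) h4 (by omega)
      (by rw [h1 5 (by omega), a1 5 (by omega), hp]) hpS
    rw [hcode s' h2] at this
    exact this
  rintro s₂ ⟨b1, b2, b3, b4⟩
  refine Runs.of_wp ?_ (by simp [Prog.time, Exp.cost])
  simp only [Prog.wp, Exp.Ok, Exp.val, b4, b1 10 (by omega), a1 10 (by omega), h10, true_and]
  refine ⟨(a1.trans b1).set (by omega) _ _, by rw [b2, a2], by simp [b3], by simp⟩

open Classical in
theorem runs_evalKLProg {s : State} {p e : ℕ} {ps : List (Fin n × List (Fin n))}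
    (hps : ∀ x ∈ ps, x.2.Nodup) (h0 : s.reg 0 = n) (h8 : s.reg 8 = ps.length)
    (hr : Reads s (s.reg 9) (ps.flatMap fun l => (l.1 : ℕ) :: setCode l.2))
    (he : s.reg 9 + (ps.flatMap fun l => (l.1 : ℕ) :: setCode l.2).length = e) (heS : e < S)
    (hp : s.reg 5 = p) (hpS : p + n ≤ S) (hkS : ps.length < S) (hnS : n < S) :
    Runs S evalKLProg s (ps.length * (n * 44 + 68) + n * 17 + 26) fun s' => Agree s s' ∧
      s'.mem = s.mem ∧ s'.reg 26 = e ∧ s'.reg 20 = if ∃ x ∈ ps,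
        KLTest (codeSet s n p) x then 0 else 1 := by
  refine Runs.seq (T₁ := 4) (T₂ := ps.length * (n * 44 + 68) + n * 17 + 22)
    (R := fun s' => Agree s s' ∧ s'.mem = s.mem ∧ s'.reg 20 = 0 ∧ s'.reg 26 = s.reg 9)
    (Runs.of_wp ?_ (by simp [Prog.time, Exp.cost])) ?_ (by omega)
  · simp [Prog.wp, Exp.Ok, Exp.val]
    exact ((Agree.refl s).set (by omega) _ s.mem).set (by omega) _ _
  rintro s₁ ⟨a1, a2, a3, a4⟩
  refine Runs.seq (T₂ := ps.length * (n * 44 + 68) + 12) (runs_cardProg (n := n) (p := p)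
    (by rw [a1 0 (by omega), h0]) (by rw [a1 5 (by omega), hp]) hpS hnS) ?_ (by omega)
  rintro s₂ ⟨b1, b2, b3, b4, b5⟩
  have hcode : ∀ s', s'.mem = s₂.mem → codeSet s' n p = codeSet s n p := fun s' h => by
    simp only [codeSet, h, b2, a2]
  have hcode₁ : codeSet s₁ n p = codeSet s n p := by simp only [codeSet, a2]
  -- A listed pair of a KL game needs only one count; the larger bound of the other games is used so
  -- that one estimate of the total time serves both theorems.
  refine Runs.seq (T₂ := 6) (runs_forTo_pairs (e := e) (T := n * 44 + 60)
    (test := fun x => KLTest (codeSet s n p) x)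
    (fun s' x hx h1 h2 h3 h4 h5 => ?_) (by rw [b1 8 (by omega), a1 8 (by omega), h8])
    (by rw [b3, a3]) (by rw [b4, a4]) (hr.congr (by rw [b2, a2])) he hkS) ?_ (le_of_eq (by ring))
  · have := runs_klPairProg (S := S) (s := s') (p := p) (x := x) (hps x hx) h4 (by omega)
      (by rw [h3, b5, hcode s' h2, hcode₁])
      (by rw [h1 5 (by omega), b1 5 (by omega), a1 5 (by omega), hp]) hpS
    rw [hcode s' h2] at this
    exact this.mono (by omega) fun _ h => h
  rintro s₃ ⟨c1, c2, c3, c4⟩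
  refine Runs.of_wp ?_ (by simp [Prog.time, Exp.cost])
  simp only [Prog.wp, Exp.Ok, Exp.val, c4]
  refine ⟨⟨by omega, trivial⟩, ((a1.trans b1).trans c1).set (by omega) _ _, by rw [c2, b2, a2],
    by simp [c3], ?_⟩
  rw [Function.update_self]
  split_ifs <;> rfl

end Evaluation

end RegularGames

namespace RegularGames

/-! ### The complete programs -/

section Solve

open Prog Exp

/-- Set up the registers for the main loop after `reg 26` was set to the end of the input. -/
def setupProg : Prog :=
  .seq (.set 4 (.reg 26)) (.seq (.set 5 (.add (.reg 26) (.reg 0)))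
    (.seq (.set 6 (.lit 1)) (.set 7 (.lit 0))))

/-- Put all positions into the first frame. -/
def fillProg : Prog := .forTo 21 0 (.store (.add (.reg 5) (.reg 21)) (.lit 2))

/-- Copy the result to the first cells of the memory. -/
def outputProg : Prog :=
  .seq (.set 12 (.add (.reg 5) (.reg 11)))
    (.forTo 21 0 (.store (.reg 21) (.mem (.add (.reg 12) (.reg 21)))))

/-- Solve a game, where `hdr` reads the header of the input and `ev` evaluates the winning
condition. The first run of `ev` serves to find the end of the input. -/
def solveProg (hdr ev : Prog) : Prog :=
  .seq hdr (.seq ev (.seq setupProg (.seq fillProg (.seq (mainLoop ev) outputProg))))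

variable {n : ℕ} {L : Layout n} {s : State} {p : ℕ} {cond : Set (Fin n) → Prop}

/-- The contents of the registers and cells after the header has been read. -/
structure Layout.Init {n : ℕ} (L : Layout n) (s : State) : Prop where
  r0 : s.reg 0 = n
  r1 : s.reg 1 = L.es.length
  r2 : s.reg 2 = L.ow
  r3 : s.reg 3 = L.ed
  r8 : s.reg 8 = L.k
  r9 : s.reg 9 = L.ps
  r10 : s.reg 10 = L.kind
  r11 : s.reg 11 = n + 2
  input : ∀ a < L.w.length, s.mem a = L.w.getD a 0

theorem Layout.Holds.init (h : L.Holds s) : L.Init s :=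
  ⟨h.r0, h.r1, h.r2, h.r3, h.r8, h.r9, h.r10, h.r11, h.input⟩

theorem runs_fillProg (h0 : s.reg 0 = n) (hp : s.reg 5 = p) {S : ℕ} (hpS : p + n ≤ S)
    (hnS : n < S) :
    Runs S fillProg s (n * 13 + 6) fun s' => Agree s s' ∧
      (∀ a, a < p ∨ p + n ≤ a → s'.mem a = s.mem a) ∧ ∀ v : Fin n, s'.mem (p + v) = 2 := by
  refine Runs.forTo (N := n) (T := 9) (fun j s' => s'.reg 21 = j ∧ Agree s s' ∧
    (∀ a, a < p ∨ p + n ≤ a → s'.mem a = s.mem a) ∧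
    ∀ v : Fin n, v < j → s'.mem (p + v) = 2) ?_ ?_ ?_ ?_ (by omega)
  · rintro j s' ⟨h1, h2, -⟩
    exact ⟨h1, by rw [h2 0 (by omega), h0]⟩
  · exact ⟨by simp, (Agree.refl s).set (by omega) _ _, fun _ _ => rfl, by simp⟩
  · rintro j hj s' ⟨h1, h2, h4, h5⟩
    have e5 : s'.reg 5 = p := by rw [h2 5 (by omega), hp]
    refine Runs.of_wp ?_ (by simp [Prog.time, Prog.inc, Exp.cost])
    simp [Prog.wp, Prog.inc, Exp.Ok, Exp.val, h1, e5, -Order.lt_add_one_iff]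
    refine ⟨by omega, by omega, h2.set (by omega) _ _, fun a ha => ?_, fun v hv => ?_⟩
    · rw [Function.update_of_ne (by omega), h4 a ha]
    · rw [Function.update_apply]
      split_ifs with h
      · rfl
      · exact h5 v (by omega)
  · rintro s' ⟨-, h2, h4, h5⟩
    exact ⟨h2, h4, fun v => h5 v v.2⟩

theorem runs_outputProg (h0 : s.reg 0 = n) (h11 : s.reg 11 = n + 2)
    (hn : 0 < n) (hp : s.reg 5 + (n + 2) = p) {S : ℕ} (hpS : p + n ≤ S) (hnS : n < S) :
    Runs S outputProg s (n * 14 + 10) fun s' => ∀ v : Fin n, s'.mem v = s.mem (p + v) := by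
  refine Runs.seq (T₁ := 4) (T₂ := n * 14 + 6) (R := fun s' => s'.reg 0 = n ∧ s'.reg 12 = p ∧
    s'.mem = s.mem) (Runs.of_wp ?_ (by simp [Prog.time, Exp.cost])) ?_ (by omega)
  · simp [Prog.wp, Exp.Ok, Exp.val, h0, h11, hp]
    omega
  rintro s₁ ⟨h1, h2, h3⟩
  refine Runs.forTo (N := n) (T := 10) (fun j s' => s'.reg 21 = j ∧ s'.reg 0 = n ∧
    s'.reg 12 = p ∧ (∀ a, n ≤ a → s'.mem a = s.mem a) ∧
    ∀ v : Fin n, v < j → s'.mem v = s.mem (p + v)) ?_ ?_ ?_ ?_ (by omega)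
  · rintro j s' ⟨h1, h2, -⟩
    exact ⟨h1, h2⟩
  · exact ⟨by simp, by simp [h1], by simp [h2], fun _ _ => by simp only [h3], by simp⟩
  · rintro j hj s' ⟨g1, g2, g3, g4, g5⟩
    have m := g4 (p + j) (by omega)
    refine Runs.of_wp ?_ (by simp [Prog.time, Prog.inc, Exp.cost])
    simp [Prog.wp, Prog.inc, Exp.Ok, Exp.val, g1, g2, g3, m, -Order.lt_add_one_iff]
    refine ⟨by omega, by omega, fun a ha => ?_, fun v hv => ?_⟩
    · rw [Function.update_of_ne (by omega), g4 a ha]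
    · rw [Function.update_apply]
      split_ifs with h
      · rw [h]
      · exact g5 v (by omega)
  · rintro s' ⟨-, -, -, -, h5⟩
    exact fun v => h5 v v.2

/-- The time for the solution of a game, if `TH` and `TE` are the times for the header and for an
evaluation of the winning condition. -/
def Layout.solveTime (L : Layout n) (TH TE : ℕ) : ℕ :=
  TH + TE + n * 27 + 40 + nodeTime n * (TE + L.attrTime + n * 100 + 100)

/-- The evaluation is needed under `Layout.Init` and not only under `Layout.Holds`: its first run
precedes the knowledge of the input length in register `4`. That run looks at meaningless codes from
address `0`, and only the final pointer in register `26` is kept. The hypothesis `hspace` provides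
`n + 1` frames behind the input and the scratch space. -/
theorem solves_solveProg {hdr ev : Prog} {TH TE : ℕ}
    (hstart : (State.start L.w).Bounded L.S) (h2 : 2 ≤ L.w.length)
    (hspace : L.w.length + n + (n + 1) * (n + 2) ≤ L.S)
    (hhdr : Runs L.S hdr (State.start L.w) TH fun s => L.Init s ∧ s.reg 5 = 0)
    (hev : ∀ s, L.Init s → s.reg 5 + n ≤ L.S → Runs L.S ev s TE fun s' => Agree s s' ∧
      s'.mem = s.mem ∧ s'.reg 26 = L.w.length ∧
      s'.reg 20 = winner cond (codeSet s n (s.reg 5))) :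
    Solves (solveProg hdr ev) (L.solveTime TH TE) L.S L.w (L.A.Win cond) := by
  have hS := L.le_S
  have how := L.ow_le
  have hpos := L.pos
  have hnn : Nonempty (Fin n) := ⟨⟨0, hpos⟩⟩
  suffices H : Runs L.S (solveProg hdr ev) (State.start L.w) (L.solveTime TH TE) fun s' =>
      ∃ c : Fin n → Player, L.A.Solved cond Set.univ c ∧ ∀ v : Fin n, s'.mem v = c v by
    obtain ⟨s', t, h1, h2, -, c, hc, h3⟩ := H hstart
    refine ⟨s', t, h1, h2, fun v => ?_⟩
    rw [h3]
    exact ⟨(c v).2, fun σ => by rw [Fin.val_inj, hc.mem_win_iff]⟩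
  have hev' : Evaluates L cond ev TE := fun s hs h => (hev s hs.init h).mono le_rfl
    fun s' h => ⟨h.1, h.2.1, h.2.2.2⟩
  unfold Layout.solveTime
  set B := TE + L.attrTime + n * 100 + 100 with hB
  refine Runs.seq hhdr (T₂ := TE + n * 27 + 40 + nodeTime n * B) ?_ (by omega)
  rintro s₀ ⟨hi, h5⟩
  refine Runs.seq (hev s₀ hi (by omega)) (T₂ := n * 27 + 40 + nodeTime n * B) ?_ (by omega)
  rintro s₁ ⟨a1, a2, a3, -⟩
  set p := L.w.length + n with hp
  refine Runs.seq (T₁ := 12) (T₂ := n * 27 + 20 + nodeTime n * B) (R := fun s' =>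
    L.At s' p (0 + 1) 0) (Runs.of_wp ?_ (by simp [setupProg, Prog.time, Exp.cost])) ?_ (by omega)
  · have e : ∀ i < 20, s₁.reg i = s₀.reg i := a1
    simp [setupProg, Prog.wp, Exp.Ok, Exp.val, a3, e, hi.r0]
    refine ⟨by omega, ⟨?_, ?_, ?_, ?_, ?_, ?_, ?_, ?_, ?_, ?_⟩, by simp [hp], by simp, by simp⟩
    iterate 9 simp [e, hi.r0, hi.r1, hi.r2, hi.r3, hi.r8, hi.r9, hi.r10, hi.r11]
    simp only [a2]
    exact hi.input
  intro s₂ b1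
  refine Runs.seq (T₂ := n * 14 + 14 + nodeTime n * B)
    (runs_fillProg b1.r0 b1.frame (S := L.S) (by nlinarith) (by omega)) ?_ (by omega)
  rintro s₃ ⟨c1, c2, c3⟩
  have hs₃ : L.At s₃ p (0 + 1) 0 := b1.of_agree c1 fun a ha => c2 a (Or.inl (by omega))
  refine Runs.seq (R := fun s' => L.At s' (p - (n + 2)) 0 2 ∧
      ∃ c : Fin n → Player, L.A.Solved cond Set.univ c ∧ ∀ v : Fin n, s'.mem (p + v) = c v)
    (runs_mainLoop hev' (B := B) hB.ge n Set.univ s₃ p 0 ?_ (fun v _ => ?_) hs₃ ?_ ?_ le_rfl hspace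
      (by omega) 2 _ ?_) (T₂ := n * 14 + 10) ?_ (by omega)
  · rw [Set.ncard_univ, Nat.card_eq_fintype_card, Fintype.card_fin]
  · obtain ⟨u, hu⟩ := L.A.total v
    exact ⟨u, Set.mem_univ _, hu⟩
  · exact Set.eq_univ_of_forall c3
  · intro v
    rw [c3 v]
    omega
  · intro s' c d1 _ _ d2 d3
    exact Runs.loop_exit (by simp [Exp.Ok]) (by simp [Exp.val, d1.depth])
      ⟨d1, c, d2, fun v => d3 v (Set.mem_univ _)⟩ (by simp [Exp.cost])
  · rintro s₄ ⟨e1, c, e2, e3⟩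
    -- The return from the first frame lowers the frame address by `n + 2`. Since the input has at
    -- least two cells, this subtraction is not truncated and the output routine can undo it.
    have hlen : n + 2 ≤ p := by omega
    refine (runs_outputProg e1.r0 e1.r11 hpos (p := p) (by rw [e1.frame]; omega)
      (by nlinarith) (by omega)).mono le_rfl fun s' hs' => ⟨c, e2, fun v => ?_⟩
    rw [hs', e3]

end Solve

end RegularGames

namespace RegularGames

/-! ### Codes of games -/

section Codes

open Prog Exp

variable {n : ℕ}

theorem Lists.length_eq {α : Type} {l : List α} {s : Finset α} (h : Lists l s) :
    l.length = s.card := by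
  classical
  rw [← List.toFinset_card_of_nodup h.1]
  congr 1
  ext x
  simp [h.2]

/-- Every position has an outgoing edge. Hence terms `n ^ 2` in the running time are absorbed by `n
* |E|`. -/
theorem Arena.le_card_edges (A : Arena (Fin n)) : n ≤ A.edges.card := by
  classical
  calc n = (Finset.univ : Finset (Fin n)).card := by simp
    _ ≤ (A.edges.image Prod.fst).card := Finset.card_le_card fun v _ => by
        obtain ⟨u, hu⟩ := A.total v
        exact Finset.mem_image.2 ⟨_, hu, rfl⟩
    _ ≤ A.edges.card := Finset.card_image_le

theorem exists_mem_iff_of_forall₂ {α β : Type} {R : α → β → Prop} {p : α → Prop} {q : β → Prop}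
    {l : List α} {l' : List β} (h : List.Forall₂ R l l') (hR : ∀ a b, R a b → (p a ↔ q b)) :
    (∃ a ∈ l, p a) ↔ ∃ b ∈ l', q b := by
  induction h with
  | nil => simp
  | cons h _ ih => simp [hR _ _ h, ih]

theorem reads_start (w : List ℕ) : Reads (State.start w) 0 w := fun j hj => by
  simp [State.start, hj]

theorem State.Bounded.start {S : ℕ} {w : List ℕ} (hS : 4 < S) (hw : ∀ x ∈ w, x < S) :
    (State.start w).Bounded S where
  four_lt := hS
  reg _ := by simp only [State.start]; omega
  mem a := by
    simp only [State.start]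
    by_cases ha : a < w.length
    · rw [List.getD_eq_getElem _ _ ha]
      exact hw _ (List.getElem_mem ha)
    · rw [List.getD_eq_default _ _ (by omega)]
      omega

theorem length_arenaCode (A : Arena (Fin n)) (es : List (Fin n × Fin n)) :
    (arenaCode A es).length = n + 2 * es.length := by
  simp [arenaCode]
  omega

theorem reads_edges {s : State} {a : ℕ} {es : List (Fin n × Fin n)}
    (h : Reads s a (es.flatMap fun e => [(e.1 : ℕ), (e.2 : ℕ)])) (j : ℕ) (hj : j < es.length) :
    s.mem (a + 2 * j) = es[j].1 ∧ s.mem (a + 2 * j + 1) = es[j].2 := by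
  induction es generalizing a j with
  | nil => simp at hj
  | cons e es ih =>
    rw [List.flatMap_cons, reads_append] at h
    cases j with
    | zero => exact ⟨h.1 0 (by simp), h.1 1 (by simp)⟩
    | succ j =>
      have := ih h.2 j (by simpa using hj)
      simp only [List.length_cons, List.length_nil] at this
      rw [show a + 2 * (j + 1) = a + (0 + 1 + 1) + 2 * j by omega]
      simpa using this

/-- The layout for an input that consists of a header, an arena and a list of pairs. -/
def Layout.ofCode (S : ℕ) (A : Arena (Fin n)) (es : List (Fin n × Fin n)) (hdr rest : List ℕ)
    (k kind : ℕ) (pos : 0 < n) (lists : Lists es A.edges)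
    (le_S : (hdr ++ arenaCode A es ++ rest).length + n < S) : Layout n :=
  have h := reads_start (hdr ++ arenaCode A es ++ rest)
  have h' := (reads_append.1 (reads_append.1 (reads_append.1 h).1).2)
  { S, A, es, k, kind, pos, lists, le_S
    w := hdr ++ arenaCode A es ++ rest
    ow := hdr.length
    ed := hdr.length + n
    ps := hdr.length + n + 2 * es.length
    ow_le := by
      simp only [List.length_append, length_arenaCode]
      omega
    ed_le := by
      simp only [List.length_append, length_arenaCode]
      omega
    owner := fun v => by
      have := h'.1 v (by simp)
      simpa [State.start] using this
    fst := fun j hj => by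
      have := (reads_edges h'.2 j hj).1
      simpa [State.start] using this
    snd := fun j hj => by
      have := (reads_edges h'.2 j hj).2
      simpa [State.start] using this }

theorem Layout.Init.reads {S : ℕ} {A : Arena (Fin n)} {es : List (Fin n × Fin n)}
    {hdr rest : List ℕ} {k kind : ℕ} {pos : 0 < n} {lists : Lists es A.edges}
    {le_S : (hdr ++ arenaCode A es ++ rest).length + n < S} {s : State}
    (h : (Layout.ofCode S A es hdr rest k kind pos lists le_S).Init s) :
    Reads s (s.reg 9) rest := by
  have hw : Reads s 0 (hdr ++ arenaCode A es ++ rest) := fun j hj => by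
    rw [Nat.zero_add, h.input j hj]
    exact List.getD_eq_getElem _ _ hj
  have := (reads_append.1 hw).2
  rw [List.length_append, length_arenaCode, Nat.zero_add, ← Nat.add_assoc] at this
  rwa [h.r9]

/-- Compute from the numbers in the header the addresses of the parts of the input. -/
def addressProg : Prog :=
  .seq (.set 3 (.add (.reg 2) (.reg 0)))
    (.seq (.set 9 (.add (.reg 3) (.mul (.lit 2) (.reg 1)))) (.set 11 (.add (.reg 0) (.lit 2))))

/-- Read the header of a Rabin or Streett game. -/
def pairHeaderProg : Prog :=
  .seq (.seq (.set 10 (.mem (.lit 0))) (.seq (.set 0 (.mem (.lit 1)))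
    (.seq (.set 1 (.mem (.lit 2))) (.seq (.set 8 (.mem (.lit 3))) (.set 2 (.lit 4)))))) addressProg

/-- Read the header of a KL game. -/
def klHeaderProg : Prog :=
  .seq (.seq (.set 0 (.mem (.lit 0))) (.seq (.set 1 (.mem (.lit 1)))
    (.seq (.set 8 (.mem (.lit 2))) (.set 2 (.lit 3))))) addressProg

theorem runs_pairHeaderProg {S : ℕ} {A : Arena (Fin n)} {es : List (Fin n × Fin n)}
    {rest : List ℕ} {k kind : ℕ} {pos : 0 < n} {lists : Lists es A.edges}
    {le_S : ([kind, n, es.length, k] ++ arenaCode A es ++ rest).length + n < S} :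
    let L := Layout.ofCode S A es [kind, n, es.length, k] rest k kind pos lists le_S
    Runs S pairHeaderProg (State.start L.w) 40 fun s => L.Init s ∧ s.reg 5 = 0 := by
  intro L
  have hS := le_S
  simp only [List.length_append, length_arenaCode, List.length_cons, List.length_nil] at hS
  refine Runs.of_wp ?_ (by simp [pairHeaderProg, addressProg, Prog.time, Exp.cost])
  simp [pairHeaderProg, addressProg, Prog.wp, Exp.Ok, Exp.val, State.start, L, Layout.ofCode]
  refine ⟨by omega, ⟨by omega, by omega⟩, by omega, ?_⟩
  constructor <;> simp

theorem runs_klHeaderProg {S : ℕ} {A : Arena (Fin n)} {es : List (Fin n × Fin n)}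
    {rest : List ℕ} {k : ℕ} {pos : 0 < n} {lists : Lists es A.edges}
    {le_S : ([n, es.length, k] ++ arenaCode A es ++ rest).length + n < S} :
    let L := Layout.ofCode S A es [n, es.length, k] rest k 0 pos lists le_S
    Runs S klHeaderProg (State.start L.w) 40 fun s => L.Init s ∧ s.reg 5 = 0 := by
  intro L
  have hS := le_S
  simp only [List.length_append, length_arenaCode, List.length_cons, List.length_nil] at hS
  refine Runs.of_wp ?_ (by simp [klHeaderProg, addressProg, Prog.time, Exp.cost])
  simp [klHeaderProg, addressProg, Prog.wp, Exp.Ok, Exp.val, State.start, L, Layout.ofCode]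
  refine ⟨by omega, ⟨by omega, by omega⟩, by omega, ?_⟩
  constructor <;> simp

/-- All lower terms are compared with `N = n * (|E| + k * n)`, using `1 ≤ n ≤ |E|`. The factor `n!`
comes from `nodeTime_le`, and `N` is the order of the cost of one step. -/
theorem Layout.solveTime_le (L : Layout n) {k TE : ℕ}
    (hTE : TE ≤ k * (n * 44 + 68) + n * 17 + 26) :
    L.solveTime 40 TE ≤ 10000 * (n.factorial * n * (L.A.edges.card + k * n)) := by
  have hn := L.pos
  have hE := L.A.le_card_edges
  have hnode := nodeTime_le n
  have hf := n.factorial_pos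
  rw [Layout.solveTime, Layout.attrTime, L.lists.length_eq]
  generalize L.A.edges.card = E at *
  generalize n.factorial = f at *
  have h1 : n ≤ n * E := Nat.le_mul_of_pos_right _ (by omega)
  have h2 : n * n ≤ n * E := Nat.mul_le_mul_left _ hE
  have h3 : k * n ≤ k * n * n := Nat.le_mul_of_pos_right _ hn
  have h4 : k ≤ k * n := Nat.le_mul_of_pos_right _ hn
  have hN : n * (E + k * n) = n * E + k * n * n := by ring
  have hTE' : k * (n * 44 + 68) = 44 * (k * n) + 68 * k := by ring
  have hA : n * (n * 45 + E * 45 + 26) = 45 * (n * n) + 45 * (n * E) + 26 * n := by ring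
  rw [Nat.mul_assoc f, hA]
  generalize n * (E + k * n) = N at *
  -- The number `391` is the sum of all coefficients that are charged to `n * |E|`; those charged to
  -- `k * n ^ 2` sum to `112` only. With the factor `24` this gives `9384`, and the work outside the
  -- main loop fits into the rest of `10000`.
  have hB : TE + (45 * (n * n) + 45 * (n * E) + 26 * n + n * 20 + 12) + n * 100 + 100 ≤
      391 * N := by omega
  have hprod := Nat.mul_le_mul hnode hB
  have hfN : N ≤ f * N := Nat.le_mul_of_pos_left _ hf
  have he : 24 * f * (391 * N) = 9384 * (f * N) := by ring
  omega

theorem lt_of_mem_setCode {l : List (Fin n)} (hl : l.Nodup) {x : ℕ} (hx : x ∈ setCode l) :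
    x ≤ n := by
  rw [setCode_eq, List.mem_cons] at hx
  rcases hx with rfl | hx
  · simpa using hl.length_le_card
  · obtain ⟨v, -, rfl⟩ := List.mem_map.1 hx
    exact v.2.le

theorem le_of_mem_arenaCode {A : Arena (Fin n)} {es : List (Fin n × Fin n)} {x : ℕ}
    (hx : x ∈ arenaCode A es) : x ≤ n + 1 := by
  simp only [arenaCode, List.mem_append, List.mem_map, List.mem_flatMap, List.mem_cons,
    List.not_mem_nil, or_false] at hx
  obtain ⟨v, -, rfl⟩ | ⟨e, -, rfl | rfl⟩ := hx <;> omega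

theorem length_setCode (l : List (Fin n)) : (setCode l).length = l.length + 1 := by
  simp [setCode_eq]

/-- Solvability of a coded game, from the properties of a program for the winning condition. -/
theorem solves_ofCode {hdr ev : Prog} {A : Arena (Fin n)} {es : List (Fin n × Fin n)}
    {cond : Set (Fin n) → Prop} {hd rest : List ℕ} {k kind m S TE : ℕ} (pos : 0 < n)
    (lists : Lists es A.edges) (hnm : n + es.length ≤ m)
    (hlen : (hd ++ arenaCode A es ++ rest).length ≤ 2 * m + 4) (h2 : 2 ≤ hd.length)
    (hhd : ∀ x ∈ hd, x ≤ m) (hrest : ∀ x ∈ rest, x ≤ n) (hS : S = 10000 * (m + n ^ 2))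
    (le_S : (hd ++ arenaCode A es ++ rest).length + n < S)
    (hTE : TE ≤ k * (n * 44 + 68) + n * 17 + 26)
    (hhdr : Runs S hdr (State.start (hd ++ arenaCode A es ++ rest)) 40 fun s =>
      (Layout.ofCode S A es hd rest k kind pos lists le_S).Init s ∧ s.reg 5 = 0)
    (hev : ∀ s, (Layout.ofCode S A es hd rest k kind pos lists le_S).Init s →
      s.reg 5 + n ≤ S → Runs S ev s TE fun s' => Agree s s' ∧
      s'.mem = s.mem ∧ s'.reg 26 = (hd ++ arenaCode A es ++ rest).length ∧
      s'.reg 20 = winner cond (codeSet s n (s.reg 5))) :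
    Solves (solveProg hdr ev) (10000 * (n.factorial * n * (A.edges.card + k * n))) S
      (hd ++ arenaCode A es ++ rest) (A.Win cond) := by
  -- With this, `10000 * (m + n ^ 2)` exceeds the input length, all numbers in the input and the
  -- total size of the frames, so the same `S` serves as memory and word bound.
  have hnn : n ≤ n ^ 2 := by nlinarith
  obtain ⟨s, t, h, ht, hs⟩ := solves_solveProg (cond := cond)
    (L := Layout.ofCode S A es hd rest k kind pos lists le_S)
    (State.Bounded.start (show 4 < S by omega) fun x hx => show x < S by
      rcases List.mem_append.1 hx with hx | hx
      · rcases List.mem_append.1 hx with hx | hx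
        · have := hhd x hx
          omega
        · have := le_of_mem_arenaCode hx
          omega
      · have := hrest x hx
        omega)
    (show 2 ≤ (hd ++ arenaCode A es ++ rest).length by simp only [List.length_append]; omega)
    (show (hd ++ arenaCode A es ++ rest).length + n + (n + 1) * (n + 2) ≤ S by nlinarith)
    hhdr hev
  exact ⟨s, t, h, ht.trans (Layout.solveTime_le _ hTE), hs⟩

end Codes

/-! ### Winning conditions of the coded games -/

section Games

variable {n : ℕ}

/-- The winning condition of a Rabin or Streett game. -/
def PairGame.Cond {V : Type} (G : PairGame V) (X : Set V) : Prop :=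
  match G.kind with
  | .rabin => RabinCond G.pairs X
  | .streett => StreettCond G.pairs X

theorem PairGame.win_eq {V : Type} (G : PairGame V) : G.Win = G.arena.Win G.Cond := by
  funext σ
  obtain ⟨_ | _, A, ps⟩ := G <;> rfl

theorem streettCond_iff {V : Type} (ps : List (Finset V × Finset V)) (X : Set V) :
    StreettCond ps X ↔ ¬ RabinCond ps X := by
  simp only [StreettCond, RabinCond, ← Set.not_nonempty_iff_eq_empty]
  push Not
  rfl

theorem exists_pairTest_iff {ps : List (List (Fin n) × List (Fin n))}
    {qs : List (Finset (Fin n) × Finset (Fin n))}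
    (h : List.Forall₂ (fun l p => Lists l.1 p.1 ∧ Lists l.2 p.2) ps qs) (X : Set (Fin n)) :
    (∃ x ∈ ps, PairTest X x) ↔ RabinCond qs X := by
  refine exists_mem_iff_of_forall₂ h fun l p hlp => ?_
  have key : ∀ {l : List (Fin n)} {s : Finset (Fin n)}, Lists l s →
      ((∃ v ∈ l, v ∈ X) ↔ (X ∩ (s : Set (Fin n))).Nonempty) := fun h =>
    ⟨fun ⟨v, hv, hX⟩ => ⟨v, hX, (h.2 v).1 hv⟩, fun ⟨v, hX, hv⟩ => ⟨v, (h.2 v).2 hv, hX⟩⟩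
  rw [PairTest, key hlp.1, key hlp.2, Set.not_nonempty_iff_eq_empty]

theorem exists_klTest_iff {ps : List (Fin n × List (Fin n))}
    {qs : List (Fin n × Finset (Fin n))}
    (h : List.Forall₂ (fun l p => l.1 = p.1 ∧ Lists l.2 p.2) ps qs) (X : Set (Fin n)) :
    (∃ x ∈ ps, KLTest X x) ↔ KLCond qs X := by
  refine exists_mem_iff_of_forall₂ h fun l p hlp => ?_
  rw [KLTest, hlp.1]
  exact and_congr_right' ⟨fun h v hv => (hlp.2.2 v).1 (h v hv),
    fun h v hv => (hlp.2.2 v).2 (h hv)⟩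

open Classical in
theorem PairGame.winner_eq (G : PairGame (Fin n)) (X : Set (Fin n)) :
    (winner G.Cond X : ℕ) = if (if RabinCond G.pairs X then 1 else 0) = G.kind.tag then 1 else 0 := by
  obtain ⟨_ | _, A, qs⟩ := G <;> by_cases h : RabinCond qs X <;>
    simp [winner, PairGame.Cond, PairKind.tag, streettCond_iff, h]

/-- The code spends a cell on the cardinality of each set, so a pair takes `2 + |U| + |W|` cells, at
most twice its share `1 + |U| + |W|` of the size. -/
theorem length_pairs_le {ps : List (List (Fin n) × List (Fin n))}
    {qs : List (Finset (Fin n) × Finset (Fin n))}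
    (h : List.Forall₂ (fun l p => Lists l.1 p.1 ∧ Lists l.2 p.2) ps qs) :
    (ps.flatMap fun l => setCode l.1 ++ setCode l.2).length ≤
      2 * (qs.map fun p => 1 + p.1.card + p.2.card).sum ∧
      ps.length ≤ (qs.map fun p => 1 + p.1.card + p.2.card).sum := by
  induction h with
  | nil => simp
  | cons h _ ih =>
    simp only [List.flatMap_cons, List.length_append, length_setCode, List.map_cons,
      List.sum_cons, List.length_cons, h.1.length_eq, h.2.length_eq]
    omega

theorem length_klPairs_le {ps : List (Fin n × List (Fin n))} {qs : List (Fin n × Finset (Fin n))}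
    (h : List.Forall₂ (fun l p => l.1 = p.1 ∧ Lists l.2 p.2) ps qs) :
    (ps.flatMap fun l => (l.1 : ℕ) :: setCode l.2).length ≤
      2 * (qs.map fun p => 1 + p.2.card).sum ∧
      ps.length ≤ (qs.map fun p => 1 + p.2.card).sum := by
  induction h with
  | nil => simp
  | cons h _ ih =>
    simp only [List.flatMap_cons, List.length_append, length_setCode, List.map_cons,
      List.sum_cons, List.length_cons, h.2.length_eq]
    omega

theorem PairGame.solves (G : PairGame (Fin n)) (hn : 0 < n) {w : List ℕ} (hw : G.IsCode w) :
    Solves (solveProg pairHeaderProg evalPairsProg)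
      (10000 * (n.factorial * n * (G.arena.edges.card + G.pairs.length * n)))
      (10000 * (G.size + n ^ 2)) w G.Win := by
  classical
  obtain ⟨es, ps, hes, hps, rfl⟩ := hw
  have hnodup : ∀ x ∈ ps, x.1.Nodup ∧ x.2.Nodup := by
    intro x hx
    obtain ⟨i, hi, rfl⟩ := List.getElem_of_mem hx
    have := hps.get hi (hps.length_eq ▸ hi)
    exact ⟨this.1.1, this.2.1⟩
  have hE := hes.length_eq
  have hsize := length_pairs_le hps
  have hm : G.size = n + es.length + (G.pairs.map fun p => 1 + p.1.card + p.2.card).sum := by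
    rw [PairGame.size, hE]
  have hEn := G.arena.le_card_edges
  have hlen : ([G.kind.tag, n, es.length, ps.length] ++ arenaCode G.arena es ++
      ps.flatMap fun l => setCode l.1 ++ setCode l.2).length = 4 + n + 2 * es.length +
      (ps.flatMap fun l => setCode l.1 ++ setCode l.2).length := by
    rw [List.length_append, List.length_append, length_arenaCode]
    simp only [List.length_cons, List.length_nil]
    omega
  have htag : G.kind.tag ≤ 1 := by cases G.kind <;> simp [PairKind.tag]
  rw [PairGame.win_eq, ← hps.length_eq]
  refine solves_ofCode (m := G.size) (kind := G.kind.tag) hn hes (by omega) (by omega)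
    (by simp) ?_ ?_ rfl (by omega) (TE := ps.length * (n * 44 + 68) + 14) (by omega)
    runs_pairHeaderProg ?_
  · simp only [List.mem_cons, List.not_mem_nil, or_false]
    rintro x (rfl | rfl | rfl | rfl) <;> omega
  · intro x hx
    obtain ⟨l, hl, hx⟩ := List.mem_flatMap.1 hx
    rcases List.mem_append.1 hx with hx | hx
    exacts [lt_of_mem_setCode (hnodup l hl).1 hx, lt_of_mem_setCode (hnodup l hl).2 hx]
  · intro s hs h5
    have h9 : s.reg 9 = 4 + n + 2 * es.length := hs.r9
    refine (runs_evalPairsProg hnodup hs.r8 hs.r10 hs.reads rfl ?_ rfl h5 (by omega)).mono le_rfl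
      fun s' h => ⟨h.1, h.2.1, ?_, ?_⟩
    · rw [h9]
      omega
    · rw [h.2.2.1, h9, hlen]
    · rw [h.2.2.2, PairGame.winner_eq]
      simp only [exists_pairTest_iff hps]
      rfl

theorem KLGame.solves (G : KLGame (Fin n)) (hn : 0 < n) {w : List ℕ} (hw : G.IsCode w) :
    Solves (solveProg klHeaderProg evalKLProg)
      (10000 * (n.factorial * n * (G.arena.edges.card + G.pairs.length * n)))
      (10000 * (G.size + n ^ 2)) w G.Win := by
  classical
  obtain ⟨es, ps, hes, hps, rfl⟩ := hw
  have hnodup : ∀ x ∈ ps, x.2.Nodup := by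
    intro x hx
    obtain ⟨i, hi, rfl⟩ := List.getElem_of_mem hx
    exact (hps.get hi (hps.length_eq ▸ hi)).2.1
  have hE := hes.length_eq
  have hsize := length_klPairs_le hps
  have hm : G.size = n + es.length + (G.pairs.map fun p => 1 + p.2.card).sum := by
    rw [KLGame.size, hE]
  have hEn := G.arena.le_card_edges
  have hlen : ([n, es.length, ps.length] ++ arenaCode G.arena es ++
      ps.flatMap fun l => (l.1 : ℕ) :: setCode l.2).length = 3 + n + 2 * es.length +
      (ps.flatMap fun l => (l.1 : ℕ) :: setCode l.2).length := by
    rw [List.length_append, List.length_append, length_arenaCode]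
    simp only [List.length_cons, List.length_nil]
    omega
  rw [show G.Win = G.arena.Win (KLCond G.pairs) from rfl, ← hps.length_eq]
  refine solves_ofCode (m := G.size) (kind := 0) hn hes (by omega) (by omega)
    (by simp) ?_ ?_ rfl (by omega) (TE := ps.length * (n * 44 + 68) + n * 17 + 26) le_rfl
    runs_klHeaderProg ?_
  · simp only [List.mem_cons, List.not_mem_nil, or_false]
    rintro x (rfl | rfl | rfl) <;> omega
  · intro x hx
    obtain ⟨l, hl, hx⟩ := List.mem_flatMap.1 hx
    rcases List.mem_cons.1 hx with rfl | hx
    exacts [l.1.2.le, lt_of_mem_setCode (hnodup l hl) hx]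
  · intro s hs h5
    have h9 : s.reg 9 = 3 + n + 2 * es.length := hs.r9
    refine (runs_evalKLProg hnodup hs.r0 hs.r8 hs.reads rfl ?_ rfl h5 (by omega)
      (by omega)).mono le_rfl fun s' h => ⟨h.1, h.2.1, ?_, ?_⟩
    · rw [h9]
      omega
    · rw [h.2.2.1, h9, hlen]
    · rw [h.2.2.2, winner]
      simp only [exists_klTest_iff hps]
      split_ifs <;> rfl

end Games

end RegularGames

theorem mainTheorem5 :
    (∃ (P : RegularGames.Prog) (C : ℕ),
      ∀ (n : ℕ) (_ : 0 < n) (G : RegularGames.PairGame (Fin n)) (w : List ℕ), G.IsCode w →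
        RegularGames.Solves P
          (C * (n.factorial * n * (G.arena.edges.card + G.pairs.length * n)))
          (C * (G.size + n ^ 2)) w G.Win) ∧
    (∃ (P : RegularGames.Prog) (C : ℕ),
      ∀ (n : ℕ) (_ : 0 < n) (G : RegularGames.KLGame (Fin n)) (w : List ℕ), G.IsCode w →
        RegularGames.Solves P
          (C * (n.factorial * n * (G.arena.edges.card + G.pairs.length * n)))
          (C * (G.size + n ^ 2)) w G.Win) :=
  ⟨⟨RegularGames.solveProg RegularGames.pairHeaderProg RegularGames.evalPairsProg, 10000,
      fun _ hn G _ hw => G.solves hn hw⟩,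
    ⟨RegularGames.solveProg RegularGames.klHeaderProg RegularGames.evalKLProg, 10000,
      fun _ hn G _ hw => G.solves hn hw⟩⟩
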